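/- Let $\Omega$ be either $\mathbb{R}$ or a bounded open interval $(a,b)$ with homogeneous Dirichlet or periodic boundary conditions, and write $H^1(\Omega)$ for the corresponding Sobolev space ($H^1_0(a,b)$ in the Dirichlet case, periodic $H^1$ in the periodic case). For an integer $n\ge 2$ and $0<\varepsilon<1$ let $$f_n^\varepsilon(\rho)=\begin{cases}\ln\rho, & \rho\ge\varepsilon^2,\\[2pt] \ln(\varepsilon^2)-\frac{n+1}{n}\left(1-\frac{\rho}{\varepsilon^2}\right)^n-\sum_{k=1}^{n-1}\frac1k\left(1-\frac{\rho}{\varepsilon^2}\right)^k, & 0\le\rho<\varepsilon^2,\end{cases}$$ and consider the energy-regularized logarithmic Schrödinger equation $$i\partial_t u^\varepsilon=-\partial_{xx}u^\varepsilon+u^\varepsilon f_n^\varepsilon(|u^\varepsilon|^2)\quad\text{in }\Omega,\qquad u^\varepsilon(\cdot,0)=u_0 .$$ Let $\Phi_A^t(v)=e^{it\Delta}v$, where $\Delta=\partial_{xx}$ carries the given boundary conditions, let $\Phi_B^t(v)=v\,e^{-itf_n^\varepsilon(|v|^2)}$, and for a time step $\tau>0$ define the Lie–Trotter splitting approximations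 by $u^{\varepsilon,0}=u_0$, $u^{\varepsilon,k+1}=\Phi_A^\tau(\Phi_B^\tau(u^{\varepsilon,k}))$, $k\ge 0$. Fix $\Omega$ with its boundary condition, $n\ge2$, $\tau_0>0$ and $M\ge 0$. Then there is $\varepsilon_0\in(0,1)$, depending only on these data, and for every $T>0$ there is a constant $C=C(n,\tau_0,T,M)>0$ (for the fixed $\Omega$), such that the following holds. If $0<\varepsilon\le\varepsilon_0$, if $u^\varepsilon\in L^\infty([0,T];H^1(\Omega))$ is a weak solution of the equation on $[0,T]$ with initial value $u_0$ and $\|u^\varepsilon\|_{L^\infty([0,T];H^1(\Omega))}\le M$, and if $0<\tau\le\tau_0$, then for all integers $k\ge0$ with $t_k:=k\tau\le T$ $$\|u^{\varepsilon,k}-u^\varepsilon(t_k)\|_{L^2(\Omega)}\le C\,\ln(\varepsilon^{-1})\,\tau^{1/2}.$$ -/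

import Mathlib

open MeasureTheory Set
open scoped ENNReal ContDiff FourierTransform ComplexConjugate

noncomputable section

namespace ERLogSE

/-- The regularized logarithm `f_n^ε`, the derivative of the regularized energy density `F_n^ε`:
it equals `log ρ` for `ρ ≥ ε²` and a polynomial of degree `n` in `ρ` for `ρ < ε²`. -/
def regLog (n : ℕ) (ε ρ : ℝ) : ℝ :=
  if ε ^ 2 ≤ ρ then Real.log ρ
  else Real.log (ε ^ 2) - ((n : ℝ) + 1) / n * (1 - ρ / ε ^ 2) ^ n
    - ∑ k ∈ Finset.Icc 1 (n - 1), 1 / (k : ℝ) * (1 - ρ / ε ^ 2) ^ k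

/-- A one-dimensional spatial domain `Ω` together with its boundary condition: the whole line, or
a bounded interval `(a, b)` with homogeneous Dirichlet or with periodic boundary condition. -/
inductive Domain1D : Type
  | line : Domain1D
  | dirichlet (a b : ℝ) (hab : a < b) : Domain1D
  | periodic (a b : ℝ) (hab : a < b) : Domain1D

/-- Lebesgue measure on `Ω`. -/
def Domain1D.vol : Domain1D → Measure ℝ
  | .line => volume
  | .dirichlet a b _ => volume.restrict (Ioo a b)
  | .periodic a b _ => volume.restrict (Ioo a b)

/-- The complex Hilbert space `L²(Ω)`. -/
abbrev Domain1D.L2 (S : Domain1D) : Type := Lp ℂ 2 S.vol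

/-- Smooth test functions: compactly supported in `Ω`, or, in the periodic case, `(b - a)`-periodic
on the line (that is, smooth functions on the torus). -/
def Domain1D.IsTest (S : Domain1D) (φ : ℝ → ℂ) : Prop :=
  ContDiff ℝ ∞ φ ∧
    match S with
    | .line => HasCompactSupport φ
    | .dirichlet a b _ => HasCompactSupport φ ∧ tsupport φ ⊆ Ioo a b
    | .periodic a b _ => Function.Periodic φ (b - a)

/-- `w` is the weak derivative of `v`. -/
def Domain1D.HasWeakDeriv (S : Domain1D) (v w : S.L2) : Prop :=
  ∀ φ : ℝ → ℂ, S.IsTest φ → ∫ x, v x * deriv φ x ∂S.vol = - ∫ x, w x * φ x ∂S.vol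

/-- The pair `(v, w)` is an `H¹`-limit of test functions. -/
def Domain1D.IsLimitOfTests (S : Domain1D) (v w : S.L2) : Prop :=
  ∀ δ : ℝ, 0 < δ → ∃ φ : ℝ → ℂ, S.IsTest φ ∧
    eLpNorm (fun x => v x - φ x) 2 S.vol ≤ ENNReal.ofReal δ ∧
    eLpNorm (fun x => w x - deriv φ x) 2 S.vol ≤ ENNReal.ofReal δ

/-- `v` lies in the Sobolev space of order one that belongs to `S`, with derivative `w`.  The space
is `H¹(ℝ)`, or `H¹₀(a, b)` (the `H¹`-closure of the test functions), or the periodic `H¹`. -/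
def Domain1D.IsH1 (S : Domain1D) (v w : S.L2) : Prop :=
  S.HasWeakDeriv v w ∧
    match S with
    | .line => True
    | .dirichlet a b hab => (Domain1D.dirichlet a b hab).IsLimitOfTests v w
    | .periodic _ _ _ => True

/-- Membership in `H¹(ℝ)`, `H¹₀(a, b)`, or the periodic `H¹(a, b)`. -/
def Domain1D.MemH1 (S : Domain1D) (v : S.L2) : Prop := ∃ w : S.L2, S.IsH1 v w

open Classical in
/-- The (unique) weak derivative of an element of `H¹`; zero outside `H¹`. -/
def Domain1D.weakDeriv (S : Domain1D) (v : S.L2) : S.L2 :=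
  if h : S.MemH1 v then Classical.choose h else 0

/-- The `H¹` norm of an element of `H¹`. -/
def Domain1D.h1Norm (S : Domain1D) (v : S.L2) : ℝ :=
  √(‖v‖ ^ 2 + ‖S.weakDeriv v‖ ^ 2)

/-- The norm of `L^∞([0, T]; H¹)`. -/
def Domain1D.linftyH1Norm (S : Domain1D) (T : ℝ) (u : ℝ → S.L2) : ℝ≥0∞ :=
  eLpNorm (fun t => S.h1Norm (u t)) ⊤ (volume.restrict (Icc 0 T))

/-- `u ∈ L^∞([0, T]; H¹)`. -/
def Domain1D.MemLinftyH1 (S : Domain1D) (T : ℝ) (u : ℝ → S.L2) : Prop :=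
  AEStronglyMeasurable u (volume.restrict (Icc 0 T)) ∧
    (∀ᵐ t ∂(volume.restrict (Icc 0 T)), S.MemH1 (u t)) ∧
    S.linftyH1Norm T u < ⊤

/-- `u ∈ L^∞([0, T]; H¹)` is a weak solution on `[0, T]` of
`i ∂ₜ u = -∂ₓₓ u + u f_n^ε(|u|²)`, `u(0) = u₀`: the equation holds in the dual space of `H¹`
(of `H¹₀` for Dirichlet conditions), integrated in time from `0` to any `t ∈ [0, T]`.  This fixes
`u(t) ∈ L²` for every `t ∈ [0, T]`. -/
structure IsWeakSolution (S : Domain1D) (n : ℕ) (ε T : ℝ) (u₀ : S.L2) (u : ℝ → S.L2) : Prop where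
  memLinftyH1 : S.MemLinftyH1 T u
  init : u 0 = u₀
  weak_eq : ∀ φ : S.L2, S.MemH1 φ → ∀ t ∈ Icc 0 T,
    Complex.I * (inner ℂ φ (u t) - inner ℂ φ u₀) =
      ∫ s in (0 : ℝ)..t, (inner ℂ (S.weakDeriv φ) (S.weakDeriv (u s))
        + ∫ x, conj (φ x) * (u s x * (regLog n ε (‖u s x‖ ^ 2) : ℂ)) ∂S.vol)

theorem memLp_phase_mul {μ : Measure ℝ} {θ : ℝ → ℝ} (hθ : AEStronglyMeasurable θ μ)
    (v : Lp ℂ 2 μ) : MemLp (fun x => Complex.exp (Complex.I * (θ x : ℂ)) * v x) 2 μ := by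
  refine (Lp.memLp v).of_le ?_ (Filter.Eventually.of_forall fun x => ?_)
  · refine AEStronglyMeasurable.mul ?_ (Lp.aestronglyMeasurable v)
    exact (by fun_prop : Continuous fun y : ℝ => Complex.exp (Complex.I * (y : ℂ))
      ).comp_aestronglyMeasurable hθ
  · rw [norm_mul, mul_comm Complex.I, Complex.norm_exp_ofReal_mul_I, one_mul]

/-- Multiplication of an `L²` function by the phase `exp(iθ)`. -/
def phaseMul {μ : Measure ℝ} (θ : ℝ → ℝ) (hθ : AEStronglyMeasurable θ μ) (v : Lp ℂ 2 μ) :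
    Lp ℂ 2 μ :=
  (memLp_phase_mul hθ v).toLp _

theorem measurable_regLog (n : ℕ) (ε : ℝ) : Measurable (regLog n ε) := by
  unfold regLog
  refine Measurable.ite measurableSet_Ici Real.measurable_log ?_
  exact Continuous.measurable (by fun_prop)

theorem aestronglyMeasurable_regLog {μ : Measure ℝ} (n : ℕ) (ε t : ℝ) (v : Lp ℂ 2 μ) :
    AEStronglyMeasurable (fun x => -t * regLog n ε (‖v x‖ ^ 2)) μ :=
  (((measurable_regLog n ε).comp_aemeasurable
    ((Lp.aestronglyMeasurable v).norm.aemeasurable.pow_const 2)).const_mul (-t)).aestronglyMeasurable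

/-- The flow `Φ_B^t(w) = w exp(-i t f_n^ε(|w|²))` of the nonlinear subproblem. -/
def flowB (S : Domain1D) (n : ℕ) (ε t : ℝ) (w : S.L2) : S.L2 :=
  phaseMul (fun x => -t * regLog n ε (‖w x‖ ^ 2)) (aestronglyMeasurable_regLog n ε t w) w

theorem memLp_sine (a b : ℝ) (k : ℕ) :
    MemLp (fun x : ℝ => ((√(2 / (b - a)) * Real.sin ((k + 1) * Real.pi * (x - a) / (b - a)) : ℝ) : ℂ))
      2 (volume.restrict (Ioo a b)) := by
  refine MemLp.of_bound (Continuous.aestronglyMeasurable (by fun_prop)) (√(2 / (b - a)))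
    (Filter.Eventually.of_forall fun x => ?_)
  rw [Complex.norm_real, Real.norm_eq_abs, abs_mul, abs_of_nonneg (Real.sqrt_nonneg _)]
  exact mul_le_of_le_one_right (Real.sqrt_nonneg _) (Real.abs_sin_le_one _)

/-- The normalized Dirichlet eigenfunction `√(2/(b-a)) sin((k+1)π(x-a)/(b-a))` of `-Δ`. -/
def sineMode (a b : ℝ) (k : ℕ) : Lp ℂ 2 (volume.restrict (Ioo a b)) :=
  (memLp_sine a b k).toLp _

theorem memLp_expMode (a b : ℝ) (k : ℤ) :
    MemLp (fun x : ℝ => ((√(b - a))⁻¹ : ℂ) *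
      Complex.exp (Complex.I * ((2 * Real.pi * k * (x - a) / (b - a) : ℝ) : ℂ)))
      2 (volume.restrict (Ioo a b)) := by
  refine MemLp.of_bound (Continuous.aestronglyMeasurable (by fun_prop)) ‖((√(b - a))⁻¹ : ℂ)‖
    (Filter.Eventually.of_forall fun x => ?_)
  rw [norm_mul, mul_comm Complex.I, Complex.norm_exp_ofReal_mul_I, mul_one]

/-- The normalized periodic eigenfunction `(b-a)^{-1/2} exp(2πik(x-a)/(b-a))` of `-Δ`. -/
def expMode (a b : ℝ) (k : ℤ) : Lp ℂ 2 (volume.restrict (Ioo a b)) :=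
  (memLp_expMode a b k).toLp _

/-- `e^{itΔ}` on `L²(ℝ)`: the Fourier multiplier `exp(-4π²itξ²)`. -/
def lineFlow (t : ℝ) (v : Lp ℂ 2 (volume : Measure ℝ)) : Lp ℂ 2 (volume : Measure ℝ) :=
  𝓕⁻ (phaseMul (fun ξ => -t * (2 * Real.pi * ξ) ^ 2)
    (Continuous.aestronglyMeasurable (by fun_prop)) (𝓕 v))

/-- `e^{itΔ}` on `L²(a, b)` for the Dirichlet Laplacian, by expansion in its eigenfunctions. -/
def dirichletFlow (a b t : ℝ) (v : Lp ℂ 2 (volume.restrict (Ioo a b))) :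
    Lp ℂ 2 (volume.restrict (Ioo a b)) :=
  ∑' k : ℕ, Complex.exp (Complex.I * ((-t * ((k + 1) * Real.pi / (b - a)) ^ 2 : ℝ) : ℂ)) •
    ((inner ℂ (sineMode a b k) v : ℂ) • sineMode a b k)

/-- `e^{itΔ}` on `L²(a, b)` for the periodic Laplacian, by expansion in its eigenfunctions. -/
def periodicFlow (a b t : ℝ) (v : Lp ℂ 2 (volume.restrict (Ioo a b))) :
    Lp ℂ 2 (volume.restrict (Ioo a b)) :=
  ∑' k : ℤ, Complex.exp (Complex.I * ((-t * (2 * Real.pi * k / (b - a)) ^ 2 : ℝ) : ℂ)) •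
    ((inner ℂ (expMode a b k) v : ℂ) • expMode a b k)

/-- The flow `Φ_A^t = e^{itΔ}` of the linear subproblem on `L²(Ω)`. -/
def flowA : (S : Domain1D) → ℝ → S.L2 → S.L2
  | .line, t, v => lineFlow t v
  | .dirichlet a b _, t, v => dirichletFlow a b t v
  | .periodic a b _, t, v => periodicFlow a b t v

/-- The Lie–Trotter splitting `u^{k+1} = Φ_A^τ(Φ_B^τ(u^k))`, `u^0 = u₀`. -/
def lieTrotter (S : Domain1D) (n : ℕ) (ε τ : ℝ) (u₀ : S.L2) : ℕ → S.L2
  | 0 => u₀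
  | k + 1 => flowA S τ (flowB S n ε τ (lieTrotter S n ε τ u₀ k))

end ERLogSE

end

open MeasureTheory Set
open scoped ENNReal ContDiff FourierTransform ComplexConjugate

noncomputable section

namespace ERLogSE

open Filter Topology

/-! ### The regularized logarithm -/

/-! The proof is stability plus local error, arranged so that log(1/ε) enters only through the local
error. For r ≤ s one has r|f(r²) − f(s²)| ≤ 4n(s − r) with no ε in the constant
(`mul_abs_regLog_sub_le`). Hence Φ_B^τ is Lipschitz on L² with constant 1 + 4nτ
(`norm_flowB_sub_le`); Φ_A^τ is an isometry, so errors are amplified at most by exp(4nT).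

For the local error let F(v) = v f(|v|²). On |z| ≤ B this is Lipschitz with a constant K
proportional to log(1/ε), and the embedding of H¹ into L^∞ supplies B. Cutting f off at B makes F
globally Lipschitz, so it acts on L² and maps H¹ to H¹, enlarging the norm of the derivative at most
by the factor K. Over one step from u = u(t), both Φ_B^τ(u) and e^{-iτΔ}u(t+τ) are compared with u −
iτF(u). The expansion of the phase costs τ²K². Duhamel's formula costs τ times the variation of
e^{-isΔ}F(u(t+s)) for 0 ≤ s ≤ τ, which is of order √τ K + τK² because e^{isΔ} moves an H¹ function v
by at most √(2|s|)‖v'‖ in L² (`IsWeakSolution.norm_step_sub_le`). Summation over the steps gives K√τ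
+ K²τ. If log(1/ε)√τ ≤ 1, the second term is absorbed by the first; otherwise conservation of the L²
norm makes the claim trivial (`SpectralData.exists_error_bound`).

The solution is only measurable in time, with its H¹ bound at almost every time. Testing the
equation with spectrally truncated functions gives an integral equation in L² for P_N u
(`IsWeakSolution.P_eq`). The tails u − P_N u are uniformly small, so u is continuous into L², and
every u(t) lies in the L² closure of the H¹ ball. All bounds needed at a fixed time are closed under
L² limits, hence hold on that closure.

The properties of the Laplacian that this uses are collected in `SpectralData`. For the two interval
problems they come from an orthonormal eigenbasis (`SpectralData.nonempty_of_basis`), for the line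
from the Fourier transform (`nonempty_spectralData_line`). -/

/-- The polynomial branch of `regLog`, as a function of `y = 1 - ρ / ε²`. -/
def regPoly (n : ℕ) (y : ℝ) : ℝ :=
  ((n : ℝ) + 1) / n * y ^ n + ∑ k ∈ Finset.Icc 1 (n - 1), 1 / (k : ℝ) * y ^ k

theorem regLog_of_le_sq {n : ℕ} {ε r : ℝ} (hε : 0 < ε) (h : ε ≤ r) :
    regLog n ε (r ^ 2) = 2 * Real.log r := by
  rw [regLog, if_pos (by gcongr), Real.log_pow]; norm_num

/-- The branches agree at r = ε because `regPoly` vanishes at 0. Each formula thus holds on a closed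
range, and estimates on the two sides can be joined at ε. -/
theorem regLog_of_sq_le {n : ℕ} (hn : 1 ≤ n) {ε r : ℝ} (hε : 0 < ε) (hr : 0 ≤ r) (h : r ≤ ε) :
    regLog n ε (r ^ 2) = 2 * Real.log ε - regPoly n (1 - r ^ 2 / ε ^ 2) := by
  rcases h.lt_or_eq with h | rfl
  · rw [regLog, if_neg (not_le.2 (by gcongr)), regPoly, Real.log_pow]; push_cast; ring
  · rw [regLog_of_le_sq hε le_rfl, regPoly, div_self (by positivity), sub_self,
      zero_pow (by lia), Finset.sum_eq_zero]
    · simp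
    · intro k hk
      rw [zero_pow (by rw [Finset.mem_Icc] at hk; lia), mul_zero]

theorem abs_pow_sub_pow_le {x y : ℝ} (hx : 0 ≤ x) (hx1 : x ≤ 1) (hy : 0 ≤ y) (hy1 : y ≤ 1) (k : ℕ) :
    |x ^ k - y ^ k| ≤ k * |x - y| := by
  induction k with
  | zero => simp
  | succ k ih =>
    have : x ^ (k + 1) - y ^ (k + 1) = x * (x ^ k - y ^ k) + y ^ k * (x - y) := by ring
    rw [this]
    refine (abs_add_le _ _).trans ?_
    rw [abs_mul, abs_mul, abs_of_nonneg hx, abs_of_nonneg (pow_nonneg hy k)]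
    have h1 : x * |x ^ k - y ^ k| ≤ 1 * (k * |x - y|) := by gcongr
    have h2 : y ^ k * |x - y| ≤ 1 * |x - y| := by gcongr; exact pow_le_one₀ hy hy1
    push_cast; linarith

/-- On [0, 1] the power y^k is k-Lipschitz. The leading term contributes n + 1 and each of the n − 1
terms of the sum contributes 1. -/
theorem abs_regPoly_sub_le {n : ℕ} (hn : 1 ≤ n) {x y : ℝ} (hx : 0 ≤ x) (hx1 : x ≤ 1)
    (hy : 0 ≤ y) (hy1 : y ≤ 1) : |regPoly n x - regPoly n y| ≤ 2 * n * |x - y| := by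
  have hn' : (0 : ℝ) < n := by exact_mod_cast hn
  have e : regPoly n x - regPoly n y = ((n : ℝ) + 1) / n * (x ^ n - y ^ n)
      + ∑ k ∈ Finset.Icc 1 (n - 1), 1 / (k : ℝ) * (x ^ k - y ^ k) := by
    rw [regPoly, regPoly]; simp_rw [mul_sub]; rw [Finset.sum_sub_distrib]; ring
  have h1 : |((n : ℝ) + 1) / n * (x ^ n - y ^ n)| ≤ (n + 1) * |x - y| := by
    rw [abs_mul, abs_of_nonneg (by positivity)]
    calc ((n : ℝ) + 1) / n * |x ^ n - y ^ n| ≤ ((n : ℝ) + 1) / n * (n * |x - y|) := by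
          gcongr; exact abs_pow_sub_pow_le hx hx1 hy hy1 n
      _ = _ := by field_simp
  have h2 : |∑ k ∈ Finset.Icc 1 (n - 1), 1 / (k : ℝ) * (x ^ k - y ^ k)| ≤ (n - 1) * |x - y| := by
    refine (Finset.abs_sum_le_sum_abs _ _).trans ?_
    have : ∀ k ∈ Finset.Icc 1 (n - 1), |1 / (k : ℝ) * (x ^ k - y ^ k)| ≤ |x - y| := by
      intro k hk
      have hk' : (0 : ℝ) < k := by
        rw [Finset.mem_Icc] at hk; exact_mod_cast hk.1
      rw [abs_mul, abs_of_nonneg (by positivity)]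
      calc 1 / (k : ℝ) * |x ^ k - y ^ k| ≤ 1 / (k : ℝ) * (k * |x - y|) := by
            gcongr; exact abs_pow_sub_pow_le hx hx1 hy hy1 k
        _ = _ := by field_simp
    refine (Finset.sum_le_card_nsmul _ _ _ this).trans_eq ?_
    simp [Nat.cast_sub hn]
  rw [e]
  refine (abs_add_le _ _).trans ?_
  linarith

theorem regPoly_zero {n : ℕ} (hn : 1 ≤ n) : regPoly n 0 = 0 := by
  rw [regPoly, zero_pow (by lia), Finset.sum_eq_zero]
  · simp
  · intro k hk
    rw [zero_pow (by rw [Finset.mem_Icc] at hk; lia), mul_zero]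

theorem one_sub_sq_div_mem {ε r : ℝ} (hε : 0 < ε) (hr : 0 ≤ r) (h : r ≤ ε) :
    0 ≤ 1 - r ^ 2 / ε ^ 2 ∧ 1 - r ^ 2 / ε ^ 2 ≤ 1 := by
  have : r ^ 2 / ε ^ 2 ≤ 1 := by rw [div_le_one (by positivity)]; gcongr
  have : 0 ≤ r ^ 2 / ε ^ 2 := by positivity
  constructor <;> linarith

/-- `r ↦ f(r²)` has a logarithmic modulus of continuity, uniformly in `ε`. -/
theorem mul_abs_regLog_sub_le {n : ℕ} (hn : 1 ≤ n) {ε r s : ℝ} (hε : 0 < ε) (hr : 0 ≤ r)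
    (hrs : r ≤ s) : r * |regLog n ε (r ^ 2) - regLog n ε (s ^ 2)| ≤ 4 * n * (s - r) := by
  have hn' : (1 : ℝ) ≤ n := by exact_mod_cast hn
  -- Above ε: log(s/r) ≤ s/r − 1, and the factor r cancels the denominator.
  have upper : ∀ {r s : ℝ}, ε ≤ r → r ≤ s →
      r * |regLog n ε (r ^ 2) - regLog n ε (s ^ 2)| ≤ 4 * n * (s - r) := by
    intro r s hr hrs
    have hr0 := hε.trans_le hr
    have hs0 := hr0.trans_le hrs
    rw [regLog_of_le_sq hε hr, regLog_of_le_sq hε (hr.trans hrs), abs_sub_comm,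
      ← mul_sub, ← Real.log_div hs0.ne' hr0.ne', abs_of_nonneg]
    · have := Real.log_le_sub_one_of_pos (div_pos hs0 hr0)
      calc r * (2 * Real.log (s / r)) ≤ r * (2 * (s / r - 1)) := by gcongr
        _ = 2 * (s - r) := by field_simp
        _ ≤ 4 * n * (s - r) := by gcongr; linarith
    · have := Real.log_nonneg ((one_le_div hr0).2 hrs)
      positivity
  -- Below ε: the polynomial has Lipschitz constant 2n/ε² in the variable r², and r(s + r) ≤ 2ε²
  -- removes the ε.
  have lower : ∀ {r s : ℝ}, 0 ≤ r → r ≤ s → s ≤ ε →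
      r * |regLog n ε (r ^ 2) - regLog n ε (s ^ 2)| ≤ 4 * n * (s - r) := by
    intro r s hr hrs hs
    have hs0 := hr.trans hrs
    obtain ⟨a1, a2⟩ := one_sub_sq_div_mem hε hr (hrs.trans hs)
    obtain ⟨b1, b2⟩ := one_sub_sq_div_mem hε hs0 hs
    rw [regLog_of_sq_le hn hε hr (hrs.trans hs), regLog_of_sq_le hn hε hs0 hs, sub_sub_sub_cancel_left]
    have h1 := abs_regPoly_sub_le hn b1 b2 a1 a2
    have h2 : |1 - s ^ 2 / ε ^ 2 - (1 - r ^ 2 / ε ^ 2)| = (s - r) * (s + r) / ε ^ 2 := by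
      rw [abs_sub_comm, sub_sub_sub_cancel_left, abs_of_nonneg (by rw [sub_nonneg]; gcongr)]
      field_simp
      ring
    rw [h2] at h1
    have h3 : r * ((s - r) * (s + r) / ε ^ 2) ≤ 2 * (s - r) := by
      rw [← mul_div_assoc, div_le_iff₀ (by positivity)]
      have : r * (s + r) ≤ ε * (ε + ε) := by
        have := hrs.trans hs
        gcongr
      nlinarith [mul_le_mul_of_nonneg_left this (sub_nonneg.2 hrs)]
    calc _ ≤ r * (2 * n * ((s - r) * (s + r) / ε ^ 2)) := by gcongr
      _ = 2 * n * (r * ((s - r) * (s + r) / ε ^ 2)) := by ring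
      _ ≤ 2 * n * (2 * (s - r)) := by gcongr
      _ = _ := by ring
  rcases le_total ε r with h | h
  · exact upper h hrs
  rcases le_total s ε with h' | h'
  · exact lower hr hrs h'
  -- If r ≤ ε ≤ s, both cases are joined at ε; on the upper piece the weight r is enlarged to ε.
  have h1 := lower hr h le_rfl
  have h2 := upper le_rfl h'
  have h3 : r * |regLog n ε (ε ^ 2) - regLog n ε (s ^ 2)| ≤
      ε * |regLog n ε (ε ^ 2) - regLog n ε (s ^ 2)| := by gcongr
  have h4 := mul_le_mul_of_nonneg_left
    (abs_sub_le (regLog n ε (r ^ 2)) (regLog n ε (ε ^ 2)) (regLog n ε (s ^ 2))) hr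
  linarith

/-- Above ε the logarithm lies between log ε and log B; below ε the polynomial lowers 2 log ε by at
most 2n. Since log(1/ε) ≥ 1, the constants can be multiplied by it. -/
theorem abs_regLog_le {n : ℕ} (hn : 1 ≤ n) {ε r B : ℝ} (hε : 0 < ε) (hL : 1 ≤ Real.log ε⁻¹)
    (hB : 1 ≤ B) (hr : 0 ≤ r) (hrB : r ≤ B) :
    |regLog n ε (r ^ 2)| ≤ (2 + 2 * n + 2 * Real.log B) * Real.log ε⁻¹ := by
  have hn' : (1 : ℝ) ≤ n := by exact_mod_cast hn
  have hB' := Real.log_nonneg hB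
  have hle : Real.log ε = - Real.log ε⁻¹ := by rw [Real.log_inv, neg_neg]
  have key : 2 * Real.log ε⁻¹ + 2 * n + 2 * Real.log B ≤
      (2 + 2 * n + 2 * Real.log B) * Real.log ε⁻¹ := by nlinarith
  refine le_trans ?_ key
  rcases le_total ε r with h | h
  · rw [regLog_of_le_sq hε h, abs_le]
    have h1 := Real.log_le_log (hε.trans_le h) hrB
    have h2 := Real.log_le_log hε h
    constructor <;> linarith
  · rw [regLog_of_sq_le hn hε hr h]
    obtain ⟨a1, a2⟩ := one_sub_sq_div_mem hε hr h
    have h1 := abs_regPoly_sub_le hn a1 a2 le_rfl zero_le_one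
    rw [regPoly_zero hn, sub_zero, sub_zero, abs_of_nonneg a1] at h1
    have h2 := abs_le.1 (h1.trans (mul_le_mul_of_nonneg_left a2 (by positivity)))
    rw [abs_le]
    constructor <;> linarith

/-! ### The truncated nonlinearity -/

/-- The nonlinearity `z f(|z|²)`, with the argument of `f` cut off at `|z| = B`. -/
def cutNonlin (n : ℕ) (ε B : ℝ) (z : ℂ) : ℂ :=
  z * (regLog n ε (min ‖z‖ B ^ 2) : ℂ)

theorem cutNonlin_zero (n : ℕ) (ε B : ℝ) : cutNonlin n ε B 0 = 0 := by simp [cutNonlin]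

theorem cutNonlin_of_le {n : ℕ} {ε B : ℝ} {z : ℂ} (h : ‖z‖ ≤ B) :
    cutNonlin n ε B z = z * (regLog n ε (‖z‖ ^ 2) : ℂ) := by
  rw [cutNonlin, min_eq_left h]

/-- Factor `K` with which the nonlinearity is Lipschitz on `|z| ≤ B`, divided by `log (1/ε)`. -/
def lipFactor (n : ℕ) (B : ℝ) : ℝ := 2 + 6 * n + 2 * Real.log B

theorem lipFactor_nonneg (n : ℕ) {B : ℝ} (hB : 1 ≤ B) : 0 ≤ lipFactor n B := by
  have := Real.log_nonneg hB
  rw [lipFactor]; positivity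

theorem abs_regLog_le_lipFactor {n : ℕ} (hn : 1 ≤ n) {ε r B : ℝ} (hε : 0 < ε)
    (hL : 1 ≤ Real.log ε⁻¹) (hB : 1 ≤ B) (hr : 0 ≤ r) (hrB : r ≤ B) :
    |regLog n ε (r ^ 2)| ≤ lipFactor n B * Real.log ε⁻¹ := by
  refine (abs_regLog_le hn hε hL hB hr hrB).trans ?_
  rw [lipFactor]
  gcongr
  norm_num

/-- With |w| ≤ |z| the difference is (z − w)g(z) + w(g(z) − g(w)). The first term is controlled by
the sup bound of f, the second by its logarithmic modulus of continuity, for which the smaller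
modulus |w| is the weight required. -/
theorem norm_cutNonlin_sub_le {n : ℕ} (hn : 1 ≤ n) {ε B : ℝ} (hε : 0 < ε)
    (hL : 1 ≤ Real.log ε⁻¹) (hB : 1 ≤ B) (z w : ℂ) :
    ‖cutNonlin n ε B z - cutNonlin n ε B w‖ ≤ lipFactor n B * Real.log ε⁻¹ * ‖z - w‖ := by
  wlog h : ‖w‖ ≤ ‖z‖ generalizing z w
  · rw [norm_sub_rev, norm_sub_rev z]; exact this w z (le_of_not_ge h)
  have hn' : (1 : ℝ) ≤ n := by exact_mod_cast hn
  set g : ℂ → ℝ := fun z => regLog n ε (min ‖z‖ B ^ 2) with hg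
  have e : cutNonlin n ε B z - cutNonlin n ε B w = (z - w) * (g z : ℂ) + w * ((g z - g w : ℝ) : ℂ) := by
    simp only [cutNonlin, hg]; push_cast; ring
  have h1 : |g z| ≤ (2 + 2 * n + 2 * Real.log B) * Real.log ε⁻¹ :=
    abs_regLog_le hn hε hL hB (le_min (norm_nonneg _) (by linarith)) (min_le_right _ _)
  have h2 : ‖w‖ * |g z - g w| ≤ 4 * n * ‖z - w‖ := by
    rcases le_total B ‖w‖ with hw | hw
    · simp only [hg]
      rw [min_eq_right hw, min_eq_right (hw.trans h), sub_self, abs_zero, mul_zero]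
      positivity
    · have := mul_abs_regLog_sub_le hn hε (norm_nonneg w) (s := min ‖z‖ B) (le_min h hw)
      simp only [hg]
      rw [min_eq_left hw, abs_sub_comm]
      refine this.trans ?_
      gcongr
      have := norm_sub_norm_le z w
      have := min_le_left ‖z‖ B
      linarith
  rw [e]
  refine (norm_add_le _ _).trans ?_
  rw [norm_mul, norm_mul, Complex.norm_real, Complex.norm_real, Real.norm_eq_abs, Real.norm_eq_abs]
  have h3 : ‖z - w‖ * |g z| ≤ ‖z - w‖ * ((2 + 2 * n + 2 * Real.log B) * Real.log ε⁻¹) := by gcongr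
  -- This 4n and the 2n of the sup bound make up the 6n in `lipFactor`.
  have h4 : 4 * n * ‖z - w‖ ≤ 4 * n * ‖z - w‖ * Real.log ε⁻¹ :=
    le_mul_of_one_le_right (by positivity) hL
  rw [lipFactor]
  linarith

theorem lipschitzWith_cutNonlin {n : ℕ} (hn : 1 ≤ n) {ε B : ℝ} (hε : 0 < ε)
    (hL : 1 ≤ Real.log ε⁻¹) (hB : 1 ≤ B) :
    LipschitzWith (lipFactor n B * Real.log ε⁻¹).toNNReal (cutNonlin n ε B) := by
  refine LipschitzWith.of_dist_le_mul fun z w => ?_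
  rw [dist_eq_norm, dist_eq_norm, Real.coe_toNNReal _
    (mul_nonneg (lipFactor_nonneg n hB) (zero_le_one.trans hL))]
  exact norm_cutNonlin_sub_le hn hε hL hB z w

/-! ### The flow of the nonlinear part -/

theorem norm_exp_mul_I_sub_le (a b : ℝ) :
    ‖Complex.exp (Complex.I * (a : ℂ)) - Complex.exp (Complex.I * (b : ℂ))‖ ≤ |a - b| := by
  have : Complex.exp (Complex.I * (a : ℂ)) - Complex.exp (Complex.I * (b : ℂ)) =
      Complex.exp (Complex.I * (b : ℂ)) * (Complex.exp (Complex.I * ((a - b : ℝ) : ℂ)) - 1) := by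
    rw [mul_sub, ← Complex.exp_add]; push_cast; ring_nf
  rw [this, norm_mul, mul_comm Complex.I (b : ℂ), Complex.norm_exp_ofReal_mul_I, one_mul]
  exact Real.norm_exp_I_mul_ofReal_sub_one_le

/-- The phase difference is multiplied by the smaller modulus |w|, so the modulus of continuity of f
applies. This is why the stability constant is free of ε and no cut-off is needed here. -/
theorem norm_phase_sub_le {n : ℕ} (hn : 1 ≤ n) {ε t : ℝ} (hε : 0 < ε) (ht : 0 ≤ t) (z w : ℂ) :
    ‖Complex.exp (Complex.I * ((-t * regLog n ε (‖z‖ ^ 2) : ℝ) : ℂ)) * z -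
      Complex.exp (Complex.I * ((-t * regLog n ε (‖w‖ ^ 2) : ℝ) : ℂ)) * w‖ ≤
      (1 + 4 * n * t) * ‖z - w‖ := by
  wlog h : ‖w‖ ≤ ‖z‖ generalizing z w
  · rw [norm_sub_rev, norm_sub_rev z]; exact this w z (le_of_not_ge h)
  have e : ∀ p q : ℂ, p * z - q * w = p * (z - w) + (p - q) * w := fun p q => by ring
  rw [e]
  refine (norm_add_le _ _).trans ?_
  rw [norm_mul, norm_mul, mul_comm Complex.I, Complex.norm_exp_ofReal_mul_I, one_mul,
    mul_comm (_ : ℂ) Complex.I]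
  have h1 := norm_exp_mul_I_sub_le (-t * regLog n ε (‖z‖ ^ 2)) (-t * regLog n ε (‖w‖ ^ 2))
  rw [← mul_sub, abs_mul, abs_neg, abs_of_nonneg ht, abs_sub_comm] at h1
  have h2 := mul_abs_regLog_sub_le hn hε (norm_nonneg w) h
  have h3 : ‖z‖ - ‖w‖ ≤ ‖z - w‖ := norm_sub_norm_le z w
  calc _ ≤ ‖z - w‖ + (t * |regLog n ε (‖w‖ ^ 2) - regLog n ε (‖z‖ ^ 2)|) * ‖w‖ := by gcongr
    _ = ‖z - w‖ + t * (‖w‖ * |regLog n ε (‖w‖ ^ 2) - regLog n ε (‖z‖ ^ 2)|) := by ring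
    _ ≤ ‖z - w‖ + t * (4 * n * ‖z - w‖) := by exact add_le_add_right (mul_le_mul_of_nonneg_left (h2.trans (by gcongr)) ht) _
    _ = _ := by ring

theorem coeFn_phaseMul {μ : Measure ℝ} (θ : ℝ → ℝ) (hθ : AEStronglyMeasurable θ μ)
    (v : Lp ℂ 2 μ) :
    phaseMul θ hθ v =ᵐ[μ] fun x => Complex.exp (Complex.I * (θ x : ℂ)) * v x :=
  (memLp_phase_mul hθ v).coeFn_toLp

theorem norm_phaseMul {μ : Measure ℝ} (θ : ℝ → ℝ) (hθ : AEStronglyMeasurable θ μ)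
    (v : Lp ℂ 2 μ) : ‖phaseMul θ hθ v‖ = ‖v‖ := by
  have : ∀ᵐ x ∂μ, ‖phaseMul θ hθ v x‖ = ‖v x‖ := by
    filter_upwards [coeFn_phaseMul θ hθ v] with x hx
    rw [hx, norm_mul, mul_comm Complex.I, Complex.norm_exp_ofReal_mul_I, one_mul]
  exact le_antisymm (Lp.norm_le_norm_of_ae_le (this.mono fun x h => h.le))
    (Lp.norm_le_norm_of_ae_le (this.mono fun x h => h.ge))

theorem norm_flowB (S : Domain1D) (n : ℕ) (ε t : ℝ) (w : S.L2) : ‖flowB S n ε t w‖ = ‖w‖ :=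
  norm_phaseMul _ _ _

theorem norm_flowB_sub_le (S : Domain1D) {n : ℕ} (hn : 1 ≤ n) {ε t : ℝ} (hε : 0 < ε) (ht : 0 ≤ t)
    (v w : S.L2) : ‖flowB S n ε t v - flowB S n ε t w‖ ≤ (1 + 4 * n * t) * ‖v - w‖ := by
  refine Lp.norm_le_mul_norm_of_ae_le_mul ?_
  filter_upwards [coeFn_phaseMul _ (aestronglyMeasurable_regLog n ε t v) v,
    coeFn_phaseMul _ (aestronglyMeasurable_regLog n ε t w) w, Lp.coeFn_sub v w,
    Lp.coeFn_sub (flowB S n ε t v) (flowB S n ε t w)] with x h1 h2 h3 h4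
  rw [h4, h3, Pi.sub_apply, Pi.sub_apply, flowB, flowB, h1, h2]
  exact norm_phase_sub_le hn hε ht _ _

/-- For |y| ≤ 1 this is the Taylor remainder; for |y| ≥ 1 the trivial bound 2|y| is enough. -/
theorem norm_exp_mul_I_sub_one_sub_le (y : ℝ) :
    ‖Complex.exp (Complex.I * (y : ℂ)) - 1 - Complex.I * y‖ ≤ 2 * y ^ 2 := by
  rcases le_total |y| 1 with h | h
  · have := Complex.norm_exp_sub_one_sub_id_le (x := Complex.I * y) (by simpa using h)
    have h2 : ‖Complex.I * (y : ℂ)‖ ^ 2 = y ^ 2 := by simp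
    rw [h2] at this
    nlinarith [sq_nonneg y]
  · have h1 : ‖Complex.exp (Complex.I * (y : ℂ)) - 1‖ ≤ |y| := Real.norm_exp_I_mul_ofReal_sub_one_le
    have h2 : ‖Complex.I * (y : ℂ)‖ = |y| := by simp
    refine (norm_sub_le _ _).trans ?_
    rw [h2, ← sq_abs]
    nlinarith

/-- The map `v ↦ v f(|v|²)` on `L²`, with the cut-off nonlinearity. -/
def nonlinL2 {n : ℕ} (hn : 1 ≤ n) {ε B : ℝ} (hε : 0 < ε) (hL : 1 ≤ Real.log ε⁻¹) (hB : 1 ≤ B)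
    {μ : Measure ℝ} (v : Lp ℂ 2 μ) : Lp ℂ 2 μ :=
  (lipschitzWith_cutNonlin hn hε hL hB).compLp (cutNonlin_zero n ε B) v

section nonlinL2
variable {n : ℕ} (hn : 1 ≤ n) {ε B : ℝ} (hε : 0 < ε) (hL : 1 ≤ Real.log ε⁻¹) (hB : 1 ≤ B)
  {μ : Measure ℝ}

theorem coeFn_nonlinL2 (v : Lp ℂ 2 μ) :
    nonlinL2 hn hε hL hB v =ᵐ[μ] fun x => cutNonlin n ε B (v x) :=
  LipschitzWith.coeFn_compLp _ _ _

theorem continuous_nonlinL2 : Continuous (nonlinL2 hn hε hL hB : Lp ℂ 2 μ → Lp ℂ 2 μ) :=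
  (lipschitzWith_cutNonlin hn hε hL hB).continuous_compLp (cutNonlin_zero n ε B)

theorem norm_nonlinL2_sub_le (v w : Lp ℂ 2 μ) : ‖nonlinL2 hn hε hL hB v - nonlinL2 hn hε hL hB w‖ ≤
    lipFactor n B * Real.log ε⁻¹ * ‖v - w‖ := by
  have := (lipschitzWith_cutNonlin hn hε hL hB).norm_compLp_sub_le (cutNonlin_zero n ε B) v w
  rwa [Real.coe_toNNReal _ (mul_nonneg (lipFactor_nonneg n hB) (zero_le_one.trans hL))] at this

theorem norm_nonlinL2_le (v : Lp ℂ 2 μ) : ‖nonlinL2 hn hε hL hB v‖ ≤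
    lipFactor n B * Real.log ε⁻¹ * ‖v‖ := by
  have := (lipschitzWith_cutNonlin hn hε hL hB).norm_compLp_le (cutNonlin_zero n ε B) v
  rwa [Real.coe_toNNReal _ (mul_nonneg (lipFactor_nonneg n hB) (zero_le_one.trans hL))] at this

/-- The modulus is constant along Φ_B, so the flow is a pure phase and its expansion to first order
is pointwise. The bound |v| ≤ B makes the cut-off inactive and f at most K. -/
theorem norm_flowB_sub_sub_le (S : Domain1D) (t : ℝ) (v : S.L2)
    (hv : ∀ᵐ x ∂S.vol, ‖v x‖ ≤ B) :
    ‖flowB S n ε t v - v + (Complex.I * t) • nonlinL2 hn hε hL hB v‖ ≤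
      2 * (t * (lipFactor n B * Real.log ε⁻¹)) ^ 2 * ‖v‖ := by
  refine Lp.norm_le_mul_norm_of_ae_le_mul ?_
  filter_upwards [coeFn_phaseMul _ (aestronglyMeasurable_regLog n ε t v) v,
    Lp.coeFn_add (flowB S n ε t v - v) ((Complex.I * t) • nonlinL2 hn hε hL hB v),
    Lp.coeFn_sub (flowB S n ε t v) v, Lp.coeFn_smul (Complex.I * t) (nonlinL2 hn hε hL hB v),
    coeFn_nonlinL2 hn hε hL hB v, hv] with x h1 h2 h3 h4 h5 h6
  rw [h2, Pi.add_apply, h3, Pi.sub_apply, h4, Pi.smul_apply, h5, cutNonlin_of_le h6, smul_eq_mul,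
    flowB, h1]
  set g := regLog n ε (‖v x‖ ^ 2)
  have e : Complex.exp (Complex.I * ((-t * g : ℝ) : ℂ)) * v x - v x + Complex.I * t * (v x * g) =
      (Complex.exp (Complex.I * ((-t * g : ℝ) : ℂ)) - 1 - Complex.I * ((-t * g : ℝ) : ℂ)) * v x := by
    push_cast; ring
  rw [e, norm_mul]
  have h7 := norm_exp_mul_I_sub_one_sub_le (-t * g)
  have h8 : (-t * g) ^ 2 ≤ (t * (lipFactor n B * Real.log ε⁻¹)) ^ 2 := by
    rw [mul_pow, mul_pow, neg_sq, ← sq_abs g]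
    gcongr
    exact abs_regLog_le_lipFactor hn hε hL hB (norm_nonneg _) h6
  gcongr
  linarith

end nonlinL2

/-! ### Primitives of locally integrable functions -/


/-- The sums of increments of f are dominated by those of h. This serves for primitives, for
Lipschitz compositions, and for real and imaginary parts. -/
theorem absolutelyContinuousOnInterval_of_dist_le {X Y : Type*} [PseudoMetricSpace X]
    [PseudoMetricSpace Y] {f : ℝ → X} {h : ℝ → Y} {a b K : ℝ}
    (hh : AbsolutelyContinuousOnInterval h a b)
    (H : ∀ x y, dist (f x) (f y) ≤ K * dist (h x) (h y)) :
    AbsolutelyContinuousOnInterval f a b := by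
  have h1 : Tendsto (fun E : ℕ × (ℕ → ℝ × ℝ) =>
      K * ∑ i ∈ Finset.range E.1, dist (h (E.2 i).1) (h (E.2 i).2))
      (AbsolutelyContinuousOnInterval.totalLengthFilter ⊓
        𝓟 (AbsolutelyContinuousOnInterval.disjWithin a b)) (𝓝 (K * 0)) := Tendsto.const_mul K hh
  rw [mul_zero] at h1
  refine squeeze_zero (fun E => Finset.sum_nonneg fun _ _ => dist_nonneg) (fun E => ?_) h1
  rw [Finset.mul_sum]
  exact Finset.sum_le_sum fun i _ => H _ _

/-- `V` is an (absolutely continuous) primitive of the locally integrable function `w`. -/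
structure IsPrimitive (V w : ℝ → ℂ) : Prop where
  locallyIntegrable : LocallyIntegrable w volume
  sub_eq : ∀ x y, V y - V x = ∫ t in x..y, w t

namespace IsPrimitive

variable {V w : ℝ → ℂ}

theorem intervalIntegrable (h : IsPrimitive V w) (a b : ℝ) : IntervalIntegrable w volume a b :=
  (h.locallyIntegrable.integrableOn_isCompact isCompact_uIcc).intervalIntegrable

theorem of_integral (hw : LocallyIntegrable w volume) (c : ℂ) (x₀ : ℝ) :
    IsPrimitive (fun x => c + ∫ t in x₀..x, w t) w := by
  refine ⟨hw, fun x y => ?_⟩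
  rw [add_sub_add_left_eq_sub, intervalIntegral.integral_interval_sub_left]
  all_goals exact (hw.integrableOn_isCompact isCompact_uIcc).intervalIntegrable

theorem eq_add (h : IsPrimitive V w) (x y : ℝ) : V y = V x + ∫ t in x..y, w t := by
  rw [← h.sub_eq]; ring

theorem dist_le (h : IsPrimitive V w) (x y : ℝ) :
    dist (V x) (V y) ≤ dist (∫ t in (0 : ℝ)..x, ‖w t‖) (∫ t in (0 : ℝ)..y, ‖w t‖) := by
  rw [dist_comm, dist_eq_norm, h.sub_eq, dist_comm, Real.dist_eq,
    intervalIntegral.integral_interval_sub_left (h.intervalIntegrable _ _).norm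
      (h.intervalIntegrable _ _).norm]
  exact intervalIntegral.norm_integral_le_abs_integral_norm

theorem absolutelyContinuousOnInterval (h : IsPrimitive V w) (a b : ℝ) :
    AbsolutelyContinuousOnInterval V a b := by
  have hH : AbsolutelyContinuousOnInterval (fun x => ∫ t in a..x, ‖w t‖) a b :=
    (h.intervalIntegrable a b).norm.absolutelyContinuousOnInterval_intervalIntegral left_mem_uIcc
  refine absolutelyContinuousOnInterval_of_dist_le (K := 1) hH fun x y => ?_
  rw [one_mul]
  refine (h.dist_le x y).trans_eq ?_
  rw [Real.dist_eq, Real.dist_eq, intervalIntegral.integral_interval_sub_left,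
    intervalIntegral.integral_interval_sub_left]
  all_goals exact (h.intervalIntegrable _ _).norm

theorem continuous (h : IsPrimitive V w) : Continuous V := by
  have : V = fun x => V 0 + ∫ t in (0 : ℝ)..x, w t := funext fun x => h.eq_add 0 x
  rw [this]
  exact continuous_const.add
    (intervalIntegral.continuous_primitive (fun a b => h.intervalIntegrable a b) 0)

theorem ae_hasDerivAt (h : IsPrimitive V w) : ∀ᵐ x, HasDerivAt V (w x) x := by
  have : V = fun x => V 0 + ∫ t in (0 : ℝ)..x, w t := funext fun x => h.eq_add 0 x
  filter_upwards [LocallyIntegrable.ae_hasDerivAt_integral h.locallyIntegrable] with x hx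
  rw [this]
  exact (hx 0).const_add _

/-- The fundamental theorem of calculus for absolutely continuous complex functions. -/
theorem of_absolutelyContinuous (hac : ∀ a b, AbsolutelyContinuousOnInterval V a b)
    (hw : LocallyIntegrable w volume) (hd : ∀ᵐ x, HasDerivAt V (w x) x) : IsPrimitive V w := by
  refine ⟨hw, fun a b => ?_⟩
  have hp := of_integral hw 0 a
  -- The difference between V and the integral of w is absolutely continuous with derivative zero
  -- almost everywhere, hence constant.
  have hg : AbsolutelyContinuousOnInterval (fun x => V x - (0 + ∫ t in a..x, w t)) a b :=
    (hac a b).sub (hp.absolutelyContinuousOnInterval a b)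
  obtain ⟨C, hC⟩ := hg.const_of_ae_hasDerivAt_zero (by
    filter_upwards [hd, hp.ae_hasDerivAt] with x h1 h2 _
    convert! h1.sub h2
    rw [sub_self])
  have h1 := hC a left_mem_uIcc
  have h2 := hC b right_mem_uIcc
  simp only [intervalIntegral.integral_same, add_zero, zero_add, sub_zero] at h1 h2
  rw [h1, ← h2]; ring

theorem mul (h : IsPrimitive V w) {V' w' : ℝ → ℂ} (h' : IsPrimitive V' w') :
    IsPrimitive (fun x => V x * V' x) (fun x => w x * V' x + V x * w' x) := by
  refine of_absolutelyContinuous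
    (fun a b => (h.absolutelyContinuousOnInterval a b).smul (h'.absolutelyContinuousOnInterval a b))
    ?_ ?_
  · refine LocallyIntegrable.add ?_ ?_
    · have := h.locallyIntegrable.smul_continuous h'.continuous
      refine this.congr (ae_of_all _ fun x => by simp)
    · have := h'.locallyIntegrable.continuous_smul h.continuous
      exact this
  · filter_upwards [h.ae_hasDerivAt, h'.ae_hasDerivAt] with x h1 h2
    exact h1.mul h2

theorem of_hasDerivAt {φ φ' : ℝ → ℂ} (hd : ∀ x, HasDerivAt φ (φ' x) x) (hc : Continuous φ') :
    IsPrimitive φ φ' :=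
  ⟨hc.locallyIntegrable, fun _ _ => (intervalIntegral.integral_eq_sub_of_hasDerivAt
    (fun t _ => hd t) (hc.intervalIntegrable _ _)).symm⟩

theorem integral_mul_deriv (h : IsPrimitive V w) {φ φ' : ℝ → ℂ} (hd : ∀ x, HasDerivAt φ (φ' x) x)
    (hc : Continuous φ') (a b : ℝ) :
    ∫ x in a..b, V x * φ' x = V b * φ b - V a * φ a - ∫ x in a..b, w x * φ x := by
  have hφ := of_hasDerivAt hd hc
  have h1 := (h.mul hφ).sub_eq a b
  have i1 : IntervalIntegrable (fun x => w x * φ x) volume a b :=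
    (h.intervalIntegrable a b).mul_continuousOn hφ.continuous.continuousOn
  have i2 : IntervalIntegrable (fun x => V x * φ' x) volume a b :=
    (h.continuous.mul hc).intervalIntegrable _ _
  rw [intervalIntegral.integral_add i1 i2] at h1
  rw [h1]; ring

/-- A Lipschitz function of a primitive is a primitive. -/
theorem comp_lipschitz (h : IsPrimitive V w) {F : ℂ → ℂ} {K : NNReal} (hF : LipschitzWith K F) :
    ∃ g : ℝ → ℂ, IsPrimitive (fun x => F (V x)) g ∧ Measurable g ∧ ∀ᵐ x, ‖g x‖ ≤ K * ‖w x‖ := by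
  set f : ℝ → ℂ := fun x => F (V x) with hf
  have hac : ∀ a b, AbsolutelyContinuousOnInterval f a b := fun a b =>
    absolutelyContinuousOnInterval_of_dist_le (h.absolutelyContinuousOnInterval a b)
      fun x y => hF.dist_le_mul _ _
  have hdiff : ∀ᵐ x, DifferentiableAt ℝ f x := by
    -- Almost everywhere differentiability is taken from real-valued functions on compact intervals;
    -- a countable exhaustion covers the line.
    have key : ∀ᵐ x, ∀ N : ℕ, x ∈ uIcc (-(N : ℝ)) N →
        DifferentiableAt ℝ (fun x => (f x).re) x ∧ DifferentiableAt ℝ (fun x => (f x).im) x := by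
      rw [ae_all_iff]
      intro N
      have hre : AbsolutelyContinuousOnInterval (fun x => (f x).re) (-(N : ℝ)) N :=
        absolutelyContinuousOnInterval_of_dist_le (K := 1) (hac _ _) fun x y => by
          rw [one_mul, dist_eq_norm, dist_eq_norm, ← Complex.sub_re]
          exact Complex.abs_re_le_norm _
      have him : AbsolutelyContinuousOnInterval (fun x => (f x).im) (-(N : ℝ)) N :=
        absolutelyContinuousOnInterval_of_dist_le (K := 1) (hac _ _) fun x y => by
          rw [one_mul, dist_eq_norm, dist_eq_norm, ← Complex.sub_im]
          exact Complex.abs_im_le_norm _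
      filter_upwards [hre.ae_differentiableAt, him.ae_differentiableAt] with x h1 h2 hx
      exact ⟨h1 hx, h2 hx⟩
    filter_upwards [key] with x hx
    obtain ⟨N, hN⟩ := exists_nat_ge |x|
    obtain ⟨h1, h2⟩ := hx N (by
      rw [uIcc_of_le (by linarith [abs_nonneg x])]; exact abs_le.1 hN)
    have : f = fun x => ((f x).re : ℂ) + ((f x).im : ℂ) * Complex.I :=
      funext fun x => (Complex.re_add_im (f x)).symm
    rw [this]
    have h1' : HasDerivAt (fun x => ((f x).re : ℂ)) _ x := h1.hasDerivAt.ofReal_comp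
    have h2' : HasDerivAt (fun x => ((f x).im : ℂ)) _ x := h2.hasDerivAt.ofReal_comp
    exact (h1'.add (h2'.mul_const _)).differentiableAt
  -- F need not be differentiable at V x, so there is no chain rule; the bound is the limit of the
  -- one for difference quotients.
  have hbound : ∀ᵐ x, ‖deriv f x‖ ≤ K * ‖w x‖ := by
    filter_upwards [hdiff, h.ae_hasDerivAt] with x h1 h2
    have t1 := (hasDerivAt_iff_tendsto_slope.1 h1.hasDerivAt).norm
    have t2 := ((hasDerivAt_iff_tendsto_slope.1 h2).norm).const_mul (K : ℝ)
    refine le_of_tendsto_of_tendsto' t1 t2 fun y => ?_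
    rw [slope_def_module, slope_def_module, norm_smul, norm_smul]
    have := hF.norm_sub_le (V y) (V x)
    calc ‖(y - x)⁻¹‖ * ‖f y - f x‖ ≤ ‖(y - x)⁻¹‖ * (K * ‖V y - V x‖) := by gcongr
      _ = _ := by ring
  have hmeas : Measurable (deriv f) := measurable_deriv f
  refine ⟨deriv f, of_absolutelyContinuous hac ?_ (hdiff.mono fun x hx => hx.hasDerivAt), hmeas,
    hbound⟩
  refine LocallyIntegrable.mono (h.locallyIntegrable.smul (K : ℝ)) hmeas.aestronglyMeasurable ?_
  filter_upwards [hbound] with x hx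
  simpa using hx

end IsPrimitive

/-! ### Absolutely continuous representatives -/

theorem norm_sq_eq_integral {μ : Measure ℝ} (v : Lp ℂ 2 μ) : ‖v‖ ^ 2 = ∫ x, ‖v x‖ ^ 2 ∂μ := by
  have h := L2.inner_def (𝕜 := ℂ) v v
  rw [inner_self_eq_norm_sq_to_K] at h
  have h2 : (∫ x, inner ℂ (v x) (v x) ∂μ) = ((∫ x, ‖v x‖ ^ 2 ∂μ : ℝ) : ℂ) := by
    rw [← integral_complex_ofReal]
    congr 1
    ext x
    rw [inner_self_eq_norm_sq_to_K]
    simp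
  rw [h2] at h
  exact Complex.ofReal_injective (by rw [← h]; push_cast; rfl)

theorem integrable_norm_sq {μ : Measure ℝ} (v : Lp ℂ 2 μ) : Integrable (fun x => ‖v x‖ ^ 2) μ :=
  (Lp.memLp v).integrable_norm_pow two_ne_zero

theorem inner_eq_integral {μ : Measure ℝ} (v w : Lp ℂ 2 μ) :
    inner ℂ v w = ∫ x, conj (v x) * w x ∂μ := by
  rw [L2.inner_def]
  simp [mul_comm]

/-- The underlying open set. -/
def Domain1D.dom : Domain1D → Set ℝ
  | .line => univ
  | .dirichlet a b _ => Ioo a b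
  | .periodic a b _ => Ioo a b

theorem Domain1D.vol_eq (S : Domain1D) : S.vol = volume.restrict S.dom := by
  cases S <;> simp [Domain1D.vol, Domain1D.dom]

theorem Domain1D.measurableSet_dom (S : Domain1D) : MeasurableSet S.dom := by
  cases S <;> simp [Domain1D.dom]

theorem Domain1D.ae_vol_iff (S : Domain1D) {p : ℝ → Prop} :
    (∀ᵐ x ∂S.vol, p x) ↔ ∀ᵐ x, x ∈ S.dom → p x := by
  rw [S.vol_eq, ae_restrict_iff' S.measurableSet_dom]

/-- The boundary condition, for continuous functions. -/
def Domain1D.BdryCond (S : Domain1D) (V : ℝ → ℂ) : Prop :=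
  match S with
  | .line => True
  | .dirichlet a b _ => V a = 0 ∧ V b = 0
  | .periodic a b _ => V a = V b

/-- `v` has an absolutely continuous representative with the boundary condition of `S`, whose
derivative is `w`. -/
def Domain1D.HasACRep (S : Domain1D) (v w : S.L2) : Prop :=
  ∃ V : ℝ → ℂ, IsPrimitive V (S.dom.indicator w) ∧ v =ᵐ[S.vol] V ∧ S.BdryCond V

theorem IsPrimitive.congr_ae {V w w' : ℝ → ℂ} (h : IsPrimitive V w) (hw : w =ᵐ[volume] w') :
    IsPrimitive V w' := by
  refine ⟨h.locallyIntegrable.congr hw, fun x y => ?_⟩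
  rw [h.sub_eq]
  exact intervalIntegral.integral_congr_ae (hw.mono fun t ht _ => ht)

/-- Applied to the cut-off nonlinearity, this is what puts F(u) into H¹. The condition F 0 = 0
preserves both square integrability and the Dirichlet condition. -/
theorem Domain1D.HasACRep.comp_lipschitz {S : Domain1D} {v w : S.L2} (h : S.HasACRep v w)
    {F : ℂ → ℂ} {K : NNReal} (hF : LipschitzWith K F) (F0 : F 0 = 0) :
    ∃ g : S.L2, S.HasACRep (hF.compLp F0 v) g ∧ ‖g‖ ≤ K * ‖w‖ := by
  obtain ⟨V, hV, hvV, hbd⟩ := h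
  obtain ⟨g, hg, hgm, hgb⟩ := hV.comp_lipschitz hF
  have hgb' : ∀ᵐ x ∂S.vol, ‖g x‖ ≤ K * ‖w x‖ := by
    rw [S.ae_vol_iff]
    filter_upwards [hgb] with x h1 h2
    rwa [indicator_of_mem h2] at h1
  have hm : MemLp g 2 S.vol :=
    (Lp.memLp w).of_le_mul hgm.aestronglyMeasurable hgb'
  -- Outside the domain the pointwise bound by K times the extended derivative forces g to vanish.
  have hgi : g =ᵐ[volume] S.dom.indicator (hm.toLp g) := by
    have h1 := hm.coeFn_toLp
    rw [EventuallyEq, S.ae_vol_iff] at h1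
    filter_upwards [h1, hgb] with x h1 h2
    by_cases hx : x ∈ S.dom
    · rw [indicator_of_mem hx, h1 hx]
    · rw [indicator_of_notMem hx] at h2 ⊢
      simpa using h2
  refine ⟨hm.toLp g, ⟨fun x => F (V x), hg.congr_ae hgi, ?_, ?_⟩, ?_⟩
  · filter_upwards [hF.coeFn_compLp F0 v, hvV] with x h1 h2
    rw [h1, Function.comp_apply, h2]
  · cases S with
    | line => trivial
    | dirichlet a b hab => exact ⟨(congrArg F hbd.1).trans F0, (congrArg F hbd.2).trans F0⟩
    | periodic a b hab => exact congrArg F hbd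
  · refine Lp.norm_le_mul_norm_of_ae_le_mul ?_
    filter_upwards [hm.coeFn_toLp, hgb'] with x h1 h2
    rwa [h1]

/-- The inequality |V(x)| ≤ |V(y)| + ∫|w| is averaged over y in an interval of length l. The
elementary 2|f| ≤ 1 + |f|² replaces Cauchy–Schwarz, hence the inhomogeneous bound. -/
theorem IsPrimitive.norm_le {V w : ℝ → ℂ} (h : IsPrimitive V w) {c l x A B : ℝ} (hl : 0 < l)
    (hx : x ∈ Icc c (c + l)) (hwi : IntegrableOn (fun t => ‖w t‖ ^ 2) (Ioc c (c + l)))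
    (hV : ∫ t in Ioc c (c + l), ‖V t‖ ^ 2 ≤ A) (hw : ∫ t in Ioc c (c + l), ‖w t‖ ^ 2 ≤ B) :
    ‖V x‖ ≤ 1 / 2 + A / (2 * l) + l / 2 + B / 2 := by
  have hfin : volume (Ioc c (c + l)) ≠ ⊤ := by simp
  have hvol : volume.real (Ioc c (c + l)) = l := by simp [hl.le]
  have half : ∀ {f : ℝ → ℂ}, IntegrableOn f (Ioc c (c + l)) →
      IntegrableOn (fun t => ‖f t‖ ^ 2) (Ioc c (c + l)) → ∫ t in Ioc c (c + l), ‖f t‖ ≤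
        (l + ∫ t in Ioc c (c + l), ‖f t‖ ^ 2) / 2 := by
    intro f hf hf2
    have : ∫ t in Ioc c (c + l), ‖f t‖ ≤ ∫ t in Ioc c (c + l), (1 / 2 + ‖f t‖ ^ 2 / 2) := by
      refine setIntegral_mono hf.norm ((integrableOn_const hfin).add (hf2.div_const 2)) fun t => ?_
      dsimp only
      nlinarith [sq_nonneg (‖f t‖ - 1)]
    refine this.trans_eq ?_
    rw [integral_add (integrable_const _) (hf2.div_const 2), setIntegral_const, hvol,
      integral_div, smul_eq_mul]
    ring
  have hwI : IntegrableOn w (Ioc c (c + l)) := by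
    have := h.intervalIntegrable c (c + l)
    rwa [intervalIntegrable_iff_integrableOn_Ioc_of_le (by linarith)] at this
  have hVI : ∀ {f : ℝ → ℝ}, Continuous f → IntegrableOn f (Ioc c (c + l)) := by
    intro f hf
    have := hf.intervalIntegrable (μ := volume) c (c + l)
    rwa [intervalIntegrable_iff_integrableOn_Ioc_of_le (by linarith)] at this
  set I := ∫ t in Ioc c (c + l), ‖w t‖ with hI
  have pt : ∀ y ∈ Ioc c (c + l), ‖V x‖ ≤ ‖V y‖ + I := by
    intro y hy
    have e := h.sub_eq y x
    have : ‖V x - V y‖ ≤ I := by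
      rw [e]
      refine intervalIntegral.norm_integral_le_integral_norm_uIoc.trans ?_
      refine setIntegral_mono_set hwI.norm (ae_of_all _ fun t => norm_nonneg _)
        (LE.le.eventuallyLE ?_)
      intro t ht
      rw [mem_uIoc] at ht
      rcases ht with ht | ht
      · exact ⟨hy.1.trans ht.1, ht.2.trans hx.2⟩
      · exact ⟨lt_of_le_of_lt hx.1 ht.1, ht.2.trans hy.2⟩
    have := norm_le_norm_add_norm_sub' (V x) (V y)
    linarith
  have int : ∫ t in Ioc c (c + l), ‖V x‖ ≤ ∫ t in Ioc c (c + l), (‖V t‖ + I) :=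
    setIntegral_mono_on (integrableOn_const hfin)
      ((hVI h.continuous.norm).add (integrableOn_const hfin)) measurableSet_Ioc pt
  rw [integral_add (hVI h.continuous.norm) (integrable_const _), setIntegral_const,
    setIntegral_const, hvol, smul_eq_mul, smul_eq_mul] at int
  have i1 := half (f := V) (by
    have := h.continuous.intervalIntegrable (μ := volume) c (c + l)
    rwa [intervalIntegrable_iff_integrableOn_Ioc_of_le (by linarith)] at this)
    (hVI (h.continuous.norm.pow 2))
  have i2 := half hwI hwi
  have i3 : l * ‖V x‖ ≤ (l + A) / 2 + l * ((l + B) / 2) := by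
    have : l * I ≤ l * ((l + B) / 2) := by gcongr; linarith
    linarith
  have i4 : l * (1 / 2 + A / (2 * l) + l / 2 + B / 2) = (l + A) / 2 + l * ((l + B) / 2) := by
    field_simp; ring
  rw [← i4] at i3
  exact le_of_mul_le_mul_left i3 hl

/-- The Sobolev embedding of `H¹` into `L^∞`. -/
theorem Domain1D.exists_forall_norm_le (S : Domain1D) : ∃ C : ℝ, 0 ≤ C ∧ ∀ v w : S.L2,
    S.HasACRep v w → ∀ᵐ x ∂S.vol, ‖v x‖ ≤ C * (1 + ‖v‖ ^ 2 + ‖w‖ ^ 2) := by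
  -- Every point must see an interval of one fixed length inside the domain: length 1 on the line,
  -- the whole interval otherwise.
  obtain ⟨l, hl, hJ⟩ : ∃ l : ℝ, 0 < l ∧ ∀ x ∈ S.dom, ∃ c, x ∈ Icc c (c + l) ∧
      Ioo c (c + l) ⊆ S.dom := by
    cases S with
    | line => exact ⟨1, one_pos, fun x _ => ⟨x, ⟨le_rfl, by linarith⟩, subset_univ _⟩⟩
    | dirichlet a b hab =>
      refine ⟨b - a, sub_pos.2 hab, fun x hx => ⟨a, ?_, ?_⟩⟩ <;> rw [add_sub_cancel]
      · exact Ioo_subset_Icc_self hx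
      · exact subset_rfl
    | periodic a b hab =>
      refine ⟨b - a, sub_pos.2 hab, fun x hx => ⟨a, ?_, ?_⟩⟩ <;> rw [add_sub_cancel]
      · exact Ioo_subset_Icc_self hx
      · exact subset_rfl
  refine ⟨1 + l + 1 / l, by positivity, fun v w ⟨V, hV, hvV, _⟩ => ?_⟩
  have hx : ∀ᵐ x ∂S.vol, x ∈ S.dom := by
    rw [S.vol_eq]; exact ae_restrict_mem S.measurableSet_dom
  filter_upwards [hx, hvV] with x hx hxV
  obtain ⟨c, hc, hsub⟩ := hJ x hx
  have hle : volume.restrict (Ioc c (c + l)) ≤ S.vol := by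
    rw [S.vol_eq, ← Measure.restrict_congr_set Ioo_ae_eq_Ioc]
    exact Measure.restrict_mono hsub le_rfl
  have hind : (fun t => ‖S.dom.indicator (⇑w) t‖ ^ 2) =ᵐ[volume.restrict (Ioc c (c + l))]
      fun t => ‖w t‖ ^ 2 := by
    rw [← Measure.restrict_congr_set Ioo_ae_eq_Ioc]
    filter_upwards [ae_restrict_mem measurableSet_Ioo] with t ht
    rw [indicator_of_mem (hsub ht)]
  have hA : ∫ t in Ioc c (c + l), ‖V t‖ ^ 2 ≤ ‖v‖ ^ 2 := by
    have e : (fun t => ‖v t‖ ^ 2) =ᵐ[S.vol] fun t => ‖V t‖ ^ 2 := hvV.mono fun t ht => by simp [ht]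
    rw [norm_sq_eq_integral, integral_congr_ae e]
    exact integral_mono_measure hle (ae_of_all _ fun t => by positivity)
      ((integrable_norm_sq v).congr e)
  have hB : ∫ t in Ioc c (c + l), ‖S.dom.indicator w t‖ ^ 2 ≤ ‖w‖ ^ 2 := by
    rw [norm_sq_eq_integral, integral_congr_ae hind]
    exact integral_mono_measure hle (ae_of_all _ fun t => by positivity) (integrable_norm_sq w)
  have := hV.norm_le hl hc
    (((integrable_norm_sq w).mono_measure hle).congr hind.symm) hA hB
  rw [hxV]
  refine this.trans ?_
  have e1 : ‖v‖ ^ 2 / (2 * l) = 1 / l * ‖v‖ ^ 2 / 2 := by field_simp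
  rw [e1]
  have : 0 ≤ 1 / l := by positivity
  nlinarith [sq_nonneg ‖v‖, sq_nonneg ‖w‖, mul_nonneg this (sq_nonneg ‖v‖),
    mul_nonneg this (sq_nonneg ‖w‖), mul_nonneg hl.le (sq_nonneg ‖v‖),
    mul_nonneg hl.le (sq_nonneg ‖w‖)]

/-! ### Error analysis for an abstract spectral calculus -/

/-- The facts about the free flow `e^{itΔ}` on `L²(Ω)` and about the spectral truncations `P N` of
the identity and `Λ N = -Δ (P N)` of the Laplacian on which the error analysis rests. -/
structure SpectralData (S : Domain1D) where
  A : ℝ → S.L2 →ₗᵢ[ℂ] S.L2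
  P : ℕ → S.L2 →L[ℂ] S.L2
  Λ : ℕ → S.L2 →L[ℂ] S.L2
  δ : ℕ → ℝ
  A_eq : ∀ t v, A t v = flowA S t v
  A_add : ∀ s t v, A (s + t) v = A s (A t v)
  A_zero : ∀ v, A 0 v = v
  P_symm : ∀ N v w, inner ℂ (P N v) w = inner ℂ v (P N w)
  Λ_symm : ∀ N v w, inner ℂ (Λ N v) w = inner ℂ v (Λ N w)
  norm_P_le : ∀ N v, ‖P N v‖ ≤ ‖v‖
  tendsto_P : ∀ v, Tendsto (fun N => P N v) atTop (𝓝 v)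
  P_Λ : ∀ N v, P N (Λ N v) = Λ N v
  P_A : ∀ N s v, P N (A s (P N v)) = A s (P N v)
  Λ_A : ∀ N s v, Λ N (A s (P N v)) = A s (Λ N v)
  hasDerivAt_A : ∀ N v s, HasDerivAt (fun s => A s (P N v)) (-Complex.I • A s (Λ N v)) s
  tendsto_δ : Tendsto δ atTop (𝓝 0)
  tail_le : ∀ N v w, S.HasACRep v w → ‖v - P N v‖ ≤ δ N * ‖w‖
  norm_A_sub_le : ∀ t v w, S.HasACRep v w → ‖A t v - v‖ ≤ √(2 * |t|) * ‖w‖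
  hasACRep : ∀ v w, S.IsH1 v w → S.HasACRep v w
  memH1_P : ∀ N v, S.MemH1 (P N v)
  inner_weakDeriv_P : ∀ N φ v w, S.HasACRep v w →
    inner ℂ (S.weakDeriv (P N φ)) w = inner ℂ (Λ N φ) v

/-- The `L²` functions with `H¹` norm at most `M`. -/
def Domain1D.h1Ball (S : Domain1D) (M : ℝ) : Set S.L2 :=
  {v | ∃ w, S.HasACRep v w ∧ ‖v‖ ^ 2 + ‖w‖ ^ 2 ≤ M ^ 2}

/-- The excess max(|v| − B, 0) depends continuously on v in L², and the set is where it vanishes.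
Thus the sup bound of the H¹ ball passes to the L² closure. -/
theorem isClosed_setOf_ae_norm_le {μ : Measure ℝ} (B : ℝ) (hB : 0 ≤ B) :
    IsClosed {v : Lp ℂ 2 μ | ∀ᵐ x ∂μ, ‖v x‖ ≤ B} := by
  have hlip : LipschitzWith 1 (fun z : ℂ => max (‖z‖ - B) 0) := by
    refine LipschitzWith.of_dist_le_mul fun z w => ?_
    rw [NNReal.coe_one, one_mul, Real.dist_eq, dist_eq_norm]
    refine (abs_max_sub_max_le_abs _ _ _).trans ?_
    rw [sub_sub_sub_cancel_right]
    exact abs_norm_sub_norm_le z w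
  have h0 : (fun z : ℂ => max (‖z‖ - B) 0) 0 = 0 := by simp [hB]
  have : {v : Lp ℂ 2 μ | ∀ᵐ x ∂μ, ‖v x‖ ≤ B} =
      (fun v : Lp ℂ 2 μ => hlip.compLp h0 v) ⁻¹' {0} := by
    ext v
    simp only [mem_ofPred_eq, mem_preimage, mem_singleton_iff]
    rw [Lp.eq_zero_iff_ae_eq_zero]
    have h1 := hlip.coeFn_compLp h0 v
    constructor <;> intro h <;> filter_upwards [h, h1] with x h h1
    · rw [h1]; simp [h]
    · rw [h1] at h; simpa using h
  rw [this]
  exact isClosed_singleton.preimage (hlip.continuous_compLp h0)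

/-- The continuous functions max(f, c) and c agree almost everywhere, hence everywhere. This
upgrades almost every time to every time. -/
theorem forall_Icc_le_of_ae {f : ℝ → ℝ} {T c : ℝ} (hT : 0 < T) (hf : ContinuousOn f (Icc 0 T))
    (h : ∀ᵐ t ∂volume.restrict (Icc 0 T), f t ≤ c) : ∀ t ∈ Icc 0 T, f t ≤ c := by
  have h1 : (fun t => max (f t) c) =ᵐ[volume.restrict (Icc 0 T)] fun _ => c :=
    h.mono fun t ht => max_eq_right ht
  have := Measure.eqOn_Icc_of_ae_eq volume hT.ne h1 (hf.sup continuousOn_const) continuousOn_const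
  exact fun t ht => (le_max_left _ _).trans_eq (this ht)

namespace SpectralData

variable {S : Domain1D} (D : SpectralData S)

theorem A_A_neg (s : ℝ) (v : S.L2) : D.A s (D.A (-s) v) = v := by
  rw [← D.A_add, add_neg_cancel, D.A_zero]

theorem inner_A (s : ℝ) (v w : S.L2) : inner ℂ (D.A s v) w = inner ℂ v (D.A (-s) w) := by
  conv_lhs => rw [← D.A_A_neg s w]
  exact (D.A s).inner_map_map _ _

/-- Take ψ = z and let N tend to infinity. It allows norms to be estimated by pairing with
spectrally truncated vectors only. -/
theorem norm_le_of_forall_inner {z : S.L2} {c : ℝ} (hc : 0 ≤ c)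
    (h : ∀ N ψ, ‖(inner ℂ (D.P N ψ) z : ℂ)‖ ≤ c * ‖ψ‖) : ‖z‖ ≤ c := by
  have h1 : Tendsto (fun N => ‖(inner ℂ (D.P N z) z : ℂ)‖) atTop (𝓝 ‖(inner ℂ z z : ℂ)‖) :=
    ((D.tendsto_P z).inner tendsto_const_nhds).norm
  have h2 := le_of_tendsto' h1 fun N => h N z
  rw [inner_self_eq_norm_sq_to_K] at h2
  have h3 : ‖((‖z‖ : ℂ)) ^ 2‖ = ‖z‖ * ‖z‖ := by
    rw [norm_pow, Complex.norm_real, norm_norm, sq]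
  rcases (norm_nonneg z).eq_or_lt with h0 | h0
  · rwa [← h0]
  · exact le_of_mul_le_mul_right (h3 ▸ h2) h0

end SpectralData

/-! ### Bounds on the H¹ ball and on its L² closure -/

section closure

variable {S : Domain1D} (D : SpectralData S) {M : ℝ}

theorem norm_le_of_mem_closure (hM : 0 ≤ M) {v : S.L2} (hv : v ∈ closure (S.h1Ball M)) : ‖v‖ ≤ M := by
  have : IsClosed {v : S.L2 | ‖v‖ ≤ M} := isClosed_le continuous_norm continuous_const
  refine closure_minimal ?_ this hv
  rintro v ⟨w, -, h⟩
  exact abs_le_of_sq_le_sq' (by nlinarith [sq_nonneg ‖w‖]) hM |>.2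

theorem norm_A_sub_le_of_mem_closure (hM : 0 ≤ M) {v : S.L2} (hv : v ∈ closure (S.h1Ball M)) (t : ℝ) :
    ‖D.A t v - v‖ ≤ √(2 * |t|) * M := by
  have : IsClosed {v : S.L2 | ‖D.A t v - v‖ ≤ √(2 * |t|) * M} :=
    isClosed_le (((D.A t).continuous.sub continuous_id).norm) continuous_const
  refine closure_minimal ?_ this hv
  rintro v ⟨w, hw, h⟩
  refine (D.norm_A_sub_le t v w hw).trans ?_
  gcongr
  exact abs_le_of_sq_le_sq' (by nlinarith [sq_nonneg ‖v‖]) hM |>.2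

theorem norm_sub_P_le_of_mem_ball (hM : 0 ≤ M) {v : S.L2} (hv : v ∈ S.h1Ball M) (N : ℕ) :
    ‖v - D.P N v‖ ≤ |D.δ N| * M := by
  obtain ⟨w, hw, h⟩ := hv
  refine (D.tail_le N v w hw).trans ?_
  gcongr
  · exact le_abs_self _
  exact abs_le_of_sq_le_sq' (by nlinarith [sq_nonneg ‖v‖]) hM |>.2

variable {n : ℕ} (hn : 1 ≤ n) {ε B : ℝ} (hε : 0 < ε) (hL : 1 ≤ Real.log ε⁻¹) (hB : 1 ≤ B)

/-- On the ball itself F(v) is in H¹ with derivative at most KM, so the time regularity of the free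
flow applies. Both sides are L²-continuous in v. -/
theorem norm_A_nonlin_sub_le_of_mem_closure (hM : 0 ≤ M) {v : S.L2}
    (hv : v ∈ closure (S.h1Ball M)) (t : ℝ) :
    ‖D.A t (nonlinL2 hn hε hL hB v) - nonlinL2 hn hε hL hB v‖ ≤
      √(2 * |t|) * (lipFactor n B * Real.log ε⁻¹ * M) := by
  have : IsClosed {v : S.L2 | ‖D.A t (nonlinL2 hn hε hL hB v) - nonlinL2 hn hε hL hB v‖ ≤
      √(2 * |t|) * (lipFactor n B * Real.log ε⁻¹ * M)} := by
    have hc := continuous_nonlinL2 hn hε hL hB (μ := S.vol)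
    exact isClosed_le ((((D.A t).continuous.comp hc).sub hc).norm) continuous_const
  refine closure_minimal ?_ this hv
  rintro v ⟨w, hw, h⟩
  obtain ⟨g, hg, hgn⟩ :=
    hw.comp_lipschitz (lipschitzWith_cutNonlin hn hε hL hB) (cutNonlin_zero n ε B)
  have hK := mul_nonneg (lipFactor_nonneg n hB) (zero_le_one.trans hL)
  rw [Real.coe_toNNReal _ hK] at hgn
  refine (D.norm_A_sub_le t _ g hg).trans ?_
  gcongr
  refine hgn.trans ?_
  gcongr
  exact abs_le_of_sq_le_sq' (by nlinarith [sq_nonneg ‖v‖]) hM |>.2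

end closure

/-! ### Regularity of weak solutions, Duhamel's formula, and the splitting error -/

section solution

variable {S : Domain1D} (D : SpectralData S) {n : ℕ} (hn : 1 ≤ n) {ε B : ℝ} (hε : 0 < ε)
  (hL : 1 ≤ Real.log ε⁻¹) (hB : 1 ≤ B) {M T : ℝ} {u₀ : S.L2} {u : ℝ → S.L2}

theorem IsWeakSolution.ae_mem_h1Ball (D : SpectralData S) (hM : 0 ≤ M)
    (hu : IsWeakSolution S n ε T u₀ u) (huM : S.linftyH1Norm T u ≤ ENNReal.ofReal M) :
    ∀ᵐ t ∂volume.restrict (Icc 0 T), S.HasACRep (u t) (S.weakDeriv (u t)) ∧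
      ‖u t‖ ^ 2 + ‖S.weakDeriv (u t)‖ ^ 2 ≤ M ^ 2 := by
  rw [Domain1D.linftyH1Norm, eLpNorm_exponent_top] at huM
  filter_upwards [hu.memLinftyH1.2.1,
    ae_le_eLpNormEssSup (f := fun t => S.h1Norm (u t)) (μ := volume.restrict (Icc 0 T))] with t h1 h2
  constructor
  · apply D.hasACRep
    rw [Domain1D.weakDeriv, dif_pos h1]
    exact Classical.choose_spec h1
  · have h3 := h2.trans huM
    have h4 : 0 ≤ S.h1Norm (u t) := Real.sqrt_nonneg _
    rw [Real.enorm_eq_ofReal h4, ENNReal.ofReal_le_ofReal_iff hM, Domain1D.h1Norm] at h3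
    exact (Real.sqrt_le_left hM).1 h3

/-- The spectrally truncated right-hand side `Λ u + P F(u)` of the equation. -/
def truncRhs (N : ℕ) (v : S.L2) : S.L2 := D.Λ N v + D.P N (nonlinL2 hn hε hL hB v)

theorem continuous_truncRhs (N : ℕ) : Continuous (truncRhs D hn hε hL hB N) :=
  (D.Λ N).continuous.add ((D.P N).continuous.comp (continuous_nonlinL2 hn hε hL hB))

theorem norm_truncRhs_le (N : ℕ) (v : S.L2) : ‖truncRhs D hn hε hL hB N v‖ ≤
    (‖D.Λ N‖ + lipFactor n B * Real.log ε⁻¹) * ‖v‖ := by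
  refine (norm_add_le _ _).trans ?_
  have h1 := (D.Λ N).le_opNorm v
  have h2 := (D.norm_P_le N (nonlinL2 hn hε hL hB v)).trans (norm_nonlinL2_le hn hε hL hB v)
  linarith

/-- For test functions in the range of P_N the derivative pairing becomes a pairing with the bounded
operator Λ_N, and the cut-off is invisible to u. The weak form then turns into an integral equation
in L². -/
theorem IsWeakSolution.P_eq (hM : 0 ≤ M)
    (hMB : ∀ v ∈ S.h1Ball M, ∀ᵐ x ∂S.vol, ‖v x‖ ≤ B)
    (hu : IsWeakSolution S n ε T u₀ u) (huM : S.linftyH1Norm T u ≤ ENNReal.ofReal M) (N : ℕ) :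
    IntegrableOn (fun s => truncRhs D hn hε hL hB N (u s)) (Icc 0 T) ∧
    ∀ t ∈ Icc 0 T, D.P N (u t) = D.P N u₀ -
      Complex.I • ∫ s in (0 : ℝ)..t, truncRhs D hn hε hL hB N (u s) := by
  have hae := hu.ae_mem_h1Ball D hM huM
  have h_int : IntegrableOn (fun s => truncRhs D hn hε hL hB N (u s)) (Icc 0 T) := by
    refine Integrable.of_bound
      ((continuous_truncRhs D hn hε hL hB N).comp_aestronglyMeasurable hu.memLinftyH1.1)
      ((‖D.Λ N‖ + lipFactor n B * Real.log ε⁻¹) * M) ?_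
    filter_upwards [hae] with s hs
    refine (norm_truncRhs_le D hn hε hL hB N (u s)).trans ?_
    have := mul_nonneg (lipFactor_nonneg n hB) (zero_le_one.trans hL)
    gcongr
    exact (abs_le_of_sq_le_sq' (by nlinarith [sq_nonneg ‖S.weakDeriv (u s)‖, hs.2]) hM).2
  refine ⟨h_int, fun t ht => ?_⟩
  have hsub : Ioc 0 t ⊆ Icc 0 T := fun s hs => ⟨hs.1.le, hs.2.trans ht.2⟩
  have hii : IntervalIntegrable (fun s => truncRhs D hn hε hL hB N (u s)) volume 0 t := by
    rw [intervalIntegrable_iff_integrableOn_Ioc_of_le ht.1]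
    exact h_int.mono_set hsub
  refine ext_inner_left ℂ fun ψ => ?_
  have h1 := hu.weak_eq (D.P N ψ) (D.memH1_P N ψ) t ht
  have h2 : ∫ s in (0 : ℝ)..t, (inner ℂ (S.weakDeriv (D.P N ψ)) (S.weakDeriv (u s))
        + ∫ x, conj (D.P N ψ x) * (u s x * (regLog n ε (‖u s x‖ ^ 2) : ℂ)) ∂S.vol) =
      ∫ s in (0 : ℝ)..t, inner ℂ ψ (truncRhs D hn hε hL hB N (u s)) := by
    refine intervalIntegral.integral_congr_ae ?_
    rw [uIoc_of_le ht.1]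
    have := ae_imp_of_ae_restrict hae
    filter_upwards [this] with s hs hs'
    obtain ⟨h3, h4⟩ := hs (hsub hs')
    rw [truncRhs, inner_add_right, ← D.Λ_symm, ← D.P_symm, D.inner_weakDeriv_P N ψ _ _ h3,
      inner_eq_integral (D.P N ψ) (nonlinL2 hn hε hL hB (u s))]
    congr 1
    refine integral_congr_ae ?_
    filter_upwards [coeFn_nonlinL2 hn hε hL hB (u s), hMB (u s) ⟨_, h3, h4⟩] with x h5 h6
    rw [h5, cutNonlin_of_le h6]
  have h3 : ∫ s in (0 : ℝ)..t, inner ℂ ψ (truncRhs D hn hε hL hB N (u s)) =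
      inner ℂ ψ (∫ s in (0 : ℝ)..t, truncRhs D hn hε hL hB N (u s)) :=
    (innerSL ℂ ψ).intervalIntegral_comp_comm hii
  rw [h2, h3] at h1
  rw [inner_sub_right, inner_smul_right, ← h1, ← D.P_symm, ← D.P_symm, ← mul_assoc, Complex.I_mul_I]
  ring

/-- Each P_N u is a primitive in time, hence continuous, and the H¹ bound makes the convergence to u
uniform. -/
theorem IsWeakSolution.continuousOn (D : SpectralData S) (hn : 1 ≤ n) (hε : 0 < ε)
    (hL : 1 ≤ Real.log ε⁻¹) (hB : 1 ≤ B) (hM : 0 ≤ M) (hT : 0 < T)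
    (hMB : ∀ v ∈ S.h1Ball M, ∀ᵐ x ∂S.vol, ‖v x‖ ≤ B)
    (hu : IsWeakSolution S n ε T u₀ u) (huM : S.linftyH1Norm T u ≤ ENNReal.ofReal M) :
    ContinuousOn u (Icc 0 T) := by
  have hae := hu.ae_mem_h1Ball D hM huM
  have hP : ∀ N, ContinuousOn (fun t => D.P N (u t)) (Icc 0 T) := by
    intro N
    obtain ⟨h1, h2⟩ := hu.P_eq D hn hε hL hB hM hMB huM N
    refine ContinuousOn.congr ?_ h2
    refine continuousOn_const.sub (ContinuousOn.const_smul ?_ Complex.I)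
    have := intervalIntegral.continuousOn_primitive_interval (a := 0) (b := T) (μ := volume)
      (f := fun s => truncRhs D hn hε hL hB N (u s)) (by rwa [uIcc_of_le hT.le])
    rwa [uIcc_of_le hT.le] at this
  -- The tail bound is known only for almost every t, and u is not yet continuous. An additional
  -- projection P_K makes the expression continuous in t; afterwards K tends to infinity.
  have tail : ∀ N, ∀ t ∈ Icc 0 T, ‖u t - D.P N (u t)‖ ≤ |D.δ N| * M := by
    intro N t ht
    have hK : ∀ K, ‖D.P K (u t - D.P N (u t))‖ ≤ |D.δ N| * M := by
      intro K
      have hc : ContinuousOn (fun t => ‖D.P K (u t - D.P N (u t))‖) (Icc 0 T) := by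
        simp_rw [map_sub]
        exact ((hP K).sub ((D.P K).continuous.comp_continuousOn (hP N))).norm
      refine forall_Icc_le_of_ae hT hc ?_ t ht
      filter_upwards [hae] with s hs
      exact (D.norm_P_le K _).trans (norm_sub_P_le_of_mem_ball D hM ⟨_, hs.1, hs.2⟩ N)
    exact le_of_tendsto' (D.tendsto_P _).norm hK
  have hunif : TendstoUniformlyOn (fun N t => D.P N (u t)) u atTop (Icc 0 T) := by
    rw [Metric.tendstoUniformlyOn_iff]
    intro η hη
    have h0 : Tendsto (fun N => |D.δ N| * M) atTop (𝓝 (|0| * M)) := (D.tendsto_δ.abs).mul_const M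
    rw [abs_zero, zero_mul] at h0
    filter_upwards [h0.eventually_lt_const hη] with N hN t ht
    rw [dist_eq_norm]
    exact (tail N t ht).trans_lt hN
  exact hunif.continuousOn (Frequently.of_forall hP)

/-- The distance from u(t) to the ball is continuous in t and vanishes almost everywhere. This
replaces weak compactness in H¹. -/
theorem IsWeakSolution.mem_closure (D : SpectralData S) (hn : 1 ≤ n) (hε : 0 < ε)
    (hL : 1 ≤ Real.log ε⁻¹) (hB : 1 ≤ B) (hM : 0 ≤ M) (hT : 0 < T)
    (hMB : ∀ v ∈ S.h1Ball M, ∀ᵐ x ∂S.vol, ‖v x‖ ≤ B)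
    (hu : IsWeakSolution S n ε T u₀ u) (huM : S.linftyH1Norm T u ≤ ENNReal.ofReal M) :
    ∀ t ∈ Icc 0 T, u t ∈ closure (S.h1Ball M) := by
  have hae := hu.ae_mem_h1Ball D hM huM
  have hc := hu.continuousOn D hn hε hL hB hM hT hMB huM
  have hne : (S.h1Ball M).Nonempty := by
    have : (ae (volume.restrict (Icc (0 : ℝ) T))).NeBot := by
      rw [ae_neBot, Ne, Measure.restrict_eq_zero]; simp [hT]
    obtain ⟨t, ht⟩ := hae.exists
    exact ⟨u t, _, ht.1, ht.2⟩
  intro t ht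
  rw [Metric.mem_closure_iff_infDist_zero hne]
  refine le_antisymm ?_ Metric.infDist_nonneg
  refine forall_Icc_le_of_ae hT (f := fun t => Metric.infDist (u t) (S.h1Ball M))
    ((Metric.continuous_infDist_pt _).comp_continuousOn hc) ?_ t ht
  filter_upwards [hae] with s hs
  exact (Metric.infDist_zero_of_mem (show u s ∈ S.h1Ball M from ⟨_, hs.1, hs.2⟩)).le

/-- Duhamel's formula, as an estimate. -/
theorem IsWeakSolution.norm_duhamel_le (hM : 0 ≤ M) (hT : 0 < T)
    (hMB : ∀ v ∈ S.h1Ball M, ∀ᵐ x ∂S.vol, ‖v x‖ ≤ B)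
    (hu : IsWeakSolution S n ε T u₀ u) (huM : S.linftyH1Norm T u ≤ ENNReal.ofReal M)
    {t₀ τ c : ℝ} (ht₀ : 0 ≤ t₀) (hτ : 0 ≤ τ) (hc : 0 ≤ c) (htτ : t₀ + τ ≤ T) (z : S.L2)
    (hz : ∀ s ∈ Icc 0 τ, ‖D.A (-s) (nonlinL2 hn hε hL hB (u (t₀ + s))) - z‖ ≤ c) :
    ‖D.A (-τ) (u (t₀ + τ)) - u t₀ + (Complex.I * τ) • z‖ ≤ c * τ := by
  have hcont := hu.continuousOn D hn hε hL hB hM hT hMB huM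
  -- A continuous extension beyond [0, T] makes the integral `Y` differentiable at every real time.
  set U : ℝ → S.L2 := IccExtend hT.le (fun t : Icc 0 T => u t) with hU
  have hUc : Continuous U := (continuousOn_iff_continuous_domRestrict.1 hcont).Icc_extend'
  have hUu : ∀ t ∈ Icc 0 T, U t = u t := fun t ht => IccExtend_of_mem hT.le _ ht
  refine D.norm_le_of_forall_inner (mul_nonneg hc hτ) fun N ψ => ?_
  obtain ⟨-, hP⟩ := hu.P_eq D hn hε hL hB hM hMB huM N
  set q : ℝ → S.L2 := fun s => truncRhs D hn hε hL hB N (U s) with hq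
  have hqc : Continuous q := (continuous_truncRhs D hn hε hL hB N).comp hUc
  set Y : ℝ → S.L2 := fun t => D.P N u₀ - Complex.I • ∫ s in (0 : ℝ)..t, q s with hY
  have hYd : ∀ t, HasDerivAt Y (-Complex.I • q t) t := by
    intro t
    have h1 := (hqc.integral_hasStrictDerivAt 0 t).hasDerivAt
    have h2 := (h1.const_smul Complex.I).const_sub (D.P N u₀)
    rw [neg_smul]
    exact h2
  have hYu : ∀ t ∈ Icc 0 T, Y t = D.P N (u t) := by
    intro t ht
    rw [hP t ht, hY]
    dsimp only
    congr 2
    refine intervalIntegral.integral_congr fun s hs => ?_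
    rw [uIcc_of_le ht.1] at hs
    simp only [hq]
    rw [hUu s ⟨hs.1, hs.2.trans ht.2⟩]
  have hmem : ∀ s ∈ Icc 0 τ, t₀ + s ∈ Icc 0 T := fun s hs =>
    ⟨add_nonneg ht₀ hs.1, (add_le_add_right hs.2 t₀).trans htτ⟩
  -- In the derivative of G the Λ-term of the equation cancels the one of the free flow, leaving the
  -- pairing of P_N ψ with e^{-isΔ}F(u(t₀+s)) − z. The mean value inequality then gives the bound.
  set G : ℝ → ℂ := fun s => inner ℂ (D.A s (D.P N ψ)) (Y (t₀ + s)) +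
    (Complex.I * s) * inner ℂ (D.P N ψ) z with hG
  have hGd : ∀ s, HasDerivAt G (inner ℂ (D.A s (D.P N ψ)) (-Complex.I • q (t₀ + s)) +
      inner ℂ (-Complex.I • D.A s (D.Λ N ψ)) (Y (t₀ + s)) +
      Complex.I * inner ℂ (D.P N ψ) z) s := by
    intro s
    have h1 := (D.hasDerivAt_A N ψ s).inner ℂ ((hYd (t₀ + s)).comp_const_add t₀ s)
    have h2 : HasDerivAt (fun s : ℝ => (Complex.I * (s : ℂ)) * inner ℂ (D.P N ψ) z)
        (Complex.I * inner ℂ (D.P N ψ) z) s := by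
      have := ((Complex.ofRealCLM.hasDerivAt (x := s)).const_mul Complex.I).mul_const
        (inner ℂ (D.P N ψ) z)
      simpa using this
    exact h1.add h2
  have hbound : ∀ s ∈ Ico 0 τ, ‖inner ℂ (D.A s (D.P N ψ)) (-Complex.I • q (t₀ + s)) +
      inner ℂ (-Complex.I • D.A s (D.Λ N ψ)) (Y (t₀ + s)) +
      Complex.I * inner ℂ (D.P N ψ) z‖ ≤ c * ‖ψ‖ := by
    intro s hs
    have hs' := Ico_subset_Icc_self hs
    have e : inner ℂ (D.A s (D.P N ψ)) (-Complex.I • q (t₀ + s)) +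
        inner ℂ (-Complex.I • D.A s (D.Λ N ψ)) (Y (t₀ + s)) +
        Complex.I * inner ℂ (D.P N ψ) z =
        -Complex.I * inner ℂ (D.P N ψ)
          (D.A (-s) (nonlinL2 hn hε hL hB (u (t₀ + s))) - z) := by
      rw [hYu _ (hmem s hs')]
      simp only [hq]
      rw [hUu _ (hmem s hs'), truncRhs, inner_smul_right, inner_smul_left, inner_add_right,
        ← D.Λ_symm, ← D.P_symm, ← D.P_symm, D.Λ_A, D.P_A, ← D.Λ_A N s ψ, D.P_Λ, inner_sub_right,
        ← D.inner_A, map_neg, Complex.conj_I]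
      ring
    rw [e, norm_mul, norm_neg, Complex.norm_I, one_mul]
    refine (norm_inner_le_norm _ _).trans ?_
    rw [mul_comm]
    gcongr
    · exact hz s hs'
    · exact D.norm_P_le N ψ
  have hfin := norm_image_sub_le_of_norm_deriv_le_segment' (f := G) (a := 0) (b := τ)
    (fun s _ => (hGd s).hasDerivWithinAt) hbound τ (right_mem_Icc.2 hτ)
  have e : inner ℂ (D.P N ψ) (D.A (-τ) (u (t₀ + τ)) - u t₀ + (Complex.I * τ) • z) = G τ - G 0 := by
    simp only [hG]
    rw [hYu _ (hmem τ (right_mem_Icc.2 hτ)), hYu _ (hmem 0 (left_mem_Icc.2 hτ)), D.A_zero,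
      ← D.P_symm, ← D.P_symm, D.P_A, inner_add_right, inner_sub_right, inner_smul_right,
      ← D.inner_A, add_zero]
    -- Idempotence is the commutation of P_N with the flow at time zero.
    have hPP : D.P N (D.P N ψ) = D.P N ψ := by
      have := D.P_A N 0 ψ
      rwa [D.A_zero] at this
    rw [hPP]
    push_cast
    ring
  rw [e]
  refine hfin.trans_eq ?_
  ring

/-- Duhamel with z = 0 measures the nonlinear contribution, of size sKM. The free flow adds √(2s)M.
-/
theorem IsWeakSolution.norm_increment_le (D : SpectralData S) (hn : 1 ≤ n) (hε : 0 < ε)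
    (hL : 1 ≤ Real.log ε⁻¹) (hB : 1 ≤ B) (hM : 0 ≤ M) (hT : 0 < T)
    (hMB : ∀ v ∈ S.h1Ball M, ∀ᵐ x ∂S.vol, ‖v x‖ ≤ B)
    (hu : IsWeakSolution S n ε T u₀ u) (huM : S.linftyH1Norm T u ≤ ENNReal.ofReal M)
    {t₀ s : ℝ} (ht₀ : 0 ≤ t₀) (hs : 0 ≤ s) (hts : t₀ + s ≤ T) :
    ‖u (t₀ + s) - u t₀‖ ≤ √(2 * s) * M + s * (lipFactor n B * Real.log ε⁻¹ * M) := by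
  have hmem := hu.mem_closure D hn hε hL hB hM hT hMB huM
  have hK := mul_nonneg (lipFactor_nonneg n hB) (zero_le_one.trans hL)
  have h1 := hu.norm_duhamel_le D hn hε hL hB hM hT hMB huM ht₀ hs (mul_nonneg hK hM) hts 0
    (fun r hr => by
      rw [sub_zero, (D.A _).norm_map]
      refine (norm_nonlinL2_le hn hε hL hB _).trans ?_
      gcongr
      exact norm_le_of_mem_closure hM (hmem _ ⟨add_nonneg ht₀ hr.1,
        (add_le_add_right hr.2 t₀).trans hts⟩))
  rw [smul_zero, add_zero] at h1
  have h2 := norm_A_sub_le_of_mem_closure D hM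
    (hmem t₀ ⟨ht₀, (le_add_of_nonneg_right hs).trans hts⟩) (-s)
  rw [abs_neg, abs_of_nonneg hs] at h2
  rw [← (D.A (-s)).norm_map, map_sub]
  have h3 := norm_sub_le_norm_sub_add_norm_sub (D.A (-s) (u (t₀ + s))) (u t₀) (D.A (-s) (u t₀))
  rw [norm_sub_rev (u t₀)] at h3
  linarith

/-- The local error of one step of the splitting. -/
theorem IsWeakSolution.norm_step_sub_le (D : SpectralData S) (hn : 1 ≤ n) (hε : 0 < ε)
    (hL : 1 ≤ Real.log ε⁻¹) (hB : 1 ≤ B) (hM : 0 ≤ M) (hT : 0 < T)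
    (hMB : ∀ v ∈ S.h1Ball M, ∀ᵐ x ∂S.vol, ‖v x‖ ≤ B)
    (hu : IsWeakSolution S n ε T u₀ u) (huM : S.linftyH1Norm T u ≤ ENNReal.ofReal M)
    {t₀ τ K : ℝ} (ht₀ : 0 ≤ t₀) (hτ : 0 ≤ τ) (htτ : t₀ + τ ≤ T)
    (hK : K = lipFactor n B * Real.log ε⁻¹) :
    ‖flowA S τ (flowB S n ε τ (u t₀)) - u (t₀ + τ)‖ ≤
      τ * (3 * τ * K ^ 2 * M + 2 * √(2 * τ) * K * M) := by
  have hmem := hu.mem_closure D hn hε hL hB hM hT hMB huM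
  have hK0 : 0 ≤ K := hK ▸ mul_nonneg (lipFactor_nonneg n hB) (zero_le_one.trans hL)
  have ht₀T : t₀ ∈ Icc 0 T := ⟨ht₀, (le_add_of_nonneg_right hτ).trans htτ⟩
  have hbd : ∀ᵐ x ∂S.vol, ‖u t₀ x‖ ≤ B :=
    closure_minimal hMB (isClosed_setOf_ae_norm_le B (zero_le_one.trans hB)) (hmem t₀ ht₀T)
  have h1 := norm_flowB_sub_sub_le hn hε hL hB S τ (u t₀) hbd
  have h1' : 2 * (τ * K) ^ 2 * ‖u t₀‖ ≤ 2 * (τ * K) ^ 2 * M := by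
    gcongr; exact norm_le_of_mem_closure hM (hmem t₀ ht₀T)
  -- The first summand of c is the action of e^{-isΔ} on F(u(t₀+s)), the second K times the
  -- increment of u over the step.
  have h2 := hu.norm_duhamel_le D hn hε hL hB hM hT hMB huM ht₀ hτ
    (c := √(2 * τ) * (K * M) + K * (√(2 * τ) * M + τ * (K * M))) (by positivity) htτ
    (nonlinL2 hn hε hL hB (u t₀)) (fun s hs => by
      have hs' : t₀ + s ∈ Icc 0 T := ⟨add_nonneg ht₀ hs.1, (add_le_add_right hs.2 t₀).trans htτ⟩
      have a1 := norm_A_nonlin_sub_le_of_mem_closure D hn hε hL hB hM (hmem _ hs') (-s)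
      have a2 := norm_nonlinL2_sub_le hn hε hL hB (u (t₀ + s)) (u t₀)
      have a3 := hu.norm_increment_le D hn hε hL hB hM hT hMB huM ht₀ hs.1 hs'.2
      rw [← hK] at a1 a2 a3
      rw [abs_neg, abs_of_nonneg hs.1] at a1
      have a4 : √(2 * s) ≤ √(2 * τ) := Real.sqrt_le_sqrt (by linarith [hs.2])
      refine (norm_sub_le_norm_sub_add_norm_sub _
        (nonlinL2 hn hε hL hB (u (t₀ + s))) _).trans (add_le_add ?_ ?_)
      · exact a1.trans (by gcongr)
      · refine a2.trans ?_
        gcongr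
        refine a3.trans ?_
        gcongr
        exact hs.2)
  rw [← hK] at h1
  have e : flowA S τ (flowB S n ε τ (u t₀)) - u (t₀ + τ) =
      D.A τ (flowB S n ε τ (u t₀) - D.A (-τ) (u (t₀ + τ))) := by
    rw [map_sub, D.A_A_neg, D.A_eq]
  rw [e, (D.A τ).norm_map]
  -- Both flows are compared with u − iτF(u). The coefficient 3 is 2 from the phase expansion plus 1
  -- from the increment; the two terms with √(2τ) come from the two parts of c.
  have e2 : flowB S n ε τ (u t₀) - D.A (-τ) (u (t₀ + τ)) =
      (flowB S n ε τ (u t₀) - u t₀ + (Complex.I * τ) • nonlinL2 hn hε hL hB (u t₀)) -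
      (D.A (-τ) (u (t₀ + τ)) - u t₀ + (Complex.I * τ) • nonlinL2 hn hε hL hB (u t₀)) := by abel
  rw [e2]
  refine (norm_sub_le _ _).trans ?_
  refine (add_le_add (h1.trans h1') h2).trans_eq ?_
  ring

theorem norm_lieTrotter (D : SpectralData S) (τ : ℝ) (k : ℕ) : ‖lieTrotter S n ε τ u₀ k‖ = ‖u₀‖ := by
  induction k with
  | zero => rfl
  | succ k ih => rw [lieTrotter, ← D.A_eq, (D.A τ).norm_map, norm_flowB, ih]

/-- Each step multiplies the accumulated error by at most 1 + 4nτ ≤ exp(4nτ) and adds one local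
error. -/
theorem IsWeakSolution.norm_lieTrotter_sub_le (D : SpectralData S) (hn : 1 ≤ n) (hε : 0 < ε)
    (hL : 1 ≤ Real.log ε⁻¹) (hB : 1 ≤ B) (hM : 0 ≤ M) (hT : 0 < T)
    (hMB : ∀ v ∈ S.h1Ball M, ∀ᵐ x ∂S.vol, ‖v x‖ ≤ B)
    (hu : IsWeakSolution S n ε T u₀ u) (huM : S.linftyH1Norm T u ≤ ENNReal.ofReal M)
    {τ K : ℝ} (hτ : 0 ≤ τ) (hK : K = lipFactor n B * Real.log ε⁻¹) (k : ℕ) (hk : k * τ ≤ T) :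
    ‖lieTrotter S n ε τ u₀ k - u (k * τ)‖ ≤ Real.exp (4 * n * (k * τ)) *
      (k * (τ * (3 * τ * K ^ 2 * M + 2 * √(2 * τ) * K * M))) := by
  have hK0 : 0 ≤ K := hK ▸ mul_nonneg (lipFactor_nonneg n hB) (zero_le_one.trans hL)
  set l := τ * (3 * τ * K ^ 2 * M + 2 * √(2 * τ) * K * M) with hl
  have hl0 : 0 ≤ l := by positivity
  induction k with
  | zero => simp [lieTrotter, hu.init]
  | succ k ih =>
    have e : ((k + 1 : ℕ) : ℝ) * τ = k * τ + τ := by push_cast; ring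
    rw [e] at hk ⊢
    have ih := ih (by linarith)
    have h1 := hu.norm_step_sub_le D hn hε hL hB hM hT hMB huM (t₀ := k * τ) (by positivity) hτ hk hK
    rw [← hl] at h1
    have h2 : ‖flowA S τ (flowB S n ε τ (lieTrotter S n ε τ u₀ k)) -
        flowA S τ (flowB S n ε τ (u (k * τ)))‖ ≤
        (1 + 4 * n * τ) * ‖lieTrotter S n ε τ u₀ k - u (k * τ)‖ := by
      rw [← D.A_eq, ← D.A_eq, ← map_sub, (D.A τ).norm_map]
      exact norm_flowB_sub_le S hn hε hτ _ _
    rw [lieTrotter]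
    have h3 := norm_sub_le_norm_sub_add_norm_sub
      (flowA S τ (flowB S n ε τ (lieTrotter S n ε τ u₀ k)))
      (flowA S τ (flowB S n ε τ (u (k * τ)))) (u (k * τ + τ))
    have h4 : 1 + 4 * n * τ ≤ Real.exp (4 * n * τ) := by
      linarith [Real.add_one_le_exp (4 * n * τ)]
    have h5 : (1 + 4 * n * τ) * ‖lieTrotter S n ε τ u₀ k - u (k * τ)‖ ≤
        Real.exp (4 * n * τ) * (Real.exp (4 * n * (k * τ)) * (k * l)) := by gcongr
    have h6 : Real.exp (4 * n * (k * τ + τ)) = Real.exp (4 * n * τ) * Real.exp (4 * n * (k * τ)) := by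
      rw [← Real.exp_add]; ring_nf
    have h7 : l ≤ Real.exp (4 * n * (k * τ + τ)) * l :=
      le_mul_of_one_le_left hl0 (Real.one_le_exp (by positivity))
    calc _ ≤ Real.exp (4 * n * τ) * (Real.exp (4 * n * (k * τ)) * (k * l)) +
          Real.exp (4 * n * (k * τ + τ)) * l := by linarith
      _ = _ := by rw [h6]; push_cast; ring

end solution

/-- The error estimate for the splitting, from the spectral calculus. -/
theorem SpectralData.exists_error_bound {S : Domain1D} (D : SpectralData S) (n : ℕ) (hn : 1 ≤ n)
    (M T : ℝ) (hT : 0 < T) :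
    ∃ C : ℝ, 0 < C ∧ ∀ ε : ℝ, 0 < ε → ε ≤ 1 / 3 → ∀ (u₀ : S.L2) (u : ℝ → S.L2),
      IsWeakSolution S n ε T u₀ u → S.linftyH1Norm T u ≤ ENNReal.ofReal M →
      ∀ τ : ℝ, 0 < τ → ∀ k : ℕ, (k : ℝ) * τ ≤ T →
        ‖lieTrotter S n ε τ u₀ k - u ((k : ℝ) * τ)‖ ≤ C * Real.log ε⁻¹ * √τ := by
  obtain ⟨C₀, hC₀, hemb⟩ := S.exists_forall_norm_le
  -- M may be negative, in which case the hypothesis says that the norm is zero.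
  set M' := max M 0 with hM'
  have hM0 : 0 ≤ M' := le_max_right _ _
  set B := 1 + C₀ * (1 + M' ^ 2) with hBdef
  have hB : 1 ≤ B := by
    have : 0 ≤ C₀ * (1 + M' ^ 2) := by positivity
    linarith
  have hMB : ∀ v ∈ S.h1Ball M', ∀ᵐ x ∂S.vol, ‖v x‖ ≤ B := by
    rintro v ⟨w, hw, h⟩
    filter_upwards [hemb v w hw] with x hx
    refine hx.trans ?_
    have : C₀ * (1 + ‖v‖ ^ 2 + ‖w‖ ^ 2) ≤ C₀ * (1 + M' ^ 2) :=
      mul_le_mul_of_nonneg_left (by linarith) hC₀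
    linarith
  set c := lipFactor n B with hc
  have hc0 : 0 ≤ c := lipFactor_nonneg n hB
  refine ⟨Real.exp (4 * n * T) * (T * (3 * c ^ 2 * M' + 3 * c * M')) + 2 * M' + 1, by positivity,
    fun ε hε hε' u₀ u hu huM τ hτ k hk => ?_⟩
  -- The threshold 1/3 is below 1/e.
  have hL : 1 ≤ Real.log ε⁻¹ := by
    rw [Real.le_log_iff_exp_le (by positivity)]
    have h1 := Real.exp_one_lt_d9
    have h2 : (3 : ℝ) ≤ ε⁻¹ := by
      rw [le_inv_comm₀ (by norm_num) hε]; linarith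
    linarith
  have huM' : S.linftyH1Norm T u ≤ ENNReal.ofReal M' :=
    huM.trans (ENNReal.ofReal_le_ofReal (le_max_left _ _))
  set L := Real.log ε⁻¹ with hLdef
  have hL0 : 0 ≤ L := zero_le_one.trans hL
  have hsq : √τ * √τ = τ := Real.mul_self_sqrt hτ.le
  have hs0 := Real.sqrt_nonneg τ
  -- In the first case L²τ ≤ L√τ absorbs the quadratic term of the global error. In the second, both
  -- functions have L² norm at most M' and 2M' ≤ 2M' L√τ.
  rcases le_total (L * √τ) 1 with h | h
  · have h1 := hu.norm_lieTrotter_sub_le D hn hε hL hB hM0 hT hMB huM' hτ.le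
      (K := c * L) rfl k hk
    refine h1.trans ?_
    have h2 : 3 * τ * (c * L) ^ 2 * M' ≤ 3 * c ^ 2 * M' * (L * √τ) := by
      have : τ * L ^ 2 ≤ L * √τ := by
        calc τ * L ^ 2 = (L * √τ) * (L * √τ) := by rw [mul_mul_mul_comm, hsq]; ring
          _ ≤ 1 * (L * √τ) := by gcongr
          _ = _ := one_mul _
      calc 3 * τ * (c * L) ^ 2 * M' = 3 * c ^ 2 * M' * (τ * L ^ 2) := by ring
        _ ≤ _ := by gcongr
    have h3 : 2 * √(2 * τ) * (c * L) * M' ≤ 3 * c * M' * (L * √τ) := by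
      -- Since √2 ≤ 3/2, the coefficient 2√2 becomes 3.
      have : √(2 * τ) ≤ 3 / 2 * √τ := by
        rw [Real.sqrt_mul (by norm_num)]
        gcongr
        rw [Real.sqrt_le_left (by norm_num)]
        norm_num
      calc 2 * √(2 * τ) * (c * L) * M' ≤ 2 * (3 / 2 * √τ) * (c * L) * M' := by gcongr
        _ = _ := by ring
    calc Real.exp (4 * n * (k * τ)) * (k * (τ * (3 * τ * (c * L) ^ 2 * M' +
          2 * √(2 * τ) * (c * L) * M')))
        ≤ Real.exp (4 * n * T) * (k * (τ * (3 * c ^ 2 * M' * (L * √τ) + 3 * c * M' * (L * √τ)))) := by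
          gcongr
      _ = Real.exp (4 * n * T) * ((k * τ) * (3 * c ^ 2 * M' + 3 * c * M')) * (L * √τ) := by ring
      _ ≤ Real.exp (4 * n * T) * (T * (3 * c ^ 2 * M' + 3 * c * M')) * (L * √τ) := by gcongr
      _ ≤ _ := by
          have : 0 ≤ (2 * M' + 1) * (L * √τ) := by positivity
          linarith
  · have hmem := hu.mem_closure D hn hε hL hB hM0 hT hMB huM'
    have h1 := norm_le_of_mem_closure hM0 (hmem (k * τ) ⟨by positivity, hk⟩)
    have h2 := norm_le_of_mem_closure hM0 (hmem 0 ⟨le_rfl, hT.le⟩)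
    rw [hu.init] at h2
    refine (norm_sub_le _ _).trans ?_
    rw [norm_lieTrotter D]
    have h3 : 2 * M' * 1 ≤ 2 * M' * (L * √τ) := by gcongr
    have h4 : 0 ≤ (Real.exp (4 * n * T) * (T * (3 * c ^ 2 * M' + 3 * c * M')) + 1) * (L * √τ) := by
      positivity
    linarith

/-! ### Spectral calculus from an eigenbasis -/

section basis

variable {ι H : Type*} [NormedAddCommGroup H] [InnerProductSpace ℂ H]

theorem HilbertBasis.ext_inner (e : HilbertBasis ι ℂ H) {x y : H}
    (h : ∀ k, (inner ℂ (e k) x : ℂ) = inner ℂ (e k) y) : x = y := by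
  refine e.repr.injective (lp.ext (funext fun k => ?_))
  rw [e.repr_apply_apply, e.repr_apply_apply, h]

theorem HilbertBasis.hasSum_norm_sq_inner (e : HilbertBasis ι ℂ H) (x : H) :
    HasSum (fun k => ‖(inner ℂ (e k) x : ℂ)‖ ^ 2) (‖x‖ ^ 2) := by
  have h := e.hasSum_inner_mul_inner x x
  rw [inner_self_eq_norm_sq_to_K] at h
  have h2 := Complex.reCLM.hasSum h
  convert! h2 using 1
  · ext k
    change _ = (_ : ℂ).re
    rw [← inner_conj_symm x (e k), Complex.conj_mul']
    norm_cast
  · norm_cast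

theorem HilbertBasis.norm_le_of_norm_inner_le (e : HilbertBasis ι ℂ H) {x y : H}
    (h : ∀ k, ‖(inner ℂ (e k) x : ℂ)‖ ≤ ‖(inner ℂ (e k) y : ℂ)‖) : ‖x‖ ≤ ‖y‖ := by
  have := hasSum_le (fun k => pow_le_pow_left₀ (norm_nonneg _) (h k) 2)
    (HilbertBasis.hasSum_norm_sq_inner e x) (HilbertBasis.hasSum_norm_sq_inner e y)
  exact (sq_le_sq₀ (norm_nonneg _) (norm_nonneg _)).1 this

/-- The diagonal operator `∑ₖ m k ⟨e k, ·⟩ e k` over a finite set of indices. -/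
def diagOp (e : HilbertBasis ι ℂ H) (s : Finset ι) (m : ι → ℝ) : H →L[ℂ] H :=
  ∑ k ∈ s, (innerSL ℂ (e k)).smulRight ((m k : ℂ) • e k)

theorem diagOp_apply (e : HilbertBasis ι ℂ H) (s : Finset ι) (m : ι → ℝ) (v : H) :
    diagOp e s m v = ∑ k ∈ s, (inner ℂ (e k) v : ℂ) • ((m k : ℂ) • e k) := by
  simp [diagOp]

theorem diagOp_symm (e : HilbertBasis ι ℂ H) (s : Finset ι) (m : ι → ℝ) (v w : H) :
    (inner ℂ (diagOp e s m v) w : ℂ) = inner ℂ v (diagOp e s m w) := by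
  rw [diagOp_apply, diagOp_apply, inner_sum, sum_inner]
  refine Finset.sum_congr rfl fun k _ => ?_
  simp only [inner_smul_left, inner_smul_right, Complex.conj_ofReal, inner_conj_symm]
  ring

variable [DecidableEq ι]

theorem HilbertBasis.inner_eq_ite (e : HilbertBasis ι ℂ H) (j k : ι) :
    (inner ℂ (e j) (e k) : ℂ) = if j = k then 1 else 0 :=
  orthonormal_iff_ite.1 e.orthonormal j k

/-- The unitary map that multiplies the basis vector `e k` by `exp(iθ k)`. -/
theorem HilbertBasis.exists_phase [CompleteSpace H] (e : HilbertBasis ι ℂ H) (θ : ι → ℝ) :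
    ∃ A : H →ₗᵢ[ℂ] H, (∀ v, HasSum (fun k => Complex.exp (Complex.I * (θ k : ℂ)) •
        ((inner ℂ (e k) v : ℂ) • e k)) (A v)) ∧
      ∀ k v, (inner ℂ (e k) (A v) : ℂ) = Complex.exp (Complex.I * (θ k : ℂ)) * inner ℂ (e k) v := by
  have hne : ∀ k, Complex.exp (Complex.I * (θ k : ℂ)) ≠ 0 := fun k => Complex.exp_ne_zero _
  -- The rotated vectors form another Hilbert basis, and the unitary map carries one basis to the
  -- other.
  have hon : Orthonormal ℂ (fun k => Complex.exp (Complex.I * (θ k : ℂ)) • e k) := by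
    rw [orthonormal_iff_ite]
    intro j k
    rw [inner_smul_left, inner_smul_right, HilbertBasis.inner_eq_ite]
    split_ifs with h
    · subst h
      rw [mul_one, Complex.conj_mul', mul_comm, Complex.norm_exp_ofReal_mul_I]
      simp
    · simp
  let e' : HilbertBasis ι ℂ H := HilbertBasis.mkOfOrthogonalEqBot hon (by
    rw [Submodule.eq_bot_iff]
    intro x hx
    refine HilbertBasis.ext_inner e fun k => ?_
    have := Submodule.inner_right_of_mem_orthogonal (Submodule.subset_span (mem_range_self k)) hx
    rw [inner_smul_left, mul_eq_zero] at this
    rw [inner_zero_right]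
    exact this.resolve_left (by simp [hne k]))
  have he' : ∀ k, e' k = Complex.exp (Complex.I * (θ k : ℂ)) • e k := fun k => by
    simp only [e', HilbertBasis.coe_mkOfOrthogonalEqBot]
  let A := (e.repr.trans e'.repr.symm).toLinearIsometry
  have hA : ∀ v, HasSum (fun k => Complex.exp (Complex.I * (θ k : ℂ)) •
      ((inner ℂ (e k) v : ℂ) • e k)) (A v) := by
    intro v
    have := e'.hasSum_repr_symm (e.repr v)
    convert! this using 2 with k
    rw [he', e.repr_apply_apply, smul_comm]
  refine ⟨A, hA, fun k v => ?_⟩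
  have h1 := (innerSL ℂ (e k)).hasSum (hA v)
  have h2 : HasSum (fun j => if j = k then
      Complex.exp (Complex.I * (θ k : ℂ)) * inner ℂ (e k) v else 0)
      (Complex.exp (Complex.I * (θ k : ℂ)) * inner ℂ (e k) v) := hasSum_ite_eq k _
  refine h1.unique ?_
  convert! h2 using 2 with j
  simp only [innerSL_apply_apply, inner_smul_right, HilbertBasis.inner_eq_ite]
  by_cases h : j = k
  · subst h; simp
  · rw [if_neg (Ne.symm h), if_neg h]; simp

theorem inner_diagOp (e : HilbertBasis ι ℂ H) (s : Finset ι) (m : ι → ℝ) (v : H) (j : ι) :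
    (inner ℂ (e j) (diagOp e s m v) : ℂ) = if j ∈ s then (m j : ℂ) * inner ℂ (e j) v else 0 := by
  rw [diagOp_apply, inner_sum]
  simp_rw [inner_smul_right, HilbertBasis.inner_eq_ite]
  simp [mul_comm]

/-- A Bessel inequality for the derivatives of the basis vectors. -/
theorem sum_mul_norm_sq_inner_le (e : HilbertBasis ι ℂ H) {d : ι → H} {lam : ι → ℝ}
    (hlam : ∀ k, 0 ≤ lam k) (hd : ∀ j k, (inner ℂ (d j) (d k) : ℂ) = lam j * inner ℂ (e j) (e k))
    {v w : H} (hvw : ∀ k, (inner ℂ (d k) w : ℂ) = lam k * inner ℂ (e k) v) (s : Finset ι) :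
    ∑ k ∈ s, lam k * ‖(inner ℂ (e k) v : ℂ)‖ ^ 2 ≤ ‖w‖ ^ 2 := by
  set E := ∑ k ∈ s, lam k * ‖(inner ℂ (e k) v : ℂ)‖ ^ 2 with hE
  -- Both ⟨ψ, w⟩ and ‖ψ‖² equal E, so Cauchy–Schwarz gives E ≤ √E ‖w‖.
  set ψ := ∑ k ∈ s, (inner ℂ (e k) v : ℂ) • d k with hψ
  have h1 : (inner ℂ ψ w : ℂ) = (E : ℂ) := by
    rw [hψ, sum_inner, hE]
    push_cast
    refine Finset.sum_congr rfl fun k _ => ?_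
    rw [inner_smul_left, hvw, ← Complex.conj_mul']
    ring
  have h2 : (inner ℂ ψ ψ : ℂ) = (E : ℂ) := by
    conv_lhs => rw [hψ, sum_inner]
    rw [hE]
    push_cast
    refine Finset.sum_congr rfl fun k hk => ?_
    rw [inner_smul_left, inner_sum]
    simp_rw [inner_smul_right, hd, HilbertBasis.inner_eq_ite]
    simp only [mul_ite, mul_one, mul_zero, Finset.sum_ite_eq, hk, if_true]
    rw [← Complex.conj_mul']
    ring
  have hE0 : 0 ≤ E := Finset.sum_nonneg fun k _ => mul_nonneg (hlam k) (by positivity)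
  have h3 : ‖ψ‖ ^ 2 = E := by
    rw [inner_self_eq_norm_sq_to_K] at h2
    exact Complex.ofReal_injective (by rw [← h2]; push_cast; rfl)
  have h4 : E ≤ ‖ψ‖ * ‖w‖ := by
    have := norm_inner_le_norm (𝕜 := ℂ) ψ w
    rwa [h1, Complex.norm_real, Real.norm_of_nonneg hE0] at this
  rw [← h3] at h4 ⊢
  rcases (norm_nonneg ψ).eq_or_lt with h0 | h0
  · rw [← h0]; simp
  · have : ‖ψ‖ ≤ ‖w‖ := by
      rw [sq] at h4
      exact le_of_mul_le_mul_left h4 h0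
    gcongr

/-- This is the common form of the tail bound and of the time regularity bound: each is a diagonal
operator whose squared symbol is at most C times the eigenvalue. -/
theorem norm_le_of_norm_sq_inner_le (e : HilbertBasis ι ℂ H) {d : ι → H} {lam : ι → ℝ}
    (hlam : ∀ k, 0 ≤ lam k) (hd : ∀ j k, (inner ℂ (d j) (d k) : ℂ) = lam j * inner ℂ (e j) (e k))
    {v w x : H} {C : ℝ} (hC : 0 ≤ C)
    (hvw : ∀ k, (inner ℂ (d k) w : ℂ) = lam k * inner ℂ (e k) v)
    (hx : ∀ k, ‖(inner ℂ (e k) x : ℂ)‖ ^ 2 ≤ C * (lam k * ‖(inner ℂ (e k) v : ℂ)‖ ^ 2)) :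
    ‖x‖ ≤ √C * ‖w‖ := by
  have h1 : ‖x‖ ^ 2 ≤ C * ‖w‖ ^ 2 := by
    refine hasSum_le_of_sum_le (HilbertBasis.hasSum_norm_sq_inner e x) fun s => ?_
    refine (Finset.sum_le_sum fun k _ => hx k).trans ?_
    rw [← Finset.mul_sum]
    exact mul_le_mul_of_nonneg_left (sum_mul_norm_sq_inner_le e hlam hd hvw s) hC
  refine le_of_sq_le_sq ?_ (by positivity)
  rwa [mul_pow, Real.sq_sqrt hC]

/-- Product of the bounds |y| and 2. With y = tλ the squared symbol is linear in λ, so one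
derivative in space buys the factor √(2|t|). -/
theorem norm_exp_mul_I_sub_one_sq_le (y : ℝ) :
    ‖Complex.exp (Complex.I * (y : ℂ)) - 1‖ ^ 2 ≤ 2 * |y| := by
  have h1 : ‖Complex.exp (Complex.I * (y : ℂ)) - 1‖ ≤ |y| := Real.norm_exp_I_mul_ofReal_sub_one_le
  have h2 : ‖Complex.exp (Complex.I * (y : ℂ)) - 1‖ ≤ 2 := by
    refine (norm_sub_le _ _).trans ?_
    rw [mul_comm, Complex.norm_exp_ofReal_mul_I, norm_one]
    norm_num
  rw [sq]
  exact mul_le_mul h2 h1 (norm_nonneg _) (by norm_num)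

end basis

/-- The spectral data of a domain whose Laplacian has an orthonormal basis of eigenfunctions. -/
theorem SpectralData.nonempty_of_basis {S : Domain1D} {ι : Type*} (e : HilbertBasis ι ℂ S.L2)
    (d : ι → S.L2) (lam : ι → ℝ) (hlam : ∀ k, 0 ≤ lam k)
    (hfin : ∀ N : ℕ, {k | lam k ≤ N + 1}.Finite)
    (hinner : ∀ k v w, S.HasACRep v w → (inner ℂ (d k) w : ℂ) = lam k * inner ℂ (e k) v)
    (hrep : ∀ v w, S.IsH1 v w → S.HasACRep v w)
    (huniq : ∀ v w w', S.IsH1 v w → S.IsH1 v w' → w = w')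
    (hsum : ∀ (s : Finset ι) (c : ι → ℂ), S.IsH1 (∑ k ∈ s, c k • e k) (∑ k ∈ s, c k • d k))
    (hflow : ∀ t v, flowA S t v = ∑' k, Complex.exp (Complex.I * ((-t * lam k : ℝ) : ℂ)) •
      ((inner ℂ (e k) v : ℂ) • e k)) : Nonempty (SpectralData S) := by
  classical
  -- The relation `hinner` is applied to the eigenfunction e k itself, whose derivative is d k.
  have hd : ∀ j k, (inner ℂ (d j) (d k) : ℂ) = lam j * inner ℂ (e j) (e k) := fun j k => by
    have h := hsum {k} (fun _ => 1)
    simp only [Finset.sum_singleton, one_smul] at h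
    exact hinner j _ _ (hrep _ _ h)
  choose A hA hAc using fun t : ℝ => HilbertBasis.exists_phase e (fun k => -t * lam k)
  set s : ℕ → Finset ι := fun N => (hfin N).toFinset with hs
  have hsm : ∀ N k, k ∈ s N ↔ lam k ≤ N + 1 := fun N k => by
    simp only [hs, Finite.mem_toFinset]; rfl
  set P : ℕ → S.L2 →L[ℂ] S.L2 := fun N => diagOp e (s N) (fun _ => 1) with hP
  set Λ : ℕ → S.L2 →L[ℂ] S.L2 := fun N => diagOp e (s N) lam with hΛ
  have hPc : ∀ N k v, (inner ℂ (e k) (P N v) : ℂ) = if k ∈ s N then inner ℂ (e k) v else 0 :=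
    fun N k v => by simp only [hP]; rw [inner_diagOp]; simp
  have hΛc : ∀ N k v, (inner ℂ (e k) (Λ N v) : ℂ) =
      if k ∈ s N then (lam k : ℂ) * inner ℂ (e k) v else 0 :=
    fun N k v => by simp only [hΛ]; rw [inner_diagOp]
  have hPsum : ∀ N v, P N v = ∑ k ∈ s N, (inner ℂ (e k) v : ℂ) • e k := fun N v => by
    simp only [hP]; rw [diagOp_apply]; simp
  have hPH1 : ∀ N v, S.IsH1 (P N v) (∑ k ∈ s N, (inner ℂ (e k) v : ℂ) • d k) := fun N v => by
    rw [hPsum]; exact hsum _ _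
  have hAe : ∀ t k, A t (e k) = Complex.exp (Complex.I * ((-t * lam k : ℝ) : ℂ)) • e k := by
    intro t k
    refine HilbertBasis.ext_inner e fun j => ?_
    rw [hAc, inner_smul_right, HilbertBasis.inner_eq_ite]
    by_cases h : j = k
    · subst h; rfl
    · simp [h]
  refine ⟨{
    A := A
    P := P
    Λ := Λ
    δ := fun N => √(1 / ((N : ℝ) + 1))
    A_eq := fun t v => by rw [hflow, (hA t v).tsum_eq]
    A_add := fun r t v => HilbertBasis.ext_inner e fun k => by
      rw [hAc, hAc, hAc, ← mul_assoc, ← Complex.exp_add]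
      congr 2
      push_cast
      ring
    A_zero := fun v => HilbertBasis.ext_inner e fun k => by rw [hAc]; simp
    P_symm := fun N v w => diagOp_symm e _ _ v w
    Λ_symm := fun N v w => diagOp_symm e _ _ v w
    norm_P_le := fun N v => HilbertBasis.norm_le_of_norm_inner_le e fun k => by
      rw [hPc]
      split_ifs
      · exact le_rfl
      · simp
    tendsto_P := fun v => ?_
    P_Λ := fun N v => HilbertBasis.ext_inner e fun k => by
      rw [hPc, hΛc]
      split_ifs <;> rfl
    P_A := fun N r v => HilbertBasis.ext_inner e fun k => by
      rw [hPc, hAc, hPc]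
      split_ifs <;> simp
    Λ_A := fun N r v => HilbertBasis.ext_inner e fun k => by
      rw [hΛc, hAc, hAc, hPc, hΛc]
      split_ifs
      · ring
      · simp
    hasDerivAt_A := fun N v r => ?_
    tendsto_δ := ?_
    tail_le := fun N v w h => ?_
    norm_A_sub_le := fun t v w h => ?_
    hasACRep := hrep
    memH1_P := fun N v => ⟨_, hPH1 N v⟩
    inner_weakDeriv_P := fun N φ v w h => ?_ }⟩
  · have h1 : HasSum (fun k => (inner ℂ (e k) v : ℂ) • e k) v := by
      have := e.hasSum_repr v
      simpa only [e.repr_apply_apply] using this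
    have h2 : Tendsto s atTop atTop := by
      refine Monotone.tendsto_atTop_finset (fun N N' hN k hk => ?_) fun k => ?_
      · rw [hsm] at hk ⊢
        have : (N : ℝ) ≤ N' := by exact_mod_cast hN
        linarith
      · obtain ⟨N, hN⟩ := exists_nat_ge (lam k)
        exact ⟨N, (hsm N k).2 (by linarith)⟩
    have := h1.comp h2
    refine this.congr fun N => ?_
    rw [Function.comp_apply, hPsum]
  · have e1 : (fun r => A r (P N v)) = fun r => ∑ k ∈ s N, (inner ℂ (e k) v : ℂ) •
        (Complex.exp (Complex.I * ((-r * lam k : ℝ) : ℂ)) • e k) := by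
      ext1 r
      rw [hPsum, map_sum]
      simp_rw [map_smul, hAe]
    have e2 : -Complex.I • A r (Λ N v) = ∑ k ∈ s N, (inner ℂ (e k) v : ℂ) •
        ((Complex.exp (Complex.I * ((-r * lam k : ℝ) : ℂ)) * (-Complex.I * lam k)) • e k) := by
      simp only [hΛ]
      rw [diagOp_apply, map_sum, Finset.smul_sum]
      refine Finset.sum_congr rfl fun k _ => ?_
      rw [map_smul, map_smul, hAe]
      simp only [smul_smul]
      congr 1
      ring
    rw [e1, e2]
    refine HasDerivAt.fun_sum fun k _ => HasDerivAt.fun_const_smul _ (HasDerivAt.smul_const ?_ _)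
    refine HasDerivAt.cexp ?_
    have h1 : HasDerivAt (fun r : ℝ => -r * lam k) (-1 * lam k) r :=
      (hasDerivAt_neg r).mul_const _
    have h2 := (h1.ofReal_comp).const_mul Complex.I
    convert! h2 using 1
    push_cast
    ring
  · have h1 : Tendsto (fun N : ℕ => 1 / ((N : ℝ) + 1)) atTop (𝓝 0) :=
      tendsto_one_div_add_atTop_nhds_zero_nat
    have := (Real.continuous_sqrt.tendsto 0).comp h1
    rwa [Real.sqrt_zero] at this
  · refine norm_le_of_norm_sq_inner_le e hlam hd (by positivity) (fun k => hinner k v w h) fun k => ?_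
    rw [inner_sub_right, hPc]
    have := hlam k
    split_ifs with hk
    · rw [sub_self, norm_zero, zero_pow two_ne_zero]
      positivity
    · rw [sub_zero]
      rw [hsm, not_le] at hk
      rw [← mul_assoc]
      refine le_mul_of_one_le_left (by positivity) ?_
      rw [one_div, inv_mul_eq_div, one_le_div (by positivity)]
      exact hk.le
  · refine norm_le_of_norm_sq_inner_le e hlam hd (by positivity) (fun k => hinner k v w h) fun k => ?_
    rw [inner_sub_right, hAc, ← sub_one_mul, norm_mul, mul_pow, ← mul_assoc]
    gcongr
    refine (norm_exp_mul_I_sub_one_sq_le _).trans_eq ?_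
    rw [abs_mul, abs_neg, abs_of_nonneg (hlam k)]
    ring
  · have h1 : S.weakDeriv (P N φ) = ∑ k ∈ s N, (inner ℂ (e k) φ : ℂ) • d k := by
      have hm : S.MemH1 (P N φ) := ⟨_, hPH1 N φ⟩
      rw [Domain1D.weakDeriv, dif_pos hm]
      exact huniq _ _ _ (Classical.choose_spec hm) (hPH1 N φ)
    rw [h1]
    simp only [hΛ]
    rw [diagOp_apply, sum_inner, sum_inner]
    refine Finset.sum_congr rfl fun k _ => ?_
    simp only [inner_smul_left, hinner k v w h, Complex.conj_ofReal]

/-! ### Functions on a bounded interval -/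

theorem Domain1D.isOpen_dom (S : Domain1D) : IsOpen S.dom := by
  cases S <;> simp [Domain1D.dom, isOpen_Ioo]

/-- The weak derivative is unique. -/
theorem Domain1D.HasACRep.unique {S : Domain1D} {v w w' : S.L2} (h : S.HasACRep v w)
    (h' : S.HasACRep v w') : w = w' := by
  obtain ⟨V, hV, hvV, -⟩ := h
  obtain ⟨V', hV', hvV', -⟩ := h'
  have h1 : V =ᵐ[volume.restrict S.dom] V' := by
    rw [← S.vol_eq]; exact hvV.symm.trans hvV'
  have h2 : EqOn V V' S.dom :=
    Measure.eqOn_open_of_ae_eq h1 S.isOpen_dom hV.continuous.continuousOn hV'.continuous.continuousOn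
  refine Lp.ext ?_
  rw [EventuallyEq, S.ae_vol_iff]
  filter_upwards [hV.ae_hasDerivAt, hV'.ae_hasDerivAt] with x h3 h4 hx
  rw [indicator_of_mem hx] at h3 h4
  exact h3.unique (h4.congr_of_eventuallyEq (h2.eventuallyEq_of_mem (S.isOpen_dom.mem_nhds hx)))

theorem memLp_Ioo_of_continuous {f : ℝ → ℂ} (hf : Continuous f) (a b : ℝ) :
    MemLp f 2 (volume.restrict (Ioo a b)) := by
  obtain ⟨C, hC⟩ := isCompact_Icc.exists_bound_of_continuousOn (s := Icc a b) hf.continuousOn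
  refine MemLp.of_bound hf.aestronglyMeasurable C ?_
  filter_upwards [ae_restrict_mem measurableSet_Ioo] with x hx
  exact hC x (Ioo_subset_Icc_self hx)

theorem setIntegral_Ioo_eq {a b : ℝ} (hab : a < b) (f : ℝ → ℂ) :
    ∫ x in Ioo a b, f x = ∫ x in a..b, f x := by
  rw [intervalIntegral.integral_of_le hab.le, integral_Ioc_eq_integral_Ioo]

section Ioo

variable {a b : ℝ}

/-- Only equality of the two boundary terms is required, which covers the periodic and the Dirichlet
condition at once. -/
theorem IsPrimitive.integral_mul_deriv_Ioo (hab : a < b)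
    {v w : Lp ℂ 2 (volume.restrict (Ioo a b))} {V : ℝ → ℂ}
    (hV : IsPrimitive V ((Ioo a b).indicator w)) (hv : v =ᵐ[volume.restrict (Ioo a b)] V)
    {φ φ' : ℝ → ℂ} (hd : ∀ x, HasDerivAt φ (φ' x) x) (hc : Continuous φ')
    (hb : V b * φ b = V a * φ a) :
    ∫ x in Ioo a b, v x * φ' x = - ∫ x in Ioo a b, w x * φ x := by
  have h1 := hV.integral_mul_deriv hd hc a b
  rw [hb, sub_self, zero_sub, ← setIntegral_Ioo_eq hab, ← setIntegral_Ioo_eq hab] at h1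
  have h2 : ∫ x in Ioo a b, v x * φ' x = ∫ x in Ioo a b, V x * φ' x :=
    integral_congr_ae (hv.mono fun x hx => by simp only [hx])
  have h3 : ∫ x in Ioo a b, w x * φ x = ∫ x in Ioo a b, (Ioo a b).indicator w x * φ x :=
    setIntegral_congr_fun measurableSet_Ioo fun x hx => by simp only [indicator_of_mem hx]
  rw [h2, h1, h3]

theorem locallyIntegrable_indicator_Ioo (w : Lp ℂ 2 (volume.restrict (Ioo a b))) :
    LocallyIntegrable ((Ioo a b).indicator w) volume :=
  ((memLp_indicator_iff_restrict measurableSet_Ioo).2 (Lp.memLp w)).locallyIntegrable one_le_two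

theorem integral_indicator_Ioo {w : ℝ → ℂ} {x : ℝ} (hx : x ∈ Icc a b) :
    ∫ t in a..x, (Ioo a b).indicator w t = ∫ t in a..x, w t := by
  rw [intervalIntegral.integral_of_le hx.1, intervalIntegral.integral_of_le hx.1,
    integral_Ioc_eq_integral_Ioo, integral_Ioc_eq_integral_Ioo]
  exact setIntegral_congr_fun measurableSet_Ioo fun t ht =>
    indicator_of_mem (show t ∈ Ioo a b from ⟨ht.1, ht.2.trans_le hx.2⟩) _

/-- A `C¹` function, cut off outside an interval, is an absolutely continuous representative. -/
theorem exists_isPrimitive_of_hasDerivAt (hab : a < b) {ψ ψ' : ℝ → ℂ}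
    (hd : ∀ x, HasDerivAt ψ (ψ' x) x) (hc : Continuous ψ')
    {v w : Lp ℂ 2 (volume.restrict (Ioo a b))} (hv : v =ᵐ[volume.restrict (Ioo a b)] ψ)
    (hw : w =ᵐ[volume.restrict (Ioo a b)] ψ') :
    ∃ V : ℝ → ℂ, IsPrimitive V ((Ioo a b).indicator w) ∧
      v =ᵐ[volume.restrict (Ioo a b)] V ∧ V a = ψ a ∧ V b = ψ b := by
  have hV : ∀ x ∈ Icc a b, ψ a + ∫ t in a..x, (Ioo a b).indicator w t = ψ x := by
    intro x hx
    rw [integral_indicator_Ioo hx]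
    have h1 : ∫ t in a..x, w t = ∫ t in a..x, ψ' t := by
      rw [intervalIntegral.integral_of_le hx.1, intervalIntegral.integral_of_le hx.1,
        integral_Ioc_eq_integral_Ioo, integral_Ioc_eq_integral_Ioo]
      exact integral_congr_ae (ae_restrict_of_ae_restrict_of_subset (Ioo_subset_Ioo_right hx.2) hw)
    rw [h1, intervalIntegral.integral_eq_sub_of_hasDerivAt (fun t _ => hd t)
      (hc.intervalIntegrable _ _)]
    ring
  refine ⟨_, IsPrimitive.of_integral (locallyIntegrable_indicator_Ioo w) (ψ a) a, ?_,
    hV a ⟨le_rfl, hab.le⟩, hV b ⟨hab.le, le_rfl⟩⟩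
  filter_upwards [hv, ae_restrict_mem measurableSet_Ioo] with x h1 h2
  rw [h1, hV x (Ioo_subset_Icc_self h2)]

/-- An `L²` function on an interval is zero if it is orthogonal to all test functions. -/
theorem Lp_eq_zero_of_integral_test {v : Lp ℂ 2 (volume.restrict (Ioo a b))} {m : ℝ → ℂ}
    (hm : Continuous m) (hm0 : ∀ x ∈ Ioo a b, m x ≠ 0)
    (h : ∀ g : ℝ → ℝ, ContDiff ℝ ∞ g → HasCompactSupport g → tsupport g ⊆ Ioo a b →
      ∫ x in Ioo a b, v x * m x * (g x : ℂ) = 0) : v = 0 := by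
  have h_int : Integrable (fun x => v x * m x) (volume.restrict (Ioo a b)) :=
    (memLp_Ioo_of_continuous hm a b).integrable_mul (Lp.memLp v) |>.congr
      (ae_of_all _ fun x => mul_comm _ _)
  have h1 : ∀ᵐ x ∂(volume : Measure ℝ), x ∈ Ioo a b → v x * m x = 0 := by
    refine isOpen_Ioo.ae_eq_zero_of_integral_contDiff_smul_eq_zero
      (IntegrableOn.locallyIntegrableOn h_int) fun g hg hgc hgs => ?_
    rw [← h g hg hgc hgs, ← integral_indicator measurableSet_Ioo]
    congr 1
    ext x
    by_cases hx : x ∈ Ioo a b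
    · rw [indicator_of_mem hx, Complex.real_smul, mul_comm]
    · rw [indicator_of_notMem hx, image_eq_zero_of_notMem_tsupport (fun h => hx (hgs h)), zero_smul]
  rw [Lp.eq_zero_iff_ae_eq_zero]
  rw [← ae_restrict_iff' measurableSet_Ioo] at h1
  filter_upwards [h1, ae_restrict_mem measurableSet_Ioo] with x hx hx'
  exact (mul_eq_zero.1 hx).resolve_right (hm0 x hx')

theorem inner_toLp_eq_integral {μ : Measure ℝ} {f : ℝ → ℂ} (hf : MemLp f 2 μ) (v : Lp ℂ 2 μ) :
    (inner ℂ (hf.toLp f) v : ℂ) = ∫ x, v x * conj (f x) ∂μ := by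
  rw [inner_eq_integral]
  refine integral_congr_ae (hf.coeFn_toLp.mono fun x hx => ?_)
  simp only [hx, mul_comm]

theorem coeFn_sum_smul_toLp {μ : Measure ℝ} {ι : Type*} (s : Finset ι) (c : ι → ℂ) {f : ι → ℝ → ℂ}
    (hf : ∀ k, MemLp (f k) 2 μ) :
    (∑ k ∈ s, c k • (hf k).toLp (f k) : Lp ℂ 2 μ) =ᵐ[μ] fun x => ∑ k ∈ s, c k * f k x := by
  have : ∑ k ∈ s, c k • (hf k).toLp (f k) =
      (memLp_finsetSum s fun k _ => (hf k).const_smul (c k)).toLp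
        (fun x => ∑ k ∈ s, (c k • f k) x) := by
    classical
    induction s using Finset.induction_on with
    | empty =>
      simp only [Finset.sum_empty]; rfl
    | insert k s hk ih =>
      simp only [Finset.sum_insert hk]
      rw [ih]; rfl
  rw [this]
  exact MemLp.coeFn_toLp _

end Ioo

/-- Integration against an integrable function, as a functional on continuous functions. -/
theorem exists_integral_comp_clm {𝕜 X : Type*} [RCLike 𝕜] [NormedSpace 𝕜 ℂ] [SMulCommClass ℝ 𝕜 ℂ]
    [TopologicalSpace X] [CompactSpace X] {μ : Measure ℝ} {f : ℝ → ℂ} (hf : Integrable f μ)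
    {π : ℝ → X} (hπ : Continuous π) :
    ∃ J : C(X, 𝕜) →L[𝕜] ℂ, ∀ g, J g = ∫ x, g (π x) • f x ∂μ := by
  have h_int : ∀ g : C(X, 𝕜), Integrable (fun x => g (π x) • f x) μ := fun g =>
    hf.bdd_smul ‖g‖ (g.continuous.comp hπ).aestronglyMeasurable
      (ae_of_all _ fun x => g.norm_coe_le_norm _)
  refine ⟨LinearMap.mkContinuous
    { toFun := fun g => ∫ x, g (π x) • f x ∂μ
      map_add' := fun g g' => by
        rw [← integral_add (h_int g) (h_int g')]
        simp [add_smul]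
      map_smul' := fun c g => by
        rw [RingHom.id_apply, ← integral_smul]
        congr 1
        ext x
        simp only [ContinuousMap.coe_smul, Pi.smul_apply, smul_assoc] } (∫ x, ‖f x‖ ∂μ)
      (fun g => ?_), fun g => rfl⟩
  refine (norm_integral_le_integral_norm _).trans ?_
  rw [← integral_mul_const]
  refine integral_mono (h_int g).norm (hf.norm.mul_const _) fun x => ?_
  simp only [norm_smul]
  rw [mul_comm]
  gcongr
  exact g.norm_coe_le_norm _

/-! ### The periodic interval -/

/-- The function behind `expMode`. -/
def expFun (a b : ℝ) (k : ℤ) (x : ℝ) : ℂ :=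
  ((√(b - a))⁻¹ : ℂ) * Complex.exp (Complex.I * ((2 * Real.pi * k * (x - a) / (b - a) : ℝ) : ℂ))

/-- The frequencies of the periodic interval. -/
def expFreq (a b : ℝ) (k : ℤ) : ℝ := 2 * Real.pi * k / (b - a)

section periodic

variable {a b : ℝ}

theorem memLp_expFun (a b : ℝ) (k : ℤ) : MemLp (expFun a b k) 2 (volume.restrict (Ioo a b)) :=
  memLp_expMode a b k

theorem expMode_eq (a b : ℝ) (k : ℤ) : expMode a b k = (memLp_expFun a b k).toLp (expFun a b k) :=
  rfl

theorem hasDerivAt_expFun (a b : ℝ) (k : ℤ) (x : ℝ) :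
    HasDerivAt (expFun a b k) ((Complex.I * expFreq a b k) * expFun a b k x) x := by
  have h1 : HasDerivAt (fun x : ℝ => 2 * Real.pi * k * (x - a) / (b - a)) (expFreq a b k) x := by
    have := (((hasDerivAt_id x).sub_const a).const_mul (2 * Real.pi * k)).div_const (b - a)
    simpa [expFreq] using this
  have h2 := ((h1.ofReal_comp.const_mul Complex.I).cexp).const_mul ((√(b - a))⁻¹ : ℂ)
  convert! h2 using 1
  rw [expFun]; ring

theorem continuous_expFun (a b : ℝ) (k : ℤ) : Continuous (expFun a b k) :=
  continuous_iff_continuousAt.2 fun x => (hasDerivAt_expFun a b k x).continuousAt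

theorem periodic_expFun (hab : a < b) (k : ℤ) : Function.Periodic (expFun a b k) (b - a) := by
  intro x
  have h0 : b - a ≠ 0 := (sub_pos.2 hab).ne'
  rw [expFun, expFun]
  congr 1
  have : Complex.I * ((2 * Real.pi * k * (x + (b - a) - a) / (b - a) : ℝ) : ℂ) =
      Complex.I * ((2 * Real.pi * k * (x - a) / (b - a) : ℝ) : ℂ) + k * (2 * Real.pi * Complex.I) := by
    have : (2 * Real.pi * k * (x + (b - a) - a) / (b - a) : ℝ) =
        2 * Real.pi * k * (x - a) / (b - a) + k * (2 * Real.pi) := by field_simp; ring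
    rw [this]; push_cast; ring
  rw [this, Complex.exp_periodic.int_mul k]

theorem expFun_right (hab : a < b) (k : ℤ) : expFun a b k b = expFun a b k a := by
  have := periodic_expFun hab k a
  rwa [add_sub_cancel] at this

theorem hasDerivAt_conj_expFun (a b : ℝ) (k : ℤ) (x : ℝ) :
    HasDerivAt (fun x => conj (expFun a b k x))
      (-(Complex.I * expFreq a b k) * conj (expFun a b k x)) x := by
  have := (hasDerivAt_expFun a b k x).star
  convert! this using 1
  simp [mul_comm]

theorem contDiff_expFun (a b : ℝ) (k : ℤ) : ContDiff ℝ ∞ (expFun a b k) := by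
  have : ContDiff ℝ ∞ (fun x : ℝ => ((2 * Real.pi * k * (x - a) / (b - a) : ℝ) : ℂ)) :=
    Complex.ofRealCLM.contDiff.comp
      ((contDiff_const.mul (contDiff_id.sub contDiff_const)).div_const _)
  exact contDiff_const.mul (contDiff_const.mul this).cexp

theorem isTest_conj_expFun (hab : a < b) (k : ℤ) :
    (Domain1D.periodic a b hab).IsTest (fun x => conj (expFun a b k x)) :=
  ⟨Complex.conjCLE.contDiff.comp (contDiff_expFun a b k),
    fun x => congrArg conj (periodic_expFun hab k x)⟩

theorem inner_expMode (k : ℤ) (v : Lp ℂ 2 (volume.restrict (Ioo a b))) :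
    (inner ℂ (expMode a b k) v : ℂ) = ∫ x in Ioo a b, v x * conj (expFun a b k x) :=
  inner_toLp_eq_integral (memLp_expMode a b k) v

/-- Fourier coefficients of a derivative. -/
theorem inner_expMode_of_integral_eq {k : ℤ} {v w : Lp ℂ 2 (volume.restrict (Ioo a b))}
    (h : ∫ x in Ioo a b, v x * (-(Complex.I * expFreq a b k) * conj (expFun a b k x)) =
      - ∫ x in Ioo a b, w x * conj (expFun a b k x)) :
    (inner ℂ (expMode a b k) w : ℂ) = Complex.I * expFreq a b k * inner ℂ (expMode a b k) v := by
  rw [inner_expMode, inner_expMode, ← neg_inj, ← h, ← integral_const_mul, ← integral_neg]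
  congr 1
  ext x
  ring

theorem inner_expMode_of_hasACRep (hab : a < b) (k : ℤ)
    {v w : Lp ℂ 2 (volume.restrict (Ioo a b))} (h : (Domain1D.periodic a b hab).HasACRep v w) :
    (inner ℂ (expMode a b k) w : ℂ) = Complex.I * expFreq a b k * inner ℂ (expMode a b k) v := by
  obtain ⟨V, hV, hvV, hb⟩ := h
  refine inner_expMode_of_integral_eq ?_
  refine hV.integral_mul_deriv_Ioo hab hvV (hasDerivAt_conj_expFun a b k) ?_ ?_
  · exact continuous_const.mul (Complex.continuous_conj.comp (continuous_expFun a b k))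
  · rw [expFun_right hab, show V a = V b from hb]

theorem inner_expMode_of_isH1 (hab : a < b) (k : ℤ)
    {v w : Lp ℂ 2 (volume.restrict (Ioo a b))} (h : (Domain1D.periodic a b hab).IsH1 v w) :
    (inner ℂ (expMode a b k) w : ℂ) = Complex.I * expFreq a b k * inner ℂ (expMode a b k) v := by
  refine inner_expMode_of_integral_eq ?_
  have := h.1 _ (isTest_conj_expFun hab k)
  rwa [funext fun x => (hasDerivAt_conj_expFun a b k x).deriv] at this

theorem expFreq_injective (hab : a < b) : Function.Injective (expFreq a b) := by
  intro j k h
  have h0 : b - a ≠ 0 := (sub_pos.2 hab).ne'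
  have hpi := Real.pi_pos.ne'
  rw [expFreq, expFreq] at h
  field_simp at h
  exact_mod_cast h

theorem isH1_periodic_of_hasDerivAt (hab : a < b) {ψ ψ' : ℝ → ℂ}
    (hd : ∀ x, HasDerivAt ψ (ψ' x) x) (hc : Continuous ψ') (hper : ψ b = ψ a)
    {v w : Lp ℂ 2 (volume.restrict (Ioo a b))} (hv : v =ᵐ[volume.restrict (Ioo a b)] ψ)
    (hw : w =ᵐ[volume.restrict (Ioo a b)] ψ') : (Domain1D.periodic a b hab).IsH1 v w := by
  refine ⟨fun φ hφ => ?_, trivial⟩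
  obtain ⟨V, hV, hvV, ha, hb⟩ := exists_isPrimitive_of_hasDerivAt hab hd hc hv hw
  have hφd : ∀ x, HasDerivAt φ (deriv φ x) x := fun x =>
    (hφ.1.differentiable (by simp) x).hasDerivAt
  refine hV.integral_mul_deriv_Ioo hab hvV hφd (hφ.1.continuous_deriv (by simp)) ?_
  have hφb : φ b = φ a := by
    have := hφ.2 a
    rwa [add_sub_cancel] at this
  rw [ha, hb, hφb, hper]

/-- Finite sums of periodic modes are in `H¹`. -/
theorem isH1_sum_expMode (hab : a < b) (s : Finset ℤ) (c : ℤ → ℂ) :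
    (Domain1D.periodic a b hab).IsH1
      (∑ k ∈ s, c k • expMode a b k : Lp ℂ 2 (volume.restrict (Ioo a b)))
      (∑ k ∈ s, c k • (Complex.I * expFreq a b k : ℂ) • expMode a b k :
        Lp ℂ 2 (volume.restrict (Ioo a b))) := by
  simp only [smul_smul]
  refine isH1_periodic_of_hasDerivAt hab (fun x => ?_) ?_ ?_
    (coeFn_sum_smul_toLp s c (memLp_expFun a b)) (coeFn_sum_smul_toLp s _ (memLp_expFun a b))
  · refine HasDerivAt.fun_sum fun k _ => ?_
    have := (hasDerivAt_expFun a b k x).const_mul (c k)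
    rwa [← mul_assoc] at this
  · exact continuous_finsetSum _ fun k _ => continuous_const.mul (continuous_expFun a b k)
  · simp only [expFun_right hab]

theorem isH1_expMode (hab : a < b) (k : ℤ) :
    (Domain1D.periodic a b hab).IsH1 (expMode a b k)
      ((Complex.I * expFreq a b k : ℂ) • expMode a b k : Lp ℂ 2 (volume.restrict (Ioo a b))) := by
  refine isH1_periodic_of_hasDerivAt hab (hasDerivAt_expFun a b k)
    (continuous_const.mul (continuous_expFun a b k)) (expFun_right hab k)
    (memLp_expFun a b k).coeFn_toLp ?_
  filter_upwards [Lp.coeFn_smul (Complex.I * expFreq a b k : ℂ) (expMode a b k),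
    (memLp_expFun a b k).coeFn_toLp] with x h1 h2
  rw [h1, Pi.smul_apply, expMode_eq, h2, smul_eq_mul]

/-- Integration by parts of e_k against e_j shows that the difference of frequencies times the inner
product is zero, and the frequencies are distinct. -/
theorem orthonormal_expMode (hab : a < b) : Orthonormal ℂ (expMode a b) := by
  refine ⟨fun k => ?_, fun j k hjk => ?_⟩
  · have h0 : 0 < b - a := sub_pos.2 hab
    have h1 : ∫ x in Ioo a b, ‖expMode a b k x‖ ^ 2 = ∫ x in Ioo a b, (b - a)⁻¹ := by
      refine integral_congr_ae ?_
      filter_upwards [(memLp_expMode a b k).coeFn_toLp] with x hx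
      rw [expMode, hx, norm_mul, mul_comm Complex.I, Complex.norm_exp_ofReal_mul_I, mul_one,
        norm_inv, Complex.norm_real, inv_pow, Real.norm_of_nonneg (Real.sqrt_nonneg _),
        Real.sq_sqrt h0.le]
    have h2 : ‖expMode a b k‖ ^ 2 = 1 := by
      rw [norm_sq_eq_integral, h1, setIntegral_const, measureReal_def, Real.volume_Ioo,
        ENNReal.toReal_ofReal h0.le, smul_eq_mul, mul_inv_cancel₀ h0.ne']
    exact (pow_eq_one_iff_of_nonneg (norm_nonneg _) two_ne_zero).1 h2
  · have h := inner_expMode_of_isH1 hab j (isH1_expMode hab k)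
    rw [inner_smul_right] at h
    have h2 : (Complex.I * (expFreq a b k - expFreq a b j)) *
        (inner ℂ (expMode a b j) (expMode a b k) : ℂ) = 0 := by linear_combination h
    refine (mul_eq_zero.1 h2).resolve_left (mul_ne_zero Complex.I_ne_zero ?_)
    rw [sub_ne_zero]
    exact fun h => hjk (expFreq_injective hab (Complex.ofReal_injective h)).symm

/-- A test function supported inside the interval descends to a continuous function on the circle.
The functional `J` given by v kills the Fourier monomials, whose span is dense, so it kills every
test function. -/
theorem eq_zero_of_inner_expMode (hab : a < b) {v : Lp ℂ 2 (volume.restrict (Ioo a b))}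
    (h : ∀ k, (inner ℂ (expMode a b k) v : ℂ) = 0) : v = 0 := by
  have hL : 0 < b - a := sub_pos.2 hab
  have : Fact (0 < b - a) := ⟨hL⟩
  have hvi : Integrable v (volume.restrict (Ioo a b)) := (Lp.memLp v).integrable one_le_two
  refine Lp_eq_zero_of_integral_test (m := fun _ => 1) continuous_const (fun _ _ => one_ne_zero)
    fun g hg hgc hgs => ?_
  have hga : ∀ x, x ∉ Ioo a b → g x = 0 := fun x hx =>
    image_eq_zero_of_notMem_tsupport fun h => hx (hgs h)
  set G : AddCircle (b - a) → ℂ := AddCircle.liftIco (b - a) a (fun x => (g x : ℂ)) with hG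
  have hGc : Continuous G := by
    refine AddCircle.liftIco_continuous ?_ ?_
    · rw [hga a (by simp), hga (a + (b - a)) (by simp)]
    · exact (Complex.continuous_ofReal.comp hg.continuous).continuousOn
  obtain ⟨J, hJ⟩ := exists_integral_comp_clm (𝕜 := ℂ) hvi
    (π := fun x : ℝ => (x : AddCircle (b - a))) (AddCircle.continuous_mk' _)
  have hJ0 : ∀ k : ℤ, J (fourier k) = 0 := by
    intro k
    have hk := h (-k)
    rw [inner_expMode] at hk
    have h0 : ((√(b - a))⁻¹ : ℂ) ≠ 0 :=
      inv_ne_zero (Complex.ofReal_ne_zero.2 (Real.sqrt_pos.2 hL).ne')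
    have e : ∀ x : ℝ, v x * conj (expFun a b (-k) x) =
        (((√(b - a))⁻¹ : ℂ) * Complex.exp (-(2 * Real.pi * Complex.I * k * a / (b - a)))) *
          (fourier k (x : AddCircle (b - a)) • v x) := by
      intro x
      have : conj (expFun a b (-k) x) = ((√(b - a))⁻¹ : ℂ) *
          (Complex.exp (-(2 * Real.pi * Complex.I * k * a / (b - a))) *
            fourier k (x : AddCircle (b - a))) := by
        rw [fourier_coe_apply, ← Complex.exp_add, expFun, map_mul, map_inv₀,
          Complex.conj_ofReal, ← Complex.exp_conj, map_mul, Complex.conj_I, Complex.conj_ofReal]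
        congr 2
        push_cast
        ring
      rw [this, smul_eq_mul]
      ring
    simp_rw [e] at hk
    rw [integral_const_mul] at hk
    rw [hJ]
    exact (mul_eq_zero.1 hk).resolve_left (mul_ne_zero h0 (Complex.exp_ne_zero _))
  have hker : (Submodule.span ℂ (range (@fourier (b - a)))).topologicalClosure ≤ J.ker :=
    Submodule.topologicalClosure_minimal _ (Submodule.span_le.2 (by
      rintro _ ⟨k, rfl⟩
      exact hJ0 k)) J.isClosed_ker
  rw [span_fourier_closure_eq_top] at hker
  have key : J ⟨G, hGc⟩ = 0 := hker Submodule.mem_top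
  rw [← key, hJ]
  refine setIntegral_congr_fun measurableSet_Ioo fun x hx => ?_
  simp only [mul_one, ContinuousMap.coe_mk, hG]
  rw [AddCircle.liftIco_coe_apply ⟨hx.1.le, by linarith [hx.2]⟩, smul_eq_mul, mul_comm]

/-- The Fourier basis of `L²(a, b)`. -/
def expBasis (hab : a < b) : HilbertBasis ℤ ℂ (Lp ℂ 2 (volume.restrict (Ioo a b))) :=
  HilbertBasis.mkOfOrthogonalEqBot (orthonormal_expMode hab) (by
    rw [Submodule.eq_bot_iff]
    intro x hx
    exact eq_zero_of_inner_expMode hab fun k =>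
      Submodule.inner_right_of_mem_orthogonal (Submodule.subset_span (mem_range_self k)) hx)

theorem expBasis_apply (hab : a < b) (k : ℤ) : expBasis hab k = expMode a b k := by
  simp only [expBasis, HilbertBasis.coe_mkOfOrthogonalEqBot]

/-- Testing with the constant 1 gives ∫w = 0, so the primitive V of w is periodic. All Fourier
coefficients of v and V except the zeroth are determined by those of w, so v − V is constant. -/
theorem hasACRep_of_isH1_periodic (hab : a < b) {v w : Lp ℂ 2 (volume.restrict (Ioo a b))}
    (h : (Domain1D.periodic a b hab).IsH1 v w) : (Domain1D.periodic a b hab).HasACRep v w := by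
  have hw0 : ∫ x in a..b, w x = 0 := by
    have := h.1 (fun _ => 1) ⟨contDiff_const, fun _ => rfl⟩
    simp only [deriv_const, mul_zero, integral_zero, mul_one] at this
    rw [← setIntegral_Ioo_eq hab]
    exact neg_eq_zero.1 this.symm
  set V : ℝ → ℂ := fun x => 0 + ∫ t in a..x, (Ioo a b).indicator w t with hVdef
  have hV : IsPrimitive V ((Ioo a b).indicator w) :=
    IsPrimitive.of_integral (locallyIntegrable_indicator_Ioo w) 0 a
  have hVb : V a = V b := by
    simp only [hVdef]
    rw [integral_indicator_Ioo ⟨hab.le, le_rfl⟩, hw0, intervalIntegral.integral_same]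
  set v₀ : Lp ℂ 2 (volume.restrict (Ioo a b)) := (memLp_Ioo_of_continuous hV.continuous a b).toLp V
  have hv₀ : v₀ =ᵐ[volume.restrict (Ioo a b)] V := MemLp.coeFn_toLp _
  have hrep : (Domain1D.periodic a b hab).HasACRep v₀ w := ⟨V, hV, hv₀, hVb⟩
  set c : ℂ := inner ℂ (expMode a b 0) (v - v₀) with hc
  have hdiff : v - v₀ = c • expMode a b 0 := by
    refine HilbertBasis.ext_inner (expBasis hab) fun k => ?_
    rw [expBasis_apply, inner_smul_right, orthonormal_iff_ite.1 (orthonormal_expMode hab)]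
    split_ifs with hk
    · rw [hk, mul_one]
    · have h1 := inner_expMode_of_isH1 hab k h
      have h2 := inner_expMode_of_hasACRep hab k hrep
      rw [h1] at h2
      have h3 : (Complex.I * expFreq a b k : ℂ) ≠ 0 := by
        refine mul_ne_zero Complex.I_ne_zero (Complex.ofReal_ne_zero.2 fun h0 => hk ?_)
        refine expFreq_injective hab (h0.trans ?_)
        simp [expFreq]
      rw [inner_sub_right, mul_left_cancel₀ h3 h2, sub_self, mul_zero]
  have hconst : ∀ᵐ x ∂(volume.restrict (Ioo a b)), v x = c * ((√(b - a))⁻¹ : ℂ) + V x := by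
    have e : v = c • expMode a b 0 + v₀ := by rw [← hdiff]; abel
    rw [e]
    filter_upwards [hv₀, Lp.coeFn_add (c • expMode a b 0) v₀, Lp.coeFn_smul c (expMode a b 0),
      (memLp_expMode a b 0).coeFn_toLp] with x h1 h2 h3 h4
    rw [h2, Pi.add_apply, h3, Pi.smul_apply, expMode, h4, h1]
    simp
  refine ⟨fun x => c * ((√(b - a))⁻¹ : ℂ) + V x, ⟨hV.locallyIntegrable, fun x y => ?_⟩, hconst, ?_⟩
  · rw [add_sub_add_left_eq_sub, hV.sub_eq]; rfl
  · exact congrArg (fun z => c * ((√(b - a))⁻¹ : ℂ) + z) hVb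

theorem inner_smul_expMode_of_hasACRep (hab : a < b) (k : ℤ)
    {v w : Lp ℂ 2 (volume.restrict (Ioo a b))} (h : (Domain1D.periodic a b hab).HasACRep v w) :
    (inner ℂ ((Complex.I * expFreq a b k : ℂ) • expMode a b k) w : ℂ) =
      (((2 * Real.pi * k / (b - a)) ^ 2 : ℝ) : ℂ) * inner ℂ (expBasis hab k) v := by
  rw [expBasis_apply, inner_smul_left, inner_expMode_of_hasACRep hab k h, ← mul_assoc]
  congr 1
  rw [map_mul, Complex.conj_I, Complex.conj_ofReal]
  have : (((2 * Real.pi * k / (b - a)) ^ 2 : ℝ) : ℂ) = (expFreq a b k : ℂ) ^ 2 := by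
    rw [expFreq]; push_cast; ring
  rw [this]
  linear_combination (-(expFreq a b k : ℂ) ^ 2) * Complex.I_mul_I

theorem finite_sq_expFreq_le (hab : a < b) (N : ℕ) :
    {k : ℤ | (2 * Real.pi * k / (b - a)) ^ 2 ≤ N + 1}.Finite := by
  have h0 : 0 < b - a := sub_pos.2 hab
  obtain ⟨m, hm⟩ := exists_nat_ge ((N + 1) * ((b - a) / (2 * Real.pi)) ^ 2)
  refine (finite_Icc (-(m : ℤ)) m).subset fun k hk => ?_
  have hk : (2 * Real.pi * k / (b - a)) ^ 2 ≤ N + 1 := hk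
  have h1 : (k : ℝ) ^ 2 ≤ m := by
    refine le_trans ?_ hm
    have e : (k : ℝ) ^ 2 = (2 * Real.pi * k / (b - a)) ^ 2 * ((b - a) / (2 * Real.pi)) ^ 2 := by
      have := Real.pi_pos.ne'
      field_simp
    rw [e]
    gcongr
  have h2 : k ^ 2 ≤ (m : ℤ) := by exact_mod_cast h1
  rw [mem_Icc]
  constructor <;> nlinarith

theorem nonempty_spectralData_periodic (hab : a < b) :
    Nonempty (SpectralData (Domain1D.periodic a b hab)) := by
  have hsum : ∀ (s : Finset ℤ) (c : ℤ → ℂ), (Domain1D.periodic a b hab).IsH1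
      (∑ k ∈ s, c k • expBasis hab k : Lp ℂ 2 (volume.restrict (Ioo a b)))
      (∑ k ∈ s, c k • (Complex.I * expFreq a b k : ℂ) • expMode a b k :
        Lp ℂ 2 (volume.restrict (Ioo a b))) := fun s c => by
    simp_rw [expBasis_apply]
    exact isH1_sum_expMode hab s c
  have hflow : ∀ t (v : Lp ℂ 2 (volume.restrict (Ioo a b))), periodicFlow a b t v =
      ∑' k : ℤ, Complex.exp (Complex.I * ((-t * (2 * Real.pi * k / (b - a)) ^ 2 : ℝ) : ℂ)) •
        ((inner ℂ (expBasis hab k) v : ℂ) • expBasis hab k) := fun t v => by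
    simp_rw [expBasis_apply]
    rfl
  exact SpectralData.nonempty_of_basis (S := Domain1D.periodic a b hab) (expBasis hab)
    (fun k => (Complex.I * expFreq a b k : ℂ) • expMode a b k)
    (fun k => (2 * Real.pi * k / (b - a)) ^ 2) (fun k => by positivity) (finite_sq_expFreq_le hab)
    (fun k v w h => inner_smul_expMode_of_hasACRep hab k h)
    (fun v w => hasACRep_of_isH1_periodic hab)
    (fun v w w' h h' => (hasACRep_of_isH1_periodic hab h).unique (hasACRep_of_isH1_periodic hab h'))
    hsum hflow

end periodic

/-! ### The interval with Dirichlet boundary conditions -/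

/-! ### Approximation by test functions under Dirichlet conditions -/

section cutoff

/-- Compactness handles [0, 1]; outside it the function attains its minimum 0 or its maximum 1, so
the derivative vanishes. -/
theorem exists_abs_deriv_smoothTransition_le :
    ∃ C : ℝ, 0 ≤ C ∧ ∀ y, |deriv Real.smoothTransition y| ≤ C := by
  have hc : Continuous (deriv Real.smoothTransition) :=
    (Real.smoothTransition.contDiff (n := 1)).continuous_deriv le_rfl
  obtain ⟨C, hC⟩ := isCompact_Icc.exists_bound_of_continuousOn (s := Icc (0 : ℝ) 1) hc.continuousOn
  refine ⟨C, (norm_nonneg _).trans (hC 0 (by simp)), fun y => ?_⟩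
  have hC0 : 0 ≤ C := (norm_nonneg _).trans (hC 0 (by simp))
  by_cases hy : y ∈ Icc (0 : ℝ) 1
  · exact hC y hy
  · have : deriv Real.smoothTransition y = 0 := by
      rw [mem_Icc, not_and_or, not_le, not_le] at hy
      rcases hy with hy | hy
      · refine IsLocalMin.deriv_eq_zero (Eventually.of_forall fun z => ?_)
        rw [Real.smoothTransition.zero_of_nonpos hy.le]
        exact Real.smoothTransition.nonneg z
      · refine IsLocalMax.deriv_eq_zero (Eventually.of_forall fun z => ?_)
        rw [Real.smoothTransition.one_of_one_le hy.le]
        exact Real.smoothTransition.le_one z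
    rw [this, abs_zero]
    exact hC0

theorem deriv_smoothTransition_of_one_le {y : ℝ} (hy : 1 ≤ y) :
    deriv Real.smoothTransition y = 0 := by
  refine IsLocalMax.deriv_eq_zero (Eventually.of_forall fun z => ?_)
  rw [Real.smoothTransition.one_of_one_le hy]
  exact Real.smoothTransition.le_one z

/-- The part of `(a, b)` at distance less than `2δ` from the boundary. -/
def bdryLayer (a b δ : ℝ) : Set ℝ := Ioo a (a + 2 * δ) ∪ Ioo (b - 2 * δ) b

/-- A smooth function that vanishes at `a` and `b` can be cut off near the boundary, with a uniform
bound on the error in `C¹`. -/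
theorem exists_cutoff {a b : ℝ} (hab : a < b) {ψ : ℝ → ℂ} (hψ : ContDiff ℝ ∞ ψ) (ha : ψ a = 0)
    (hb : ψ b = 0) : ∃ C : ℝ, 0 ≤ C ∧ ∀ δ, 0 < δ → 4 * δ ≤ b - a →
      ∃ φ : ℝ → ℂ, (Domain1D.dirichlet a b hab).IsTest φ ∧ ∀ x ∈ Ioo a b,
        ‖ψ x - φ x‖ ≤ (bdryLayer a b δ).indicator (fun _ => C) x ∧
        ‖deriv ψ x - deriv φ x‖ ≤ (bdryLayer a b δ).indicator (fun _ => C) x := by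
  obtain ⟨K, hK0, hK⟩ := exists_abs_deriv_smoothTransition_le
  have hψc : Continuous (deriv ψ) := hψ.continuous_deriv (by simp)
  have hψd : Differentiable ℝ ψ := hψ.differentiable (by simp)
  obtain ⟨D, hD⟩ := isCompact_Icc.exists_bound_of_continuousOn (s := Icc a b) hψc.continuousOn
  have hD0 : 0 ≤ D := (norm_nonneg _).trans (hD a ⟨le_rfl, hab.le⟩)
  have hmv : ∀ x ∈ Icc a b, ∀ y ∈ Icc a b, ‖ψ y - ψ x‖ ≤ D * ‖y - x‖ := fun x hx y hy =>
    (convex_Icc a b).norm_image_sub_le_of_norm_deriv_le (fun z _ => hψd z) hD hx hy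
  -- In the boundary layer ψ is at most 2δD while the cut-off has derivative at most 2K/δ; the
  -- product is 4KD. The summand b − a covers the error in ψ itself, since 2δ ≤ b − a.
  refine ⟨D * (1 + 4 * K + (b - a)), by have := sub_pos.2 hab; positivity, fun δ hδ hδ' => ?_⟩
  set σ := Real.smoothTransition
  -- The cut-off vanishes within δ of an endpoint and is 1 at distance at least 2δ from both.
  set y₁ : ℝ → ℝ := fun x => (x - a) / δ - 1 with hy₁
  set y₂ : ℝ → ℝ := fun x => (b - x) / δ - 1 with hy₂
  set χ : ℝ → ℝ := fun x => σ (y₁ x) * σ (y₂ x) with hχ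
  have hσc : ContDiff ℝ ∞ σ := Real.smoothTransition.contDiff
  have hy₁c : ContDiff ℝ ∞ y₁ := ((contDiff_id.sub contDiff_const).div_const _).sub contDiff_const
  have hy₂c : ContDiff ℝ ∞ y₂ := ((contDiff_const.sub contDiff_id).div_const _).sub contDiff_const
  have hχc : ContDiff ℝ ∞ χ := (hσc.comp hy₁c).mul (hσc.comp hy₂c)
  have hχd : ∀ x, HasDerivAt χ (deriv σ (y₁ x) * (1 / δ) * σ (y₂ x) +
      σ (y₁ x) * (deriv σ (y₂ x) * (-1 / δ))) x := by
    intro x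
    have hσd : ∀ y, HasDerivAt σ (deriv σ y) y := fun y =>
      (hσc.differentiable (by simp) y).hasDerivAt
    have d1 : HasDerivAt y₁ (1 / δ) x := (((hasDerivAt_id x).sub_const a).div_const δ).sub_const 1
    have d2 : HasDerivAt y₂ (-1 / δ) x := (((hasDerivAt_id x).const_sub b).div_const δ).sub_const 1
    exact ((hσd (y₁ x)).comp x d1).mul ((hσd (y₂ x)).comp x d2)
  have hσ01 : ∀ y, |σ y| ≤ 1 := fun y => by
    rw [abs_of_nonneg (Real.smoothTransition.nonneg y)]; exact Real.smoothTransition.le_one y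
  have hχ01 : ∀ x, 0 ≤ χ x ∧ χ x ≤ 1 := fun x =>
    ⟨mul_nonneg (Real.smoothTransition.nonneg _) (Real.smoothTransition.nonneg _),
      mul_le_one₀ (Real.smoothTransition.le_one _) (Real.smoothTransition.nonneg _)
        (Real.smoothTransition.le_one _)⟩
  have hχ' : ∀ x, |deriv χ x| ≤ 2 * K / δ := by
    intro x
    rw [(hχd x).deriv]
    refine (abs_add_le _ _).trans ?_
    have e1 : |deriv σ (y₁ x) * (1 / δ) * σ (y₂ x)| ≤ K * (1 / δ) * 1 := by
      rw [abs_mul, abs_mul, abs_of_pos (a := 1 / δ) (by positivity)]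
      gcongr
      · exact hK _
      · exact hσ01 _
    have e2 : |σ (y₁ x) * (deriv σ (y₂ x) * (-1 / δ))| ≤ 1 * (K * (1 / δ)) := by
      rw [abs_mul, abs_mul, abs_div, abs_neg, abs_one, abs_of_pos hδ]
      gcongr
      · exact hσ01 _
      · exact hK _
    calc _ ≤ K * (1 / δ) * 1 + 1 * (K * (1 / δ)) := add_le_add e1 e2
      _ = _ := by ring
  have hsupp : Function.support (fun x => (χ x : ℂ) * ψ x) ⊆ Icc (a + δ) (b - δ) := by
    intro x hx
    by_contra hcon
    apply hx
    have : χ x = 0 := by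
      rw [mem_Icc, not_and_or, not_le, not_le] at hcon
      rcases hcon with h | h
      · have : σ (y₁ x) = 0 := Real.smoothTransition.zero_of_nonpos (by
          simp only [hy₁]; rw [sub_nonpos, div_le_one hδ]; linarith)
        simp only [hχ, this, zero_mul]
      · have : σ (y₂ x) = 0 := Real.smoothTransition.zero_of_nonpos (by
          simp only [hy₂]; rw [sub_nonpos, div_le_one hδ]; linarith)
        simp only [hχ, this, mul_zero]
    simp only [this, Complex.ofReal_zero, zero_mul]
  have htsupp : tsupport (fun x => (χ x : ℂ) * ψ x) ⊆ Icc (a + δ) (b - δ) :=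
    closure_minimal hsupp isClosed_Icc
  have hφd : ∀ x, deriv (fun x => (χ x : ℂ) * ψ x) x =
      ((deriv χ x : ℝ) : ℂ) * ψ x + (χ x : ℂ) * deriv ψ x := fun x =>
    (((hχd x).differentiableAt.hasDerivAt.ofReal_comp).mul (hψd x).hasDerivAt).deriv
  refine ⟨fun x => (χ x : ℂ) * ψ x, ⟨(Complex.ofRealCLM.contDiff.comp hχc).mul hψ,
    isCompact_Icc.of_isClosed_subset (isClosed_tsupport _) htsupp,
    htsupp.trans fun x hx => ⟨by linarith [hx.1], by linarith [hx.2]⟩⟩, fun x hx => ?_⟩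
  rw [hφd]
  by_cases hxE : x ∈ bdryLayer a b δ
  · rw [indicator_of_mem hxE]
    have hψx : ‖ψ x‖ ≤ D * (2 * δ) := by
      rcases hxE with h | h
      · have := hmv a ⟨le_rfl, hab.le⟩ x (Ioo_subset_Icc_self hx)
        rw [ha, sub_zero, Real.norm_of_nonneg (by linarith [hx.1])] at this
        exact this.trans (by gcongr; linarith [h.2])
      · have := hmv b ⟨hab.le, le_rfl⟩ x (Ioo_subset_Icc_self hx)
        rw [hb, sub_zero, Real.norm_of_nonpos (by linarith [hx.2])] at this
        exact this.trans (by gcongr; linarith [h.1])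
    have hone : ‖(1 - χ x : ℂ)‖ ≤ 1 := by
      rw [← Complex.ofReal_one, ← Complex.ofReal_sub, Complex.norm_real, Real.norm_eq_abs, abs_le]
      constructor <;> linarith [(hχ01 x).1, (hχ01 x).2]
    constructor
    · have e : ψ x - χ x * ψ x = (1 - χ x) * ψ x := by ring
      rw [e, norm_mul]
      calc _ ≤ 1 * (D * (2 * δ)) := by gcongr
        _ ≤ D * (b - a) := by rw [one_mul]; gcongr; linarith
        _ ≤ _ := by gcongr; linarith
    · have e : deriv ψ x - (((deriv χ x : ℝ) : ℂ) * ψ x + χ x * deriv ψ x) =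
          (1 - χ x) * deriv ψ x - ((deriv χ x : ℝ) : ℂ) * ψ x := by ring
      rw [e]
      refine (norm_sub_le _ _).trans ?_
      rw [norm_mul, norm_mul, Complex.norm_real, Real.norm_eq_abs]
      calc _ ≤ 1 * D + 2 * K / δ * (D * (2 * δ)) := by
            gcongr
            · exact hD x (Ioo_subset_Icc_self hx)
            · exact hχ' x
        _ = D * (1 + 4 * K) := by field_simp; ring
        _ ≤ _ := mul_le_mul_of_nonneg_left (by linarith) hD0
  · rw [indicator_of_notMem hxE]
    have h1 : a + 2 * δ ≤ x := by
      by_contra h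
      exact hxE (Or.inl ⟨hx.1, not_le.1 h⟩)
    have h2 : x ≤ b - 2 * δ := by
      by_contra h
      exact hxE (Or.inr ⟨not_le.1 h, hx.2⟩)
    have h1' : 1 ≤ y₁ x := by
      simp only [hy₁]; rw [le_sub_iff_add_le, le_div_iff₀ hδ]; linarith
    have h2' : 1 ≤ y₂ x := by
      simp only [hy₂]; rw [le_sub_iff_add_le, le_div_iff₀ hδ]; linarith
    have hχ1 : χ x = 1 := by
      simp only [hχ, σ]
      rw [Real.smoothTransition.one_of_one_le h1', Real.smoothTransition.one_of_one_le h2', one_mul]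
    have hχ'0 : deriv χ x = 0 := by
      rw [(hχd x).deriv, deriv_smoothTransition_of_one_le h1', deriv_smoothTransition_of_one_le h2']
      ring
    simp only [hχ1, hχ'0]
    simp

/-- The C¹ error of the cut-off stays bounded while the layer that carries it has measure at most
4δ, so the L² error is of order √δ. -/
theorem isLimitOfTests_of_contDiff {a b : ℝ} (hab : a < b) {ψ : ℝ → ℂ} (hψ : ContDiff ℝ ∞ ψ)
    (ha : ψ a = 0) (hb : ψ b = 0) {v w : Lp ℂ 2 (volume.restrict (Ioo a b))}
    (hv : v =ᵐ[volume.restrict (Ioo a b)] ψ) (hw : w =ᵐ[volume.restrict (Ioo a b)] deriv ψ) :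
    (Domain1D.dirichlet a b hab).IsLimitOfTests v w := by
  intro η hη
  obtain ⟨C, hC0, hC⟩ := exists_cutoff hab hψ ha hb
  -- The first entry keeps the layers inside the interval, the second gives C√(4δ) ≤ η; C + 1 avoids
  -- division by zero.
  set δ := min ((b - a) / 4) ((η / (C + 1)) ^ 2 / 4) with hδ
  have hδ0 : 0 < δ := lt_min (by linarith) (by positivity)
  obtain ⟨φ, hφ, hφC⟩ := hC δ hδ0 (by linarith [min_le_left ((b - a) / 4) ((η / (C + 1)) ^ 2 / 4)])
  have hm : MeasurableSet (bdryLayer a b δ) := measurableSet_Ioo.union measurableSet_Ioo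
  have hvol : (volume.restrict (Ioo a b)) (bdryLayer a b δ) ≤ ENNReal.ofReal (4 * δ) := by
    refine (Measure.restrict_apply_le _ _).trans ((measure_union_le _ _).trans ?_)
    rw [Real.volume_Ioo, Real.volume_Ioo, ← ENNReal.ofReal_add (by linarith) (by linarith)]
    exact ENNReal.ofReal_le_ofReal (by linarith)
  have key : ∀ f : ℝ → ℂ, (∀ᵐ x ∂volume.restrict (Ioo a b),
      ‖f x‖ ≤ (bdryLayer a b δ).indicator (fun _ => C) x) →
      eLpNorm f 2 (volume.restrict (Ioo a b)) ≤ ENNReal.ofReal η := by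
    intro f hf
    have h1 : eLpNorm f 2 (volume.restrict (Ioo a b)) ≤
        eLpNorm ((bdryLayer a b δ).indicator (fun _ => C)) 2 (volume.restrict (Ioo a b)) :=
      eLpNorm_mono_ae_real hf
    refine h1.trans ((eLpNorm_indicator_const_le C 2).trans ?_)
    rw [Real.enorm_eq_ofReal hC0]
    calc _ ≤ ENNReal.ofReal C * ENNReal.ofReal (4 * δ) ^ (1 / (2 : ENNReal).toReal) := by gcongr
      _ = ENNReal.ofReal (C * √(4 * δ)) := by
          rw [ENNReal.ofReal_rpow_of_nonneg (by positivity) (by positivity),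
            ← ENNReal.ofReal_mul hC0, Real.sqrt_eq_rpow]
          simp
      _ ≤ ENNReal.ofReal η := by
          refine ENNReal.ofReal_le_ofReal ?_
          have h2 : √(4 * δ) ≤ η / (C + 1) := by
            rw [Real.sqrt_le_left (by positivity)]
            linarith [min_le_right ((b - a) / 4) ((η / (C + 1)) ^ 2 / 4)]
          calc C * √(4 * δ) ≤ (C + 1) * (η / (C + 1)) := by gcongr; linarith
            _ = η := by field_simp
  refine ⟨φ, hφ, key _ ?_, key _ ?_⟩
  · filter_upwards [hv, ae_restrict_mem measurableSet_Ioo] with x h1 h2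
    have h3 := (hφC x h2).1
    rw [← h1] at h3
    exact h3
  · filter_upwards [hw, ae_restrict_mem measurableSet_Ioo] with x h1 h2
    have h3 := (hφC x h2).2
    rw [← h1] at h3
    exact h3

end cutoff

/-- The function behind `sineMode`. -/
def sinFun (a b : ℝ) (k : ℕ) (x : ℝ) : ℂ :=
  ((√(2 / (b - a)) * Real.sin ((k + 1) * Real.pi * (x - a) / (b - a)) : ℝ) : ℂ)

/-- The cosine that belongs to `sinFun`. -/
def cosFun (a b : ℝ) (k : ℕ) (x : ℝ) : ℂ :=
  ((√(2 / (b - a)) * Real.cos ((k + 1) * Real.pi * (x - a) / (b - a)) : ℝ) : ℂ)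

/-- The frequencies of the Dirichlet interval. -/
def sinFreq (a b : ℝ) (k : ℕ) : ℝ := (k + 1) * Real.pi / (b - a)

/-! ### The sine basis -/

section dirichlet

variable {a b : ℝ}

theorem hasDerivAt_sinFun_arg (a b : ℝ) (k : ℕ) (x : ℝ) :
    HasDerivAt (fun x : ℝ => (k + 1) * Real.pi * (x - a) / (b - a)) (sinFreq a b k) x := by
  have := (((hasDerivAt_id x).sub_const a).const_mul ((k + 1) * Real.pi)).div_const (b - a)
  simpa [sinFreq] using this

theorem hasDerivAt_sinFun (a b : ℝ) (k : ℕ) (x : ℝ) :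
    HasDerivAt (sinFun a b k) (sinFreq a b k * cosFun a b k x) x := by
  have h := ((hasDerivAt_sinFun_arg a b k x).sin.const_mul √(2 / (b - a))).ofReal_comp
  convert! h using 1
  rw [cosFun]; push_cast; ring

theorem hasDerivAt_freq_mul_cosFun (a b : ℝ) (k : ℕ) (x : ℝ) :
    HasDerivAt (fun x => sinFreq a b k * cosFun a b k x)
      (-(sinFreq a b k : ℂ) ^ 2 * sinFun a b k x) x := by
  have h := ((hasDerivAt_sinFun_arg a b k x).cos.const_mul √(2 / (b - a))).ofReal_comp.const_mul
    (sinFreq a b k : ℂ)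
  convert! h using 1
  rw [sinFun]; push_cast; ring

theorem contDiff_sinFun (a b : ℝ) (k : ℕ) : ContDiff ℝ ∞ (sinFun a b k) :=
  Complex.ofRealCLM.contDiff.comp (contDiff_const.mul (Real.contDiff_sin.comp
    ((contDiff_const.mul (contDiff_id.sub contDiff_const)).div_const _)))

theorem continuous_sinFun (a b : ℝ) (k : ℕ) : Continuous (sinFun a b k) :=
  (contDiff_sinFun a b k).continuous

theorem continuous_freq_mul_cosFun (a b : ℝ) (k : ℕ) :
    Continuous (fun x => sinFreq a b k * cosFun a b k x) :=
  continuous_iff_continuousAt.2 fun x => (hasDerivAt_freq_mul_cosFun a b k x).continuousAt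

theorem memLp_sinFun (a b : ℝ) (k : ℕ) : MemLp (sinFun a b k) 2 (volume.restrict (Ioo a b)) :=
  memLp_sine a b k

theorem memLp_freq_mul_cosFun (a b : ℝ) (k : ℕ) :
    MemLp (fun x => sinFreq a b k * cosFun a b k x) 2 (volume.restrict (Ioo a b)) :=
  memLp_Ioo_of_continuous (continuous_freq_mul_cosFun a b k) a b

theorem sineMode_eq (a b : ℝ) (k : ℕ) :
    sineMode a b k = (memLp_sinFun a b k).toLp (sinFun a b k) := rfl

/-- The derivative of `sineMode`. -/
def sineModeDeriv (a b : ℝ) (k : ℕ) : Lp ℂ 2 (volume.restrict (Ioo a b)) :=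
  (memLp_freq_mul_cosFun a b k).toLp _

theorem sinFun_left (a b : ℝ) (k : ℕ) : sinFun a b k a = 0 := by simp [sinFun]

theorem sinFun_right (hab : a < b) (k : ℕ) : sinFun a b k b = 0 := by
  have h0 : b - a ≠ 0 := (sub_pos.2 hab).ne'
  have h := Real.sin_nat_mul_pi (k + 1)
  push_cast at h
  rw [sinFun, mul_div_assoc, div_self h0, mul_one, h]
  simp

theorem inner_sineMode (k : ℕ) (v : Lp ℂ 2 (volume.restrict (Ioo a b))) :
    (inner ℂ (sineMode a b k) v : ℂ) = ∫ x in Ioo a b, v x * sinFun a b k x := by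
  rw [sineMode_eq, inner_toLp_eq_integral]
  simp only [sinFun, Complex.conj_ofReal]

theorem inner_sineModeDeriv (k : ℕ) (v : Lp ℂ 2 (volume.restrict (Ioo a b))) :
    (inner ℂ (sineModeDeriv a b k) v : ℂ) =
      ∫ x in Ioo a b, v x * (sinFreq a b k * cosFun a b k x) := by
  rw [sineModeDeriv, inner_toLp_eq_integral]
  simp only [cosFun, map_mul, Complex.conj_ofReal]

/-- Integration by parts, without boundary terms. -/
theorem integral_mul_deriv_of_hasACRep (hab : a < b) {v w : Lp ℂ 2 (volume.restrict (Ioo a b))}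
    (h : (Domain1D.dirichlet a b hab).HasACRep v w) {φ φ' : ℝ → ℂ}
    (hd : ∀ x, HasDerivAt φ (φ' x) x) (hc : Continuous φ') :
    ∫ x in Ioo a b, v x * φ' x = - ∫ x in Ioo a b, w x * φ x := by
  obtain ⟨V, hV, hvV, h1, h2⟩ := h
  exact hV.integral_mul_deriv_Ioo hab hvV hd hc (by rw [h1, h2, zero_mul, zero_mul])

theorem hasACRep_dirichlet_of_hasDerivAt (hab : a < b) {ψ ψ' : ℝ → ℂ}
    (hd : ∀ x, HasDerivAt ψ (ψ' x) x) (hc : Continuous ψ') (ha : ψ a = 0) (hb : ψ b = 0)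
    {v w : Lp ℂ 2 (volume.restrict (Ioo a b))} (hv : v =ᵐ[volume.restrict (Ioo a b)] ψ)
    (hw : w =ᵐ[volume.restrict (Ioo a b)] ψ') : (Domain1D.dirichlet a b hab).HasACRep v w := by
  obtain ⟨V, hV, hvV, h1, h2⟩ := exists_isPrimitive_of_hasDerivAt hab hd hc hv hw
  exact ⟨V, hV, hvV, h1.trans ha, h2.trans hb⟩

theorem norm_sub_toLp_le {μ : Measure ℝ} {v : Lp ℂ 2 μ} {f : ℝ → ℂ} (hf : MemLp f 2 μ) {δ : ℝ}
    (hδ : 0 ≤ δ) (h : eLpNorm (fun x => v x - f x) 2 μ ≤ ENNReal.ofReal δ) :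
    ‖v - hf.toLp f‖ ≤ δ := by
  have e : v - hf.toLp f = ((Lp.memLp v).sub hf).toLp (⇑v - f) := by
    rw [MemLp.toLp_sub (Lp.memLp v) hf, Lp.toLp_coeFn]
  rw [e, Lp.norm_toLp]
  exact ENNReal.toReal_le_of_le_ofReal hδ h

/-- Integration by parts for limits of test functions. -/
theorem integral_mul_deriv_of_isLimitOfTests (hab : a < b)
    {v w : Lp ℂ 2 (volume.restrict (Ioo a b))}
    (h : (Domain1D.dirichlet a b hab).IsLimitOfTests v w) {φ φ' : ℝ → ℂ}
    (hd : ∀ x, HasDerivAt φ (φ' x) x) (hc : Continuous φ') :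
    ∫ x in Ioo a b, v x * φ' x = - ∫ x in Ioo a b, w x * φ x := by
  have hφc : Continuous φ := continuous_iff_continuousAt.2 fun x => (hd x).continuousAt
  have hA := memLp_Ioo_of_continuous (Complex.continuous_conj.comp hc) a b
  have hB := memLp_Ioo_of_continuous (Complex.continuous_conj.comp hφc) a b
  set A := hA.toLp _ with hAdef
  set B := hB.toLp _ with hBdef
  -- Both sides are continuous functionals on L², so the identity passes from test functions to the
  -- limit. The function φ need not vanish at the boundary.
  have eA : ∀ f : Lp ℂ 2 (volume.restrict (Ioo a b)),
      ∫ x in Ioo a b, f x * φ' x = inner ℂ A f := fun f => by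
    rw [hAdef, inner_toLp_eq_integral]; simp
  have eB : ∀ f : Lp ℂ 2 (volume.restrict (Ioo a b)),
      ∫ x in Ioo a b, f x * φ x = inner ℂ B f := fun f => by
    rw [hBdef, inner_toLp_eq_integral]; simp
  rw [eA, eB, eq_neg_iff_add_eq_zero, ← norm_eq_zero]
  refine le_antisymm (le_of_forall_pos_le_add fun η hη => ?_) (norm_nonneg _)
  obtain ⟨ψ, hψ, h1, h2⟩ := h (η / (‖A‖ + ‖B‖ + 1)) (by positivity)
  have hψd : ∀ x, HasDerivAt ψ (deriv ψ x) x := fun x =>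
    (hψ.1.differentiable (by simp) x).hasDerivAt
  have hψc : Continuous (deriv ψ) := hψ.1.continuous_deriv (by simp)
  have hf := memLp_Ioo_of_continuous hψ.1.continuous a b
  have hg := memLp_Ioo_of_continuous hψc a b
  have hψ0 : ∀ x, x ∉ Ioo a b → ψ x = 0 := fun x hx =>
    image_eq_zero_of_notMem_tsupport fun h => hx (hψ.2.2 h)
  have h3 := integral_mul_deriv_of_hasACRep hab (hasACRep_dirichlet_of_hasDerivAt hab hψd hψc
    (hψ0 a (by simp)) (hψ0 b (by simp)) hf.coeFn_toLp hg.coeFn_toLp) hd hc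
  rw [eA, eB, eq_neg_iff_add_eq_zero] at h3
  have h4 := norm_sub_toLp_le hf (by positivity) h1
  have h5 := norm_sub_toLp_le hg (by positivity) h2
  have e : (inner ℂ A v + inner ℂ B w : ℂ) =
      inner ℂ A (v - hf.toLp ψ) + inner ℂ B (w - hg.toLp (deriv ψ)) := by
    rw [inner_sub_right, inner_sub_right]
    linear_combination h3
  rw [e, zero_add]
  calc _ ≤ ‖A‖ * ‖v - hf.toLp ψ‖ + ‖B‖ * ‖w - hg.toLp (deriv ψ)‖ :=
        (norm_add_le _ _).trans (add_le_add (norm_inner_le_norm _ _) (norm_inner_le_norm _ _))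
    _ ≤ ‖A‖ * (η / (‖A‖ + ‖B‖ + 1)) + ‖B‖ * (η / (‖A‖ + ‖B‖ + 1)) := by gcongr
    _ ≤ (‖A‖ + ‖B‖ + 1) * (η / (‖A‖ + ‖B‖ + 1)) := by
        rw [← add_mul]; exact mul_le_mul_of_nonneg_right (by linarith) (by positivity)
    _ = η := by field_simp

theorem inner_sineModeDeriv_of_integral_eq {k : ℕ} {v w : Lp ℂ 2 (volume.restrict (Ioo a b))}
    (h : ∫ x in Ioo a b, v x * (-(sinFreq a b k : ℂ) ^ 2 * sinFun a b k x) =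
      - ∫ x in Ioo a b, w x * (sinFreq a b k * cosFun a b k x)) :
    (inner ℂ (sineModeDeriv a b k) w : ℂ) =
      ((sinFreq a b k ^ 2 : ℝ) : ℂ) * inner ℂ (sineMode a b k) v := by
  rw [inner_sineModeDeriv, inner_sineMode, ← neg_inj, ← h, ← integral_const_mul, ← integral_neg]
  congr 1
  ext x
  push_cast
  ring

theorem inner_sineModeDeriv_of_hasACRep (hab : a < b) (k : ℕ)
    {v w : Lp ℂ 2 (volume.restrict (Ioo a b))} (h : (Domain1D.dirichlet a b hab).HasACRep v w) :
    (inner ℂ (sineModeDeriv a b k) w : ℂ) =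
      ((sinFreq a b k ^ 2 : ℝ) : ℂ) * inner ℂ (sineMode a b k) v :=
  inner_sineModeDeriv_of_integral_eq (integral_mul_deriv_of_hasACRep hab h
    (hasDerivAt_freq_mul_cosFun a b k) (continuous_const.mul (continuous_sinFun a b k)))

theorem inner_sineModeDeriv_of_isLimitOfTests (hab : a < b) (k : ℕ)
    {v w : Lp ℂ 2 (volume.restrict (Ioo a b))}
    (h : (Domain1D.dirichlet a b hab).IsLimitOfTests v w) :
    (inner ℂ (sineModeDeriv a b k) w : ℂ) =
      ((sinFreq a b k ^ 2 : ℝ) : ℂ) * inner ℂ (sineMode a b k) v :=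
  inner_sineModeDeriv_of_integral_eq (integral_mul_deriv_of_isLimitOfTests hab h
    (hasDerivAt_freq_mul_cosFun a b k) (continuous_const.mul (continuous_sinFun a b k)))

theorem sinFreq_pos (hab : a < b) (k : ℕ) : 0 < sinFreq a b k := by
  have h0 : 0 < b - a := sub_pos.2 hab
  have := Real.pi_pos
  rw [sinFreq]; positivity

theorem sinFreq_sq_injective (hab : a < b) : Function.Injective (fun k => sinFreq a b k ^ 2) := by
  intro j k h
  have h0 : b - a ≠ 0 := (sub_pos.2 hab).ne'
  have hpi := Real.pi_pos.ne'
  have h1 := (sq_eq_sq₀ (sinFreq_pos hab j).le (sinFreq_pos hab k).le).1 h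
  rw [sinFreq, sinFreq] at h1
  field_simp at h1
  have h2 : (j : ℝ) = k := by linarith
  exact_mod_cast h2

theorem isH1_dirichlet_of_contDiff (hab : a < b) {ψ : ℝ → ℂ} (hψ : ContDiff ℝ ∞ ψ)
    (ha : ψ a = 0) (hb : ψ b = 0) {v w : Lp ℂ 2 (volume.restrict (Ioo a b))}
    (hv : v =ᵐ[volume.restrict (Ioo a b)] ψ) (hw : w =ᵐ[volume.restrict (Ioo a b)] deriv ψ) :
    (Domain1D.dirichlet a b hab).IsH1 v w := by
  have hψd : ∀ x, HasDerivAt ψ (deriv ψ x) x := fun x =>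
    (hψ.differentiable (by simp) x).hasDerivAt
  refine ⟨fun φ hφ => ?_, isLimitOfTests_of_contDiff hab hψ ha hb hv hw⟩
  exact integral_mul_deriv_of_hasACRep hab (hasACRep_dirichlet_of_hasDerivAt hab hψd
    (hψ.continuous_deriv (by simp)) ha hb hv hw)
    (fun x => (hφ.1.differentiable (by simp) x).hasDerivAt) (hφ.1.continuous_deriv (by simp))

theorem isH1_sum_sineMode (hab : a < b) (s : Finset ℕ) (c : ℕ → ℂ) :
    (Domain1D.dirichlet a b hab).IsH1
      (∑ k ∈ s, c k • sineMode a b k : Lp ℂ 2 (volume.restrict (Ioo a b)))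
      (∑ k ∈ s, c k • sineModeDeriv a b k : Lp ℂ 2 (volume.restrict (Ioo a b))) := by
  have hd : ∀ x, HasDerivAt (fun x => ∑ k ∈ s, c k * sinFun a b k x)
      (∑ k ∈ s, c k * (sinFreq a b k * cosFun a b k x)) x := fun x =>
    HasDerivAt.fun_sum fun k _ => (hasDerivAt_sinFun a b k x).const_mul (c k)
  refine isH1_dirichlet_of_contDiff hab
    (ContDiff.sum fun k _ => contDiff_const.mul (contDiff_sinFun a b k)) ?_ ?_
    (coeFn_sum_smul_toLp s c (memLp_sinFun a b)) ?_
  · simp [sinFun_left]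
  · simp [sinFun_right hab]
  · rw [funext fun x => (hd x).deriv]
    exact coeFn_sum_smul_toLp s c (memLp_freq_mul_cosFun a b)

theorem hasACRep_sineMode (hab : a < b) (k : ℕ) :
    (Domain1D.dirichlet a b hab).HasACRep (sineMode a b k) (sineModeDeriv a b k) :=
  hasACRep_dirichlet_of_hasDerivAt hab (hasDerivAt_sinFun a b k)
    (continuous_freq_mul_cosFun a b k) (sinFun_left a b k) (sinFun_right hab k)
    (memLp_sinFun a b k).coeFn_toLp (memLp_freq_mul_cosFun a b k).coeFn_toLp

/-- Integration by parts gives ‖e'‖² = λ‖e‖², while sin² + cos² = 1 evaluates the sum of the two as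
2λ. No integral of sin² is computed. -/
theorem norm_sineMode (hab : a < b) (k : ℕ) : ‖sineMode a b k‖ = 1 := by
  have h0 : 0 < b - a := sub_pos.2 hab
  have hf := sinFreq_pos hab k
  have h1 := inner_sineModeDeriv_of_hasACRep hab k (hasACRep_sineMode hab k)
  rw [inner_self_eq_norm_sq_to_K, inner_self_eq_norm_sq_to_K] at h1
  have h1' : ‖sineModeDeriv a b k‖ ^ 2 = sinFreq a b k ^ 2 * ‖sineMode a b k‖ ^ 2 := by
    exact Complex.ofReal_injective (by push_cast at h1 ⊢; exact h1)
  have h2 : ‖sineModeDeriv a b k‖ ^ 2 + sinFreq a b k ^ 2 * ‖sineMode a b k‖ ^ 2 =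
      ∫ x in Ioo a b, sinFreq a b k ^ 2 * (2 / (b - a)) := by
    rw [norm_sq_eq_integral, norm_sq_eq_integral, ← integral_const_mul,
      ← integral_add (integrable_norm_sq _) ((integrable_norm_sq _).const_mul _)]
    refine integral_congr_ae ?_
    filter_upwards [(memLp_sinFun a b k).coeFn_toLp,
      (memLp_freq_mul_cosFun a b k).coeFn_toLp] with x hx hx'
    rw [sineMode_eq, hx, sineModeDeriv, hx', norm_mul, sinFun, cosFun, Complex.norm_real,
      Complex.norm_real, Complex.norm_real, mul_pow, Real.norm_eq_abs, Real.norm_eq_abs,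
      Real.norm_eq_abs, sq_abs, sq_abs, sq_abs, mul_pow, mul_pow, Real.sq_sqrt (by positivity)]
    linear_combination (sinFreq a b k ^ 2 * (2 / (b - a))) *
      Real.sin_sq_add_cos_sq ((k + 1) * Real.pi * (x - a) / (b - a))
  rw [setIntegral_const, measureReal_def, Real.volume_Ioo, ENNReal.toReal_ofReal h0.le, smul_eq_mul,
    h1'] at h2
  have h3 : ‖sineMode a b k‖ ^ 2 = 1 := by
    have h4 : sinFreq a b k ^ 2 ≠ 0 := by positivity
    refine mul_left_cancel₀ h4 ?_
    field_simp at h2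
    rw [show ‖sineMode a b k‖ ^ 2 = 1 by linarith]
  exact (pow_eq_one_iff_of_nonneg (norm_nonneg _) two_ne_zero).1 h3

/-- Evaluating ⟨e_j', e_k'⟩ by parts in two ways gives (λ_j − λ_k)⟨e_j, e_k⟩ = 0. -/
theorem orthonormal_sineMode (hab : a < b) : Orthonormal ℂ (sineMode a b) := by
  refine ⟨norm_sineMode hab, fun j k hjk => ?_⟩
  have h1 := inner_sineModeDeriv_of_hasACRep hab j (hasACRep_sineMode hab k)
  have h2 := congrArg conj (inner_sineModeDeriv_of_hasACRep hab k (hasACRep_sineMode hab j))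
  rw [map_mul, Complex.conj_ofReal, inner_conj_symm, inner_conj_symm, h1] at h2
  have h3 : ((sinFreq a b j ^ 2 : ℝ) - (sinFreq a b k ^ 2 : ℝ) : ℂ) *
      (inner ℂ (sineMode a b j) (sineMode a b k) : ℂ) = 0 := by linear_combination h2
  refine (mul_eq_zero.1 h3).resolve_left ?_
  rw [sub_eq_zero]
  exact fun h => hjk (sinFreq_sq_injective hab (Complex.ofReal_injective h))

/-- The angle that parametrizes the interval by `[0, π]`. -/
def angle (a b x : ℝ) : ℝ := Real.pi * (x - a) / (b - a)

theorem continuous_angle (a b : ℝ) : Continuous (angle a b) := by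
  unfold angle; fun_prop

/-- Each factor cos θ is traded for neighbouring frequencies by 2 cos θ sin((k+1)θ) = sin((k+2)θ) +
sin(kθ). -/
theorem integral_mul_cos_pow_mul_sin {v : Lp ℂ 2 (volume.restrict (Ioo a b))} (hab : a < b)
    (h : ∀ k, (inner ℂ (sineMode a b k) v : ℂ) = 0) (m k : ℕ) :
    ∫ x in Ioo a b, v x *
      ((Real.cos (angle a b x) ^ m * Real.sin (k * angle a b x) : ℝ) : ℂ) = 0 := by
  have hc := continuous_angle a b
  have h_int : ∀ m k : ℕ, Integrable (fun x => v x *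
      ((Real.cos (angle a b x) ^ m * Real.sin (k * angle a b x) : ℝ) : ℂ))
      (volume.restrict (Ioo a b)) := fun m k =>
    (Lp.memLp v).integrable_mul (memLp_Ioo_of_continuous (by fun_prop) a b)
  induction m generalizing k with
  | zero =>
    cases k with
    | zero => simp
    | succ k =>
      have hk := h k
      rw [inner_sineMode] at hk
      have h0 : (√(2 / (b - a)) : ℂ) ≠ 0 := Complex.ofReal_ne_zero.2
        (Real.sqrt_pos.2 (div_pos two_pos (sub_pos.2 hab))).ne'
      refine (mul_eq_zero.1 (?_ : (√(2 / (b - a)) : ℂ) * _ = 0)).resolve_left h0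
      rw [← integral_const_mul, ← hk]
      congr 1
      ext x
      have e : ((k + 1 : ℕ) : ℝ) * angle a b x = (k + 1) * Real.pi * (x - a) / (b - a) := by
        rw [angle]; push_cast; ring
      rw [e, sinFun, pow_zero, one_mul, Complex.ofReal_mul]
      ring
  | succ m ih =>
    cases k with
    | zero => simp
    | succ k =>
      have e : ∀ x, v x * ((Real.cos (angle a b x) ^ (m + 1) *
          Real.sin ((k + 1 : ℕ) * angle a b x) : ℝ) : ℂ) =
          (1 / 2 : ℂ) * (v x * ((Real.cos (angle a b x) ^ m *
            Real.sin ((k + 2 : ℕ) * angle a b x) : ℝ) : ℂ) +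
          v x * ((Real.cos (angle a b x) ^ m * Real.sin (k * angle a b x) : ℝ) : ℂ)) := by
        intro x
        have e1 : Real.cos (angle a b x) * Real.sin ((k + 1 : ℕ) * angle a b x) =
            1 / 2 * (Real.sin ((k + 2 : ℕ) * angle a b x) + Real.sin (k * angle a b x)) := by
          have a1 : ((k + 2 : ℕ) : ℝ) * angle a b x =
            (k + 1 : ℕ) * angle a b x + angle a b x := by push_cast; ring
          have a2 : (k : ℝ) * angle a b x =
            (k + 1 : ℕ) * angle a b x - angle a b x := by push_cast; ring
          rw [a1, a2, Real.sin_add, Real.sin_sub]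
          ring
        rw [pow_succ, mul_assoc, e1]
        push_cast
        ring
      simp_rw [e]
      rw [integral_const_mul, integral_add (h_int _ _) (h_int _ _), ih, ih]
      simp

/-- In the variable c = cos θ orthogonality to all sines becomes orthogonality of v sin θ to all
polynomials in c. Weierstrass extends this to continuous functions of c, in particular to test
functions; sin θ has no zero inside the interval. -/
theorem eq_zero_of_inner_sineMode (hab : a < b) {v : Lp ℂ 2 (volume.restrict (Ioo a b))}
    (h : ∀ k, (inner ℂ (sineMode a b k) v : ℂ) = 0) : v = 0 := by
  have hL : 0 < b - a := sub_pos.2 hab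
  have hpi := Real.pi_pos
  have hc := continuous_angle a b
  have hang : ∀ x ∈ Ioo a b, angle a b x ∈ Ioo 0 Real.pi := by
    intro x hx
    have h1 : 0 < x - a := sub_pos.2 hx.1
    refine ⟨by rw [angle]; positivity, ?_⟩
    rw [angle, div_lt_iff₀ hL]
    exact mul_lt_mul_of_pos_left (by linarith [hx.2]) hpi
  have hsc : Continuous fun x => (Real.sin (angle a b x) : ℂ) := by fun_prop
  have hvi : Integrable (fun x => v x * (Real.sin (angle a b x) : ℂ))
      (volume.restrict (Ioo a b)) :=
    (Lp.memLp v).integrable_mul (memLp_Ioo_of_continuous hsc a b)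
  refine Lp_eq_zero_of_integral_test hsc
    (fun x hx => Complex.ofReal_ne_zero.2 (Real.sin_pos_of_mem_Ioo (hang x hx)).ne')
    fun g hg hgc hgs => ?_
  obtain ⟨J, hJ⟩ := exists_integral_comp_clm (𝕜 := ℝ) hvi
    (π := fun x : ℝ => (⟨Real.cos (angle a b x), Real.cos_mem_Icc _⟩ : Icc (-1 : ℝ) 1))
    (by fun_prop)
  have hJ0 : ∀ p : Polynomial ℝ, J (p.toContinuousMapOn (Icc (-1 : ℝ) 1)) = 0 := by
    intro p
    induction p using Polynomial.induction_on' with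
    | add p q hp hq =>
      have : (p + q).toContinuousMapOn (Icc (-1 : ℝ) 1) =
          p.toContinuousMapOn _ + q.toContinuousMapOn _ := by ext; simp
      rw [this, map_add, hp, hq, add_zero]
    | monomial m r =>
      rw [hJ]
      have := integral_mul_cos_pow_mul_sin hab h m 1
      rw [← mul_zero (r : ℂ), ← this, ← integral_const_mul]
      congr 1
      ext x
      simp only [Polynomial.toContinuousMapOn_apply, Polynomial.toContinuousMap_apply,
        Polynomial.eval_monomial, Complex.real_smul, Nat.cast_one, one_mul]
      push_cast
      ring
  have hker : (polynomialFunctions (Icc (-1 : ℝ) 1)).toSubmodule.topologicalClosure ≤ J.ker := by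
    refine Submodule.topologicalClosure_minimal _ ?_ J.isClosed_ker
    rintro f hf
    rw [Subalgebra.mem_toSubmodule, ← SetLike.mem_coe, polynomialFunctions_coe] at hf
    obtain ⟨p, rfl⟩ := hf
    exact hJ0 p
  have htop := polynomialFunctions_closure_eq_top (-1) 1
  set G : C(Icc (-1 : ℝ) 1, ℝ) :=
    ⟨fun c => g (a + (b - a) * Real.arccos c / Real.pi), by
      have := hg.continuous
      fun_prop⟩ with hG
  have hGmem : G ∈ (polynomialFunctions (Icc (-1 : ℝ) 1)).topologicalClosure := by
    rw [htop]; exact Algebra.mem_top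
  have key : J G = 0 := hker hGmem
  rw [← key, hJ]
  refine setIntegral_congr_fun measurableSet_Ioo fun x hx => ?_
  have hx' := hang x hx
  have e : a + (b - a) * angle a b x / Real.pi = x := by
    rw [angle]; field_simp; ring
  simp only [hG, ContinuousMap.coe_mk]
  rw [Real.arccos_cos hx'.1.le hx'.2.le, e, Complex.real_smul, mul_comm]

/-- The sine basis of `L²(a, b)`. -/
def sineBasis (hab : a < b) : HilbertBasis ℕ ℂ (Lp ℂ 2 (volume.restrict (Ioo a b))) :=
  HilbertBasis.mkOfOrthogonalEqBot (orthonormal_sineMode hab) (by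
    rw [Submodule.eq_bot_iff]
    intro x hx
    exact eq_zero_of_inner_sineMode hab fun k =>
      Submodule.inner_right_of_mem_orthogonal (Submodule.subset_span (mem_range_self k)) hx)

theorem sineBasis_apply (hab : a < b) (k : ℕ) : sineBasis hab k = sineMode a b k := by
  simp only [sineBasis, HilbertBasis.coe_mkOfOrthogonalEqBot]

/-- Limits of test functions satisfy ∫w = 0, so the primitive of w from a vanishes at both ends. Its
sine coefficients agree with those of v because no eigenvalue is zero. -/
theorem hasACRep_of_isLimitOfTests (hab : a < b) {v w : Lp ℂ 2 (volume.restrict (Ioo a b))}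
    (h : (Domain1D.dirichlet a b hab).IsLimitOfTests v w) :
    (Domain1D.dirichlet a b hab).HasACRep v w := by
  have hw0 : ∫ x in a..b, w x = 0 := by
    have := integral_mul_deriv_of_isLimitOfTests hab h (φ := fun _ => 1)
      (fun x => hasDerivAt_const x (1 : ℂ)) continuous_const
    simp only [mul_zero, integral_zero, mul_one] at this
    rw [← setIntegral_Ioo_eq hab]
    exact neg_eq_zero.1 this.symm
  set V : ℝ → ℂ := fun x => 0 + ∫ t in a..x, (Ioo a b).indicator w t with hVdef
  have hV : IsPrimitive V ((Ioo a b).indicator w) :=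
    IsPrimitive.of_integral (locallyIntegrable_indicator_Ioo w) 0 a
  have hVa : V a = 0 := by
    simp only [hVdef, intervalIntegral.integral_same, add_zero]
  have hVb : V b = 0 := by
    simp only [hVdef]
    rw [integral_indicator_Ioo ⟨hab.le, le_rfl⟩, hw0, add_zero]
  set v₀ : Lp ℂ 2 (volume.restrict (Ioo a b)) := (memLp_Ioo_of_continuous hV.continuous a b).toLp V
  have hv₀ : v₀ =ᵐ[volume.restrict (Ioo a b)] V := MemLp.coeFn_toLp _
  have hrep : (Domain1D.dirichlet a b hab).HasACRep v₀ w := ⟨V, hV, hv₀, hVa, hVb⟩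
  have hdiff : v - v₀ = 0 := by
    refine eq_zero_of_inner_sineMode hab fun k => ?_
    have h1 := inner_sineModeDeriv_of_isLimitOfTests hab k h
    rw [inner_sineModeDeriv_of_hasACRep hab k hrep] at h1
    have h3 : ((sinFreq a b k ^ 2 : ℝ) : ℂ) ≠ 0 :=
      Complex.ofReal_ne_zero.2 (pow_pos (sinFreq_pos hab k) 2).ne'
    rw [inner_sub_right, mul_left_cancel₀ h3 h1, sub_self]
  rw [sub_eq_zero.1 hdiff]
  exact hrep

theorem finite_sinFreq_sq_le (hab : a < b) (N : ℕ) :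
    {k : ℕ | sinFreq a b k ^ 2 ≤ N + 1}.Finite := by
  have h0 : 0 < b - a := sub_pos.2 hab
  obtain ⟨m, hm⟩ := exists_nat_ge ((N + 1) * ((b - a) / Real.pi) ^ 2)
  refine (finite_Iic m).subset fun k hk => ?_
  have hk : sinFreq a b k ^ 2 ≤ N + 1 := hk
  have h1 : ((k : ℝ) + 1) ^ 2 ≤ m := by
    refine le_trans ?_ hm
    have e : ((k : ℝ) + 1) ^ 2 = sinFreq a b k ^ 2 * ((b - a) / Real.pi) ^ 2 := by
      have := Real.pi_pos.ne'
      rw [sinFreq]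
      field_simp
    rw [e]
    gcongr
  have h2 : (k + 1) ^ 2 ≤ m := by exact_mod_cast h1
  rw [mem_Iic]
  nlinarith

theorem nonempty_spectralData_dirichlet (hab : a < b) :
    Nonempty (SpectralData (Domain1D.dirichlet a b hab)) := by
  have hinner : ∀ (k : ℕ) (v w : Lp ℂ 2 (volume.restrict (Ioo a b))),
      (Domain1D.dirichlet a b hab).HasACRep v w → (inner ℂ (sineModeDeriv a b k) w : ℂ) =
      ((sinFreq a b k ^ 2 : ℝ) : ℂ) * inner ℂ (sineBasis hab k) v := fun k v w h => by
    rw [sineBasis_apply]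
    exact inner_sineModeDeriv_of_hasACRep hab k h
  have hsum : ∀ (s : Finset ℕ) (c : ℕ → ℂ), (Domain1D.dirichlet a b hab).IsH1
      (∑ k ∈ s, c k • sineBasis hab k : Lp ℂ 2 (volume.restrict (Ioo a b)))
      (∑ k ∈ s, c k • sineModeDeriv a b k : Lp ℂ 2 (volume.restrict (Ioo a b))) := fun s c => by
    simp_rw [sineBasis_apply]
    exact isH1_sum_sineMode hab s c
  have hflow : ∀ t (v : Lp ℂ 2 (volume.restrict (Ioo a b))), dirichletFlow a b t v =
      ∑' k : ℕ, Complex.exp (Complex.I * ((-t * sinFreq a b k ^ 2 : ℝ) : ℂ)) •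
        ((inner ℂ (sineBasis hab k) v : ℂ) • sineBasis hab k) := fun t v => by
    simp_rw [sineBasis_apply]
    rfl
  exact SpectralData.nonempty_of_basis (S := Domain1D.dirichlet a b hab) (sineBasis hab)
    (sineModeDeriv a b) (fun k => sinFreq a b k ^ 2) (fun k => by positivity)
    (finite_sinFreq_sq_le hab) hinner
    (fun v w h => hasACRep_of_isLimitOfTests hab h.2)
    (fun v w w' h h' =>
      (hasACRep_of_isLimitOfTests hab h.2).unique (hasACRep_of_isLimitOfTests hab h'.2))
    hsum hflow

end dirichlet

/-! ### The whole line -/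

theorem hasACRep_line_iff {v w : Lp ℂ 2 (volume : Measure ℝ)} :
    Domain1D.line.HasACRep v w ↔ ∃ V : ℝ → ℂ, IsPrimitive V w ∧ v =ᵐ[volume] V := by
  have e : Domain1D.line.dom.indicator w = w := indicator_univ _
  constructor
  · rintro ⟨V, hV, hv, -⟩
    exact ⟨V, e ▸ hV, hv⟩
  · rintro ⟨V, hV, hv⟩
    exact ⟨V, e.symm ▸ hV, hv, trivial⟩

theorem locallyIntegrable_coeFn (w : Lp ℂ 2 (volume : Measure ℝ)) :
    LocallyIntegrable w volume := (Lp.memLp w).locallyIntegrable one_le_two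

/-! ### Functions with vanishing weak derivative on the line -/

section duBoisReymond

/-- A test function with vanishing integral is the derivative of a test function. -/
theorem exists_test_deriv_eq {ζ : ℝ → ℂ} (hζ : ContDiff ℝ ∞ ζ) (hζc : HasCompactSupport ζ)
    (h0 : ∫ x, ζ x = 0) :
    ∃ φ : ℝ → ℂ, ContDiff ℝ ∞ φ ∧ HasCompactSupport φ ∧ deriv φ = ζ := by
  obtain ⟨R, hR⟩ := hζc.isCompact.isBounded.subset_closedBall 0
  have hz : ∀ x, R < |x| → ζ x = 0 := fun x hx => by
    refine image_eq_zero_of_notMem_tsupport fun h => ?_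
    have := hR h
    rw [mem_closedBall_zero_iff, Real.norm_eq_abs] at this
    linarith
  have hd : ∀ x, HasDerivAt (fun x => ∫ t in (-(|R| + 1))..x, ζ t) (ζ x) x := fun x =>
    intervalIntegral.integral_hasDerivAt_right (hζ.continuous.intervalIntegrable _ _)
      (hζ.continuous.stronglyMeasurableAtFilter _ _) hζ.continuous.continuousAt
  have hder : deriv (fun x => ∫ t in (-(|R| + 1))..x, ζ t) = ζ := funext fun x => (hd x).deriv
  refine ⟨_, ?_, ?_, hder⟩
  · rw [contDiff_infty_iff_deriv, hder]
    exact ⟨fun x => (hd x).differentiableAt, hζ⟩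
  · refine HasCompactSupport.of_support_subset_isCompact
      (isCompact_Icc (a := -(|R| + 1)) (b := |R| + 1)) fun x hx => ?_
    by_contra hcon
    apply hx
    beta_reduce
    have hRR := le_abs_self R
    rw [mem_Icc, not_and_or, not_le, not_le] at hcon
    rcases hcon with h | h
    · rw [intervalIntegral.integral_symm, neg_eq_zero]
      refine (intervalIntegral.integral_congr (g := fun _ => 0) fun t ht => ?_).trans (by simp)
      rw [uIcc_of_le h.le] at ht
      exact hz t (by rw [lt_abs]; right; linarith [ht.2])
    · rw [← h0]
      refine intervalIntegral.integral_eq_integral_of_support_subset fun t ht => ?_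
      by_contra hcon
      apply ht
      refine hz t ?_
      rw [mem_Ioc, not_and_or, not_lt, not_le] at hcon
      rw [lt_abs]
      rcases hcon with h' | h'
      · right; linarith
      · left; linarith

theorem integrable_mul_of_hasCompactSupport {u : ℝ → ℂ} (hu : LocallyIntegrable u volume) {φ : ℝ → ℂ}
    (hφ : Continuous φ) (hφc : HasCompactSupport φ) : Integrable fun x => u x * φ x := by
  have := hu.integrable_smul_right_of_hasCompactSupport hφ hφc
  exact this

/-- The lemma of du Bois-Reymond. -/
theorem exists_ae_eq_const_of_integral_mul_deriv_eq_zero {u : ℝ → ℂ}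
    (hu : LocallyIntegrable u volume)
    (h : ∀ φ : ℝ → ℂ, ContDiff ℝ ∞ φ → HasCompactSupport φ → ∫ x, u x * deriv φ x = 0) :
    ∃ c : ℂ, ∀ᵐ x, u x = c := by
  let b : ContDiffBump (0 : ℝ) := ⟨1, 2, one_pos, one_lt_two⟩
  set ρ : ℝ → ℝ := b.normed volume
  have hρ : ContDiff ℝ ∞ ρ := b.contDiff_normed
  have hρc : HasCompactSupport ρ := b.hasCompactSupport_normed
  have hρ1 : ∫ x, ρ x = 1 := b.integral_normed
  set c : ℂ := ∫ x, u x * (ρ x : ℂ)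
  have hcast : ∀ {g : ℝ → ℝ}, ContDiff ℝ ∞ g → ContDiff ℝ ∞ fun x => (g x : ℂ) := fun hg =>
    Complex.ofRealCLM.contDiff.comp hg
  have hcastc : ∀ {g : ℝ → ℝ}, HasCompactSupport g → HasCompactSupport fun x => (g x : ℂ) :=
    fun hg => hg.comp_left Complex.ofReal_zero
  refine ⟨c, ?_⟩
  have key : ∀ᵐ x, u x - c = 0 := by
    refine ae_eq_zero_of_integral_contDiff_smul_eq_zero
      (hu.sub (locallyIntegrable_const c)) fun g hg hgc => ?_
    have hgi : Integrable fun x => (g x : ℂ) := (hcast hg).continuous.integrable_of_hasCompactSupport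
      (hcastc hgc)
    have hρi : Integrable fun x => (ρ x : ℂ) :=
      (hcast hρ).continuous.integrable_of_hasCompactSupport (hcastc hρc)
    set I : ℂ := ∫ x, (g x : ℂ)
    have hρ1' : ∫ x, (ρ x : ℂ) = 1 := by
      rw [integral_complex_ofReal, hρ1, Complex.ofReal_one]
    -- Subtracting (∫g)ρ from g leaves integral zero, so the difference is an admissible derivative.
    obtain ⟨φ, hφ, hφc, hφd⟩ := exists_test_deriv_eq (ζ := fun x => (g x : ℂ) - I * (ρ x : ℂ))
      ((hcast hg).sub (contDiff_const.mul (hcast hρ))) ((hcastc hgc).sub ((hcastc hρc).mul_left))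
      (by rw [integral_sub hgi (hρi.const_mul I), integral_const_mul, hρ1', mul_one, sub_self])
    have h1 := h φ hφ hφc
    rw [hφd] at h1
    have i1 := integrable_mul_of_hasCompactSupport hu (hcast hg).continuous (hcastc hgc)
    have i2 := integrable_mul_of_hasCompactSupport hu (hcast hρ).continuous (hcastc hρc)
    have e1 : ∫ x, u x * ((g x : ℂ) - I * (ρ x : ℂ)) = (∫ x, u x * (g x : ℂ)) - I * c := by
      rw [← integral_const_mul, ← integral_sub i1 (i2.const_mul I)]
      congr 1
      ext x
      ring
    have e2 : ∫ x, g x • (u x - c) = (∫ x, u x * (g x : ℂ)) - c * I := by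
      rw [← integral_const_mul, ← integral_sub i1 (hgi.const_mul c)]
      congr 1
      ext x
      rw [Complex.real_smul]
      ring
    rw [e2, mul_comm c I, ← e1, h1]
  exact key.mono fun x hx => sub_eq_zero.1 hx

end duBoisReymond

/-- Integration by parts against a function of compact support. -/
theorem IsPrimitive.integral_mul_deriv_of_hasCompactSupport {V w : ℝ → ℂ} (hV : IsPrimitive V w)
    {φ : ℝ → ℂ} (hφ : ContDiff ℝ ∞ φ) (hφc : HasCompactSupport φ) :
    ∫ x, V x * deriv φ x = - ∫ x, w x * φ x := by
  obtain ⟨R, hR⟩ := hφc.isCompact.isBounded.subset_closedBall 0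
  have hts : ∀ x ∈ tsupport φ, x ∈ Ioc (-(|R| + 1)) (|R| + 1) := fun x hx => by
    have h1 := hR hx
    rw [mem_closedBall_zero_iff, Real.norm_eq_abs, abs_le] at h1
    have := le_abs_self R
    exact ⟨by linarith [h1.1], by linarith [h1.2]⟩
  have hz : ∀ x, x ∉ Ioo (-(|R| + 1)) (|R| + 1) → φ x = 0 := fun x hx => by
    refine image_eq_zero_of_notMem_tsupport fun h => hx ?_
    have h1 := hR h
    rw [mem_closedBall_zero_iff, Real.norm_eq_abs, abs_le] at h1
    have := le_abs_self R
    exact ⟨by linarith [h1.1], by linarith [h1.2]⟩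
  have h1 := hV.integral_mul_deriv (fun x => (hφ.differentiable (by simp) x).hasDerivAt)
    (hφ.continuous_deriv (by simp)) (-(|R| + 1)) (|R| + 1)
  rw [hz (|R| + 1) (by simp), hz (-(|R| + 1)) (by simp), mul_zero, mul_zero, sub_self, zero_sub] at h1
  have e1 : ∫ x in (-(|R| + 1))..(|R| + 1), V x * deriv φ x = ∫ x, V x * deriv φ x :=
    intervalIntegral.integral_eq_integral_of_support_subset fun x hx =>
      hts x (support_deriv_subset (right_ne_zero_of_mul hx))
  have e2 : ∫ x in (-(|R| + 1))..(|R| + 1), w x * φ x = ∫ x, w x * φ x :=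
    intervalIntegral.integral_eq_integral_of_support_subset fun x hx =>
      hts x (subset_tsupport _ (right_ne_zero_of_mul hx))
  rw [← e1, ← e2, h1]

/-- The lemma of du Bois-Reymond applies to the difference of v and a primitive of w. -/
theorem hasACRep_line_of_hasWeakDeriv {v w : Lp ℂ 2 (volume : Measure ℝ)}
    (h : Domain1D.line.HasWeakDeriv v w) : Domain1D.line.HasACRep v w := by
  set V : ℝ → ℂ := fun x => 0 + ∫ t in (0 : ℝ)..x, w t
  have hV : IsPrimitive V w := IsPrimitive.of_integral (locallyIntegrable_coeFn w) 0 0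
  have hVl : LocallyIntegrable V volume := hV.continuous.locallyIntegrable
  obtain ⟨c, hc⟩ := exists_ae_eq_const_of_integral_mul_deriv_eq_zero
    (u := fun x => v x - V x) ((locallyIntegrable_coeFn v).sub hVl) fun φ hφ hφc => by
      have hd := hφ.continuous_deriv (by simp)
      have h1 : ∫ x, v x * deriv φ x = - ∫ x, w x * φ x := h φ ⟨hφ, hφc⟩
      simp only [sub_mul]
      rw [integral_sub (integrable_mul_of_hasCompactSupport (locallyIntegrable_coeFn v) hd hφc.deriv)
        (integrable_mul_of_hasCompactSupport hVl hd hφc.deriv), h1,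
        hV.integral_mul_deriv_of_hasCompactSupport hφ hφc, sub_self]
  refine hasACRep_line_iff.2 ⟨fun x => c + V x, ⟨hV.locallyIntegrable, fun x y => ?_⟩, ?_⟩
  · rw [add_sub_add_left_eq_sub, hV.sub_eq]
  · exact hc.mono fun x hx => by rw [← hx]; ring

theorem isH1_line_iff {v w : Lp ℂ 2 (volume : Measure ℝ)} :
    Domain1D.line.IsH1 v w ↔ ∀ φ : ℝ → ℂ, ContDiff ℝ ∞ φ → HasCompactSupport φ →
      ∫ x, v x * deriv φ x = - ∫ x, w x * φ x :=
  ⟨fun h φ hφ hφc => h.1 φ ⟨hφ, hφc⟩, fun h => ⟨fun φ hφ => h φ hφ.1 hφ.2, trivial⟩⟩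

/-- The Sobolev bound holds almost everywhere, hence on a dense set, and continuity extends it to
every point. Boundedness makes the boundary terms against Schwartz functions vanish at infinity. -/
theorem norm_le_of_hasACRep_line {v w : Lp ℂ 2 (volume : Measure ℝ)} {V : ℝ → ℂ}
    (hV : IsPrimitive V w) (hv : v =ᵐ[volume] V) : ∃ C : ℝ, ∀ x, ‖V x‖ ≤ C := by
  obtain ⟨C, -, hC⟩ := Domain1D.line.exists_forall_norm_le
  have h1 : ∀ᵐ x ∂(volume : Measure ℝ), ‖v x‖ ≤ C * (1 + ‖v‖ ^ 2 + ‖w‖ ^ 2) :=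
    hC v w (hasACRep_line_iff.2 ⟨V, hV, hv⟩)
  refine ⟨C * (1 + ‖v‖ ^ 2 + ‖w‖ ^ 2), fun x => ?_⟩
  have h2 : ∀ᵐ x ∂(volume : Measure ℝ), ‖V x‖ ≤ C * (1 + ‖v‖ ^ 2 + ‖w‖ ^ 2) := by
    filter_upwards [h1, hv] with x h1 h2
    rwa [← h2]
  have h3 := (Measure.dense_of_ae h2).closure_eq
  rw [(isClosed_le hV.continuous.norm continuous_const).closure_eq] at h3
  exact h3.ge (mem_univ x)

/-- Integration by parts against Schwartz functions. -/
theorem integral_mul_deriv_schwartz {v w : Lp ℂ 2 (volume : Measure ℝ)}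
    (h : Domain1D.line.HasACRep v w) (ψ : SchwartzMap ℝ ℂ) :
    ∫ x, v x * conj (deriv ψ x) = - ∫ x, w x * conj (ψ x) := by
  obtain ⟨V, hV, hv⟩ := hasACRep_line_iff.1 h
  obtain ⟨C, hC⟩ := norm_le_of_hasACRep_line hV hv
  have hd : ∀ x, HasDerivAt (fun x => conj (ψ x)) (conj (deriv ψ x)) x := fun x =>
    (ψ.hasDerivAt x).star
  have hdc : Continuous fun x => conj (deriv ψ x) :=
    Complex.continuous_conj.comp (SchwartzMap.derivCLM ℂ ℂ ψ).continuous
  have hconj : ∀ (f : SchwartzMap ℝ ℂ) (u : Lp ℂ 2 (volume : Measure ℝ)),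
      Integrable fun x => u x * conj (f x) := fun f u =>
    (Lp.memLp u).integrable_mul (f.memLp 2 volume).star
  have i1 : Integrable fun x => V x * conj (deriv ψ x) :=
    (hconj (SchwartzMap.derivCLM ℂ ℂ ψ) v).congr (hv.mono fun x hx => by
      simp only [hx, SchwartzMap.derivCLM_apply])
  have e1 : ∫ x, v x * conj (deriv ψ x) = ∫ x, V x * conj (deriv ψ x) :=
    integral_congr_ae (hv.mono fun x hx => by simp only [hx])
  rw [e1]
  have t1 := intervalIntegral_tendsto_integral i1 tendsto_neg_atTop_atBot tendsto_id
  have t2 := intervalIntegral_tendsto_integral (hconj ψ w) tendsto_neg_atTop_atBot tendsto_id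
  have t3 : ∀ l : Filter ℝ, l ≤ cocompact ℝ → Tendsto (fun R => V R * conj (ψ R)) l (𝓝 0) := by
    intro l hl
    have h1 : Tendsto (fun R => C * ‖ψ R‖) l (𝓝 0) := by
      have := ((ψ.toZeroAtInfty.zero_at_infty').mono_left hl).norm.const_mul C
      simpa using this
    refine squeeze_zero_norm (fun R => ?_) h1
    rw [norm_mul, RCLike.norm_conj]
    gcongr
    exact hC R
  have t4 := (t3 atTop atTop_le_cocompact).sub
    ((t3 atBot atBot_le_cocompact).comp tendsto_neg_atTop_atBot)
  rw [sub_zero] at t4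
  refine tendsto_nhds_unique t1 ?_
  have t5 := t4.sub t2
  rw [zero_sub] at t5
  refine t5.congr fun R => ?_
  exact (hV.integral_mul_deriv hd hdc (-R) R).symm

theorem fourier_deriv_schwartz (ψ : SchwartzMap ℝ ℂ) (ξ : ℝ) :
    𝓕 (SchwartzMap.derivCLM ℂ ℂ ψ) ξ = 2 * Real.pi * Complex.I * ξ * 𝓕 ψ ξ := by
  have := congrFun (Real.fourier_deriv ψ.integrable ψ.differentiable
    (SchwartzMap.derivCLM ℂ ℂ ψ).integrable) ξ
  exact this

/-- Plancherel's formula for the pairing with a Schwartz function. -/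
theorem integral_mul_conj_schwartz (v : Lp ℂ 2 (volume : Measure ℝ)) (ψ : SchwartzMap ℝ ℂ) :
    ∫ x, v x * conj (ψ x) = ∫ ξ, (𝓕 v : Lp ℂ 2 (volume : Measure ℝ)) ξ * conj (𝓕 ψ ξ) := by
  have h : ∀ (u : Lp ℂ 2 (volume : Measure ℝ)) (f : SchwartzMap ℝ ℂ),
      ∫ x, u x * conj (f x) = inner ℂ (f.toLp 2) u := fun u f =>
    (inner_toLp_eq_integral (f.memLp 2 volume) u).symm
  rw [h, h, ← SchwartzMap.toLp_fourier_eq, Lp.inner_fourier_eq]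

/-- Integration by parts against the inverse transform of an arbitrary test function η becomes, by
Plancherel, the claimed identity tested against η. -/
theorem fourier_ae_eq_of_hasACRep {v w : Lp ℂ 2 (volume : Measure ℝ)}
    (h : Domain1D.line.HasACRep v w) :
    ∀ᵐ ξ, (𝓕 w : Lp ℂ 2 (volume : Measure ℝ)) ξ =
      2 * Real.pi * Complex.I * ξ * (𝓕 v : Lp ℂ 2 (volume : Measure ℝ)) ξ := by
  set f := (𝓕 v : Lp ℂ 2 (volume : Measure ℝ))
  set g := (𝓕 w : Lp ℂ 2 (volume : Measure ℝ))
  have hfl : LocallyIntegrable (fun ξ : ℝ => 2 * Real.pi * Complex.I * ξ * f ξ) volume := by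
    have := (locallyIntegrable_coeFn f).continuous_smul
      (g := fun ξ : ℝ => (2 * Real.pi * Complex.I * ξ : ℂ)) (by fun_prop)
    exact this
  have key : ∀ᵐ ξ, g ξ - 2 * Real.pi * Complex.I * ξ * f ξ = 0 := by
    refine ae_eq_zero_of_integral_contDiff_smul_eq_zero
      ((locallyIntegrable_coeFn g).sub hfl) fun η hη hηc => ?_
    have hηC : ContDiff ℝ ∞ fun x => (η x : ℂ) := Complex.ofRealCLM.contDiff.comp hη
    have hηCc : HasCompactSupport fun x => (η x : ℂ) := hηc.comp_left Complex.ofReal_zero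
    set ψ : SchwartzMap ℝ ℂ := 𝓕⁻ (hηCc.toSchwartzMap hηC)
    have hψ : ∀ ξ, 𝓕 ψ ξ = (η ξ : ℂ) := fun ξ => by
      simp only [ψ, FourierTransform.fourier_fourierInv_eq]; rfl
    have h1 := integral_mul_deriv_schwartz h ψ
    have h2 := integral_mul_conj_schwartz v (SchwartzMap.derivCLM ℂ ℂ ψ)
    have h3 := integral_mul_conj_schwartz w ψ
    simp only [SchwartzMap.derivCLM_apply] at h2
    rw [h2, h3] at h1
    simp only [fourier_deriv_schwartz, hψ] at h1
    have e : ∀ ξ : ℝ, η ξ • (g ξ - 2 * Real.pi * Complex.I * ξ * f ξ) =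
        g ξ * (η ξ : ℂ) - (2 * Real.pi * Complex.I * ξ * f ξ) * (η ξ : ℂ) := fun ξ => by
      rw [Complex.real_smul]; ring
    simp only [e]
    rw [integral_sub (integrable_mul_of_hasCompactSupport (locallyIntegrable_coeFn g)
      hηC.continuous hηCc) (integrable_mul_of_hasCompactSupport hfl hηC.continuous hηCc)]
    simp only [map_mul, Complex.conj_ofReal, Complex.conj_I, map_ofNat] at h1
    rw [← neg_eq_iff_eq_neg] at h1
    rw [← h1, ← integral_neg, sub_eq_zero]
    congr 1
    ext ξ
    ring
  exact key.mono fun ξ hξ => sub_eq_zero.1 hξ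

theorem isH1_line_of_fourier_ae_eq {v w : Lp ℂ 2 (volume : Measure ℝ)}
    (h : ∀ᵐ ξ, (𝓕 w : Lp ℂ 2 (volume : Measure ℝ)) ξ =
      2 * Real.pi * Complex.I * ξ * (𝓕 v : Lp ℂ 2 (volume : Measure ℝ)) ξ) :
    Domain1D.line.IsH1 v w := by
  refine isH1_line_iff.2 fun φ hφ hφc => ?_
  have hφC : ContDiff ℝ ∞ fun x => conj (φ x) := Complex.conjCLE.contDiff.comp hφ
  have hφCc : HasCompactSupport fun x => conj (φ x) := hφc.comp_left (map_zero _)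
  set ψ : SchwartzMap ℝ ℂ := hφCc.toSchwartzMap hφC
  have hψ : ∀ x, conj (ψ x) = φ x := fun x => Complex.conj_conj _
  have hψ' : ∀ x, conj (SchwartzMap.derivCLM ℂ ℂ ψ x) = deriv φ x := fun x => by
    have h1 : HasDerivAt ψ (conj (deriv φ x)) x :=
      ((hφ.differentiable (by simp) x).hasDerivAt).star
    rw [SchwartzMap.derivCLM_apply, h1.deriv, Complex.conj_conj]
  have h2 := integral_mul_conj_schwartz v (SchwartzMap.derivCLM ℂ ℂ ψ)
  have h3 := integral_mul_conj_schwartz w ψ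
  simp only [hψ'] at h2
  simp only [hψ] at h3
  rw [h2, h3, ← integral_neg]
  refine integral_congr_ae (h.mono fun ξ hξ => ?_)
  simp only [hξ, fourier_deriv_schwartz, map_mul, Complex.conj_ofReal, Complex.conj_I, map_ofNat]
  ring

/-! ### Fourier multipliers on the line -/

section multiplier

/-- `L²(ℝ)`. -/
abbrev LineL2 : Type := Lp ℂ 2 (volume : Measure ℝ)

theorem fourier_ext {v w : LineL2} (h : (𝓕 v : LineL2) =ᵐ[volume] (𝓕 w : LineL2)) : v = w :=
  (Lp.fourierTransformₗᵢ ℝ ℂ).injective (Lp.ext h)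

theorem inner_eq_integral_fourier (v w : LineL2) :
    (inner ℂ v w : ℂ) = ∫ ξ, conj ((𝓕 v : LineL2) ξ) * (𝓕 w : LineL2) ξ := by
  rw [← Lp.inner_fourier_eq, inner_eq_integral]

theorem norm_le_of_norm_fourier_le {v w : LineL2} {c : ℝ}
    (h : ∀ᵐ ξ, ‖(𝓕 v : LineL2) ξ‖ ≤ c * ‖(𝓕 w : LineL2) ξ‖) : ‖v‖ ≤ c * ‖w‖ := by
  have := Lp.norm_le_mul_norm_of_ae_le_mul h
  rwa [Lp.norm_fourier_eq, Lp.norm_fourier_eq] at this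

theorem coeFn_fourier_sub (v w : LineL2) :
    (𝓕 (v - w) : LineL2) =ᵐ[volume] fun ξ => (𝓕 v : LineL2) ξ - (𝓕 w : LineL2) ξ := by
  have : (𝓕 (v - w) : LineL2) = 𝓕 v - 𝓕 w := (Lp.fourierTransformₗᵢ ℝ ℂ).map_sub v w
  rw [this]
  exact Lp.coeFn_sub _ _

theorem coeFn_fourier_smul (c : ℂ) (v : LineL2) :
    (𝓕 (c • v) : LineL2) =ᵐ[volume] fun ξ => c * (𝓕 v : LineL2) ξ := by
  have : (𝓕 (c • v) : LineL2) = c • 𝓕 v := (Lp.fourierTransformₗᵢ ℝ ℂ).map_smul c v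
  rw [this]
  exact Lp.coeFn_smul _ _

/-- Bounded Fourier multipliers. -/
theorem exists_fourierMultiplier {m : ℝ → ℂ} (hm : Measurable m) {C : ℝ} (hC : ∀ ξ, ‖m ξ‖ ≤ C) :
    ∃ M : LineL2 →L[ℂ] LineL2, ∀ v,
      (𝓕 (M v) : LineL2) =ᵐ[volume] fun ξ => m ξ * (𝓕 v : LineL2) ξ := by
  have hmem : ∀ v : LineL2, MemLp (fun ξ => m ξ * v ξ) 2 volume := fun v =>
    (Lp.memLp v).of_le_mul (c := C) (hm.aestronglyMeasurable.mul (Lp.aestronglyMeasurable v))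
      (ae_of_all _ fun ξ => by rw [norm_mul]; gcongr; exact hC ξ)
  set L : LineL2 →ₗ[ℂ] LineL2 :=
    { toFun := fun v => (hmem v).toLp _
      map_add' := fun v w => by
        refine Lp.ext ?_
        filter_upwards [(hmem (v + w)).coeFn_toLp, (hmem v).coeFn_toLp, (hmem w).coeFn_toLp,
          Lp.coeFn_add v w, Lp.coeFn_add ((hmem v).toLp _) ((hmem w).toLp _)] with ξ h1 h2 h3 h4 h5
        rw [h1, h5, Pi.add_apply, h2, h3, h4, Pi.add_apply, mul_add]
      map_smul' := fun c v => by
        refine Lp.ext ?_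
        filter_upwards [(hmem (c • v)).coeFn_toLp, (hmem v).coeFn_toLp,
          Lp.coeFn_smul c v, Lp.coeFn_smul c ((hmem v).toLp _)] with ξ h1 h2 h3 h4
        rw [RingHom.id_apply, h1, h4, Pi.smul_apply, h2, h3, Pi.smul_apply, smul_eq_mul,
          smul_eq_mul, mul_left_comm] } with hL
  have hLc : ∀ v, L v =ᵐ[volume] fun ξ => m ξ * v ξ := fun v => (hmem v).coeFn_toLp
  have hLn : ∀ v, ‖L v‖ ≤ C * ‖v‖ := fun v => by
    refine Lp.norm_le_mul_norm_of_ae_le_mul ((hLc v).mono fun ξ hξ => ?_)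
    rw [hξ, norm_mul]
    gcongr
    exact hC ξ
  set F := Lp.fourierTransformₗᵢ ℝ ℂ
  refine ⟨(F.symm : LineL2 →L[ℂ] LineL2) ∘L (L.mkContinuous C hLn) ∘L (F : LineL2 →L[ℂ] LineL2),
    fun v => ?_⟩
  have e : (𝓕 (((F.symm : LineL2 →L[ℂ] LineL2) ∘L (L.mkContinuous C hLn) ∘L
      (F : LineL2 →L[ℂ] LineL2)) v) : LineL2) = L (𝓕 v) :=
    F.apply_symm_apply _
  rw [e]
  exact hLc _

/-- The free flow on the line, as an isometry. -/
theorem exists_isometry_lineFlow (t : ℝ) :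
    ∃ A : LineL2 →ₗᵢ[ℂ] LineL2, (∀ v, A v = lineFlow t v) ∧ ∀ v, (𝓕 (A v) : LineL2) =ᵐ[volume]
      fun ξ => Complex.exp (Complex.I * ((-t * (2 * Real.pi * ξ) ^ 2 : ℝ) : ℂ)) *
        (𝓕 v : LineL2) ξ := by
  have hθ : AEStronglyMeasurable (fun ξ : ℝ => -t * (2 * Real.pi * ξ) ^ 2) volume :=
    Continuous.aestronglyMeasurable (by fun_prop)
  have hF : ∀ v, (𝓕 (lineFlow t v) : LineL2) = phaseMul _ hθ (𝓕 v) := fun v =>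
    (Lp.fourierTransformₗᵢ ℝ ℂ).apply_symm_apply _
  have hc : ∀ v, (𝓕 (lineFlow t v) : LineL2) =ᵐ[volume]
      fun ξ => Complex.exp (Complex.I * ((-t * (2 * Real.pi * ξ) ^ 2 : ℝ) : ℂ)) *
        (𝓕 v : LineL2) ξ := fun v => by
    rw [hF]
    exact coeFn_phaseMul _ hθ _
  have hadd : ∀ v w : LineL2, (𝓕 (v + w) : LineL2) =ᵐ[volume]
      fun ξ => (𝓕 v : LineL2) ξ + (𝓕 w : LineL2) ξ := fun v w => by
    have : (𝓕 (v + w) : LineL2) = 𝓕 v + 𝓕 w := (Lp.fourierTransformₗᵢ ℝ ℂ).map_add v w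
    rw [this]
    exact Lp.coeFn_add _ _
  refine ⟨⟨{ toFun := lineFlow t, map_add' := fun v w => ?_, map_smul' := fun c v => ?_ },
    fun v => ?_⟩, fun v => rfl, hc⟩
  · refine fourier_ext ?_
    filter_upwards [hc (v + w), hc v, hc w, hadd v w, hadd (lineFlow t v) (lineFlow t w)]
      with ξ h1 h2 h3 h4 h5
    rw [h1, h5, h2, h3, h4, mul_add]
  · refine fourier_ext ?_
    filter_upwards [hc (c • v), hc v, coeFn_fourier_smul c v, coeFn_fourier_smul c (lineFlow t v)]
      with ξ h1 h2 h3 h4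
    rw [RingHom.id_apply, h1, h4, h2, h3, mul_left_comm]
  · change ‖lineFlow t v‖ = ‖v‖
    rw [← Lp.norm_fourier_eq, hF, norm_phaseMul, Lp.norm_fourier_eq]

theorem norm_two_pi_I_mul_sq (ξ : ℝ) :
    ‖(2 * Real.pi * Complex.I * ξ : ℂ)‖ ^ 2 = (2 * Real.pi * ξ) ^ 2 := by
  rw [norm_mul, norm_mul, norm_mul, Complex.norm_I, Complex.norm_real, Complex.norm_real,
    Complex.norm_ofNat, mul_one, mul_pow, mul_pow, Real.norm_eq_abs, Real.norm_eq_abs, sq_abs,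
    sq_abs]
  ring

/-- A multiplier that is controlled by the symbol of the derivative. -/
theorem norm_le_of_norm_fourier_sq_le {v w z : LineL2} (h : Domain1D.line.HasACRep v w) {c : ℝ}
    (hc : 0 ≤ c) (hz : ∀ᵐ ξ, ‖(𝓕 z : LineL2) ξ‖ ^ 2 ≤
      c * ((2 * Real.pi * ξ) ^ 2 * ‖(𝓕 v : LineL2) ξ‖ ^ 2)) : ‖z‖ ≤ √c * ‖w‖ := by
  refine norm_le_of_norm_fourier_le ?_
  filter_upwards [hz, fourier_ae_eq_of_hasACRep h] with ξ h1 h2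
  refine le_of_sq_le_sq ?_ (by positivity)
  rw [mul_pow, Real.sq_sqrt hc, h2, norm_mul, mul_pow, norm_two_pi_I_mul_sq]
  exact h1

end multiplier

theorem hasDerivAt_of_norm_sub_le {E : Type*} [NormedAddCommGroup E] [NormedSpace ℝ E]
    {f : ℝ → E} {f' : E} {s C : ℝ} (h : ∀ r, ‖f (s + r) - f s - r • f'‖ ≤ C * r ^ 2) :
    HasDerivAt f f' s := by
  rw [hasDerivAt_iff_isLittleO_nhds_zero]
  have h1 : (fun r => f (s + r) - f s - r • f') =O[𝓝 0] fun r : ℝ => r ^ 2 :=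
    Asymptotics.IsBigO.of_bound C (Eventually.of_forall fun r => by
      rw [Real.norm_of_nonneg (sq_nonneg r)]
      exact h r)
  refine h1.trans_isLittleO ?_
  have := Asymptotics.isLittleO_pow_pow (𝕜 := ℝ) one_lt_two
  simpa using this

theorem weakDeriv_eq_of_isH1 {S : Domain1D} {v w : S.L2} (h : S.IsH1 v w)
    (hrep : ∀ w', S.IsH1 v w' → S.HasACRep v w') : S.weakDeriv v = w := by
  have hm : S.MemH1 v := ⟨w, h⟩
  rw [Domain1D.weakDeriv, dif_pos hm]
  exact (hrep _ (Classical.choose_spec hm)).unique (hrep _ h)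

/-- Every operator is a Fourier multiplier, with truncation to (2πξ)² ≤ N + 1, so the required
identities and bounds reduce to statements about symbols at almost every frequency. -/
theorem nonempty_spectralData_line : Nonempty (SpectralData Domain1D.line) := by
  set lam : ℝ → ℝ := fun ξ => (2 * Real.pi * ξ) ^ 2 with hlam
  have hlam0 : ∀ ξ, 0 ≤ lam ξ := fun ξ => sq_nonneg _
  have hlamc : Continuous lam := by simp only [hlam]; fun_prop
  have hms : ∀ N : ℕ, MeasurableSet {ξ | lam ξ ≤ N + 1} := fun N =>
    measurableSet_le hlamc.measurable measurable_const
  have hif : ∀ (N : ℕ) {f : ℝ → ℂ}, Continuous f →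
      Measurable fun ξ => if lam ξ ≤ N + 1 then f ξ else 0 := fun N f hf =>
    Measurable.ite (hms N) hf.measurable measurable_const
  choose A hA hAc using exists_isometry_lineFlow
  have hP : ∀ N : ℕ, ∃ P : LineL2 →L[ℂ] LineL2, ∀ v, (𝓕 (P v) : LineL2) =ᵐ[volume]
      fun ξ => (if lam ξ ≤ N + 1 then 1 else 0) * (𝓕 v : LineL2) ξ := fun N =>
    exists_fourierMultiplier (hif N continuous_const) (C := 1) fun ξ => by
      split_ifs <;> simp
  choose P hPc using hP
  have hΛ : ∀ N : ℕ, ∃ Λ : LineL2 →L[ℂ] LineL2, ∀ v, (𝓕 (Λ v) : LineL2) =ᵐ[volume]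
      fun ξ => (if lam ξ ≤ N + 1 then (lam ξ : ℂ) else 0) * (𝓕 v : LineL2) ξ := fun N =>
    exists_fourierMultiplier (hif N (Complex.continuous_ofReal.comp hlamc)) (C := N + 1) fun ξ => by
      split_ifs with h
      · rwa [Complex.norm_real, Real.norm_of_nonneg (hlam0 ξ)]
      · rw [norm_zero]; positivity
  choose Λ hΛc using hΛ
  have hD : ∀ N : ℕ, ∃ D : LineL2 →L[ℂ] LineL2, ∀ v, (𝓕 (D v) : LineL2) =ᵐ[volume]
      fun ξ => (if lam ξ ≤ N + 1 then (2 * Real.pi * Complex.I * ξ : ℂ) else 0) *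
        (𝓕 v : LineL2) ξ := fun N =>
    exists_fourierMultiplier (hif N (by fun_prop)) (C := N + 1) fun ξ => by
      split_ifs with h
      · refine le_of_sq_le_sq ?_ (by positivity)
        rw [norm_two_pi_I_mul_sq]
        -- The symbol has square at most N + 1, which is at most (N + 1)².
        have h' : (2 * Real.pi * ξ) ^ 2 ≤ N + 1 := h
        nlinarith [Nat.cast_nonneg (α := ℝ) N]
      · rw [norm_zero]; positivity
  choose D hDc using hD
  have hPH1 : ∀ N v, Domain1D.line.IsH1 (P N v) (D N v) := fun N v =>
    isH1_line_of_fourier_ae_eq (by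
      filter_upwards [hPc N v, hDc N v] with ξ h1 h2
      rw [h1, h2]
      split_ifs <;> simp)
  have hrep : ∀ v w : LineL2, Domain1D.line.IsH1 v w → Domain1D.line.HasACRep v w :=
    fun v w h => hasACRep_line_of_hasWeakDeriv h.1
  have hsymm : ∀ (M : LineL2 →L[ℂ] LineL2) (m : ℝ → ℂ), (∀ ξ, conj (m ξ) = m ξ) →
      (∀ v, (𝓕 (M v) : LineL2) =ᵐ[volume] fun ξ => m ξ * (𝓕 v : LineL2) ξ) →
      ∀ v w, (inner ℂ (M v) w : ℂ) = inner ℂ v (M w) := fun M m hm hM v w => by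
    rw [inner_eq_integral_fourier, inner_eq_integral_fourier]
    refine integral_congr_ae ?_
    filter_upwards [hM v, hM w] with ξ h1 h2
    rw [h1, h2, map_mul, hm]
    ring
  have hAadd : ∀ s t v, A (s + t) v = A s (A t v) := fun s t v => fourier_ext (by
    filter_upwards [hAc (s + t) v, hAc s (A t v), hAc t v] with ξ h1 h2 h3
    rw [h1, h2, h3, ← mul_assoc, ← Complex.exp_add]
    congr 2
    push_cast
    ring)
  have hAzero : ∀ v, A 0 v = v := fun v => fourier_ext (by
    filter_upwards [hAc 0 v] with ξ h1
    rw [h1]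
    simp)
  have hPn : ∀ N v, ‖P N v‖ ≤ ‖v‖ := fun N v => by
    rw [← one_mul ‖v‖]
    refine norm_le_of_norm_fourier_le ((hPc N v).mono fun ξ hξ => ?_)
    rw [hξ, norm_mul]
    gcongr
    split_ifs <;> simp
  have hPt : ∀ v, Tendsto (fun N => P N v) atTop (𝓝 v) := fun v => by
    rw [tendsto_iff_norm_sub_tendsto_zero]
    have h1 : ∀ N, ‖P N v - v‖ ^ 2 =
        ∫ ξ, (if lam ξ ≤ N + 1 then 0 else ‖(𝓕 v : LineL2) ξ‖ ^ 2) := fun N => by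
      rw [← Lp.norm_fourier_eq, norm_sq_eq_integral]
      refine integral_congr_ae ?_
      filter_upwards [coeFn_fourier_sub (P N v) v, hPc N v] with ξ h1 h2
      rw [h1, h2]
      split_ifs <;> simp
    have h2 : Tendsto (fun N : ℕ => ‖P N v - v‖ ^ 2) atTop (𝓝 (∫ _ : ℝ, (0 : ℝ))) := by
      simp_rw [h1]
      refine tendsto_integral_of_dominated_convergence (fun ξ => ‖(𝓕 v : LineL2) ξ‖ ^ 2)
        (fun N => ?_) (integrable_norm_sq _) (fun N => ae_of_all _ fun ξ => ?_)
        (ae_of_all _ fun ξ => ?_)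
      · have := (integrable_norm_sq (𝓕 v : LineL2)).aestronglyMeasurable.indicator (hms N).compl
        refine this.congr (ae_of_all _ fun ξ => ?_)
        by_cases h : lam ξ ≤ N + 1 <;> simp [indicator, h]
      · split_ifs
        · simp
        · simp
      · obtain ⟨N₀, hN₀⟩ := exists_nat_ge (lam ξ)
        refine tendsto_const_nhds.congr' ?_
        filter_upwards [eventually_ge_atTop N₀] with N hN
        have : (N₀ : ℝ) ≤ N := by exact_mod_cast hN
        rw [if_pos (by linarith)]
    rw [integral_zero] at h2
    have h3 := (Real.continuous_sqrt.tendsto 0).comp h2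
    rw [Real.sqrt_zero] at h3
    exact h3.congr fun N => Real.sqrt_sq (norm_nonneg _)
  have hPΛ : ∀ N v, P N (Λ N v) = Λ N v := fun N v => fourier_ext (by
    filter_upwards [hPc N (Λ N v), hΛc N v] with ξ h1 h2
    rw [h1, h2]
    split_ifs <;> simp)
  have hPA : ∀ N s v, P N (A s (P N v)) = A s (P N v) := fun N s v => fourier_ext (by
    filter_upwards [hPc N (A s (P N v)), hAc s (P N v), hPc N v] with ξ h1 h2 h3
    rw [h1, h2, h3]
    split_ifs <;> simp)
  have hΛA : ∀ N s v, Λ N (A s (P N v)) = A s (Λ N v) := fun N s v => fourier_ext (by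
    filter_upwards [hΛc N (A s (P N v)), hAc s (P N v), hPc N v, hAc s (Λ N v), hΛc N v]
      with ξ h1 h2 h3 h4 h5
    rw [h1, h2, h3, h4, h5]
    split_ifs
    · ring
    · simp)
  have hder : ∀ N v s, HasDerivAt (fun s => A s (P N v)) (-Complex.I • A s (Λ N v)) s :=
    fun N v s => by
    -- The constant is that of the second-order phase remainder with the eigenvalue bounded by N + 1
    -- on the truncated frequencies.
    refine hasDerivAt_of_norm_sub_le (C := 2 * ((N : ℝ) + 1) ^ 2 * ‖v‖) fun r => ?_
    have e : 2 * ((N : ℝ) + 1) ^ 2 * ‖v‖ * r ^ 2 = (2 * (r * ((N : ℝ) + 1)) ^ 2) * ‖v‖ := by ring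
    have e' : r • (-Complex.I • A s (Λ N v)) = ((r : ℂ) * -Complex.I) • A s (Λ N v) := by
      rw [mul_smul, Complex.coe_smul]
      rfl
    rw [e, e']
    refine norm_le_of_norm_fourier_le ?_
    filter_upwards [coeFn_fourier_sub (A (s + r) (P N v) - A s (P N v))
      (((r : ℂ) * -Complex.I) • A s (Λ N v)), coeFn_fourier_sub (A (s + r) (P N v)) (A s (P N v)),
      coeFn_fourier_smul ((r : ℂ) * -Complex.I) (A s (Λ N v)), hAc (s + r) (P N v),
      hAc s (P N v), hAc s (Λ N v), hPc N v, hΛc N v] with ξ h1 h2 h3 h4 h5 h6 h7 h8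
    rw [h1, h2, h3, h4, h5, h6, h7, h8]
    split_ifs with h
    · have e1 : Complex.exp (Complex.I * ((-(s + r) * (2 * Real.pi * ξ) ^ 2 : ℝ) : ℂ)) =
          Complex.exp (Complex.I * ((-s * (2 * Real.pi * ξ) ^ 2 : ℝ) : ℂ)) *
            Complex.exp (Complex.I * ((-r * lam ξ : ℝ) : ℂ)) := by
        rw [← Complex.exp_add]
        simp only [hlam]
        congr 1
        push_cast
        ring
      have e2 : ∀ E G z : ℂ, E * G * (1 * z) - E * (1 * z) -
          (r : ℂ) * -Complex.I * (E * ((lam ξ : ℂ) * z)) =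
          E * ((G - 1 - Complex.I * ((-r * lam ξ : ℝ) : ℂ)) * z) := fun E G z => by
        push_cast
        ring
      rw [e1, e2, norm_mul, mul_comm Complex.I, Complex.norm_exp_ofReal_mul_I, one_mul, norm_mul]
      gcongr
      refine (norm_exp_mul_I_sub_one_sub_le _).trans ?_
      rw [neg_mul, neg_sq, mul_pow, mul_pow]
      have := hlam0 ξ
      gcongr
    · simp only [zero_mul, mul_zero, sub_zero, norm_zero]
      positivity
  have htail : ∀ (N : ℕ) (v w : LineL2), Domain1D.line.HasACRep v w →
      ‖v - P N v‖ ≤ √(1 / ((N : ℝ) + 1)) * ‖w‖ := fun N v w h => by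
    refine norm_le_of_norm_fourier_sq_le h (by positivity) ?_
    filter_upwards [coeFn_fourier_sub v (P N v), hPc N v] with ξ h1 h2
    rw [h1, h2]
    split_ifs with hk
    · rw [one_mul, sub_self, norm_zero, zero_pow two_ne_zero]
      positivity
    · rw [zero_mul, sub_zero, ← mul_assoc]
      refine le_mul_of_one_le_left (by positivity) ?_
      rw [one_div, inv_mul_eq_div, one_le_div (by positivity)]
      exact (not_le.1 hk).le
  have hAsub : ∀ (t : ℝ) (v w : LineL2), Domain1D.line.HasACRep v w →
      ‖A t v - v‖ ≤ √(2 * |t|) * ‖w‖ := fun t v w h => by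
    refine norm_le_of_norm_fourier_sq_le h (by positivity) ?_
    filter_upwards [coeFn_fourier_sub (A t v) v, hAc t v] with ξ h1 h2
    rw [h1, h2, ← sub_one_mul, norm_mul, mul_pow, ← mul_assoc]
    gcongr
    refine (norm_exp_mul_I_sub_one_sq_le _).trans_eq ?_
    rw [abs_mul, abs_neg, abs_of_nonneg (sq_nonneg (2 * Real.pi * ξ))]
    ring
  have hweak : ∀ N (φ v w : LineL2), Domain1D.line.HasACRep v w →
      (inner ℂ (Domain1D.line.weakDeriv (P N φ) : LineL2) w : ℂ) = inner ℂ (Λ N φ) v :=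
    fun N φ v w h => by
    have h1 : (Domain1D.line.weakDeriv (P N φ) : LineL2) = D N φ :=
      weakDeriv_eq_of_isH1 (hPH1 N φ) fun w' => hrep _ w'
    refine (congrArg (fun z : LineL2 => (inner ℂ z w : ℂ)) h1).trans ?_
    rw [inner_eq_integral_fourier, inner_eq_integral_fourier]
    refine integral_congr_ae ?_
    filter_upwards [hDc N φ, hΛc N φ, fourier_ae_eq_of_hasACRep h] with ξ h1 h2 h3
    rw [h1, h2, h3]
    split_ifs
    · simp only [map_mul, Complex.conj_ofReal, Complex.conj_I, map_ofNat, hlam]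
      push_cast
      linear_combination (-(4 * Real.pi ^ 2 * ξ ^ 2 * conj ((𝓕 φ : LineL2) ξ) *
        (𝓕 v : LineL2) ξ)) * Complex.I_mul_I
    · simp
  have hδ : Tendsto (fun N : ℕ => √(1 / ((N : ℝ) + 1))) atTop (𝓝 0) := by
    have := (Real.continuous_sqrt.tendsto 0).comp
      (tendsto_one_div_add_atTop_nhds_zero_nat (𝕜 := ℝ))
    rwa [Real.sqrt_zero] at this
  exact ⟨{
    A := A
    P := P
    Λ := Λ
    δ := fun N => √(1 / ((N : ℝ) + 1))
    A_eq := hA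
    A_add := hAadd
    A_zero := hAzero
    P_symm := fun N => hsymm (P N) _ (fun ξ => by split_ifs <;> simp) (hPc N)
    Λ_symm := fun N => hsymm (Λ N) _ (fun ξ => by split_ifs <;> simp) (hΛc N)
    norm_P_le := hPn
    tendsto_P := hPt
    P_Λ := hPΛ
    P_A := hPA
    Λ_A := hΛA
    hasDerivAt_A := hder
    tendsto_δ := hδ
    tail_le := htail
    norm_A_sub_le := hAsub
    hasACRep := hrep
    memH1_P := fun N v => ⟨_, hPH1 N v⟩
    inner_weakDeriv_P := hweak }⟩

theorem nonempty_spectralData (S : Domain1D) : Nonempty (SpectralData S) := by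
  cases S with
  | line => exact nonempty_spectralData_line
  | dirichlet a b hab => exact nonempty_spectralData_dirichlet hab
  | periodic a b hab => exact nonempty_spectralData_periodic hab

end ERLogSE

end

/-! ### The error bound on every domain -/

theorem theorem4p2 (S : ERLogSE.Domain1D) (n : ℕ) (hn : 2 ≤ n) (τ₀ : ℝ) (hτ₀ : 0 < τ₀) (M : ℝ) :
    ∃ ε₀ : ℝ, 0 < ε₀ ∧ ε₀ < 1 ∧
      ∀ T : ℝ, 0 < T → ∃ C : ℝ, 0 < C ∧
        ∀ ε : ℝ, 0 < ε → ε ≤ ε₀ →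
          ∀ (u₀ : S.L2) (u : ℝ → S.L2),
            ERLogSE.IsWeakSolution S n ε T u₀ u →
            S.linftyH1Norm T u ≤ ENNReal.ofReal M →
            ∀ τ : ℝ, 0 < τ → τ ≤ τ₀ → ∀ k : ℕ, (k : ℝ) * τ ≤ T →
              ‖ERLogSE.lieTrotter S n ε τ u₀ k - u ((k : ℝ) * τ)‖
                ≤ C * Real.log ε⁻¹ * τ ^ (1 / 2 : ℝ) := by
  obtain ⟨D⟩ := ERLogSE.nonempty_spectralData S
  refine ⟨1 / 3, by norm_num, by norm_num, fun T hT => ?_⟩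
  obtain ⟨C, hC, h⟩ := D.exists_error_bound n (by omega) M T hT
  refine ⟨C, hC, fun ε hε hε' u₀ u hu hM τ hτ _ k hk => ?_⟩
  rw [← Real.sqrt_eq_rpow]
  exact h ε hε hε' u₀ u hu hM τ hτ k hk
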